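/- Let $(M,g)$ and $(N,h)$ be smooth Riemannian manifolds (without boundary, Hausdorff, second countable) of arbitrary dimensions $m,n\ge 0$, and let $\mathrm{vol}_g$ be the Riemannian volume measure of $(M,g)$. Pointwise inner products of $(0,2)$ tensors on $M$ are $\langle S,T\rangle_g=\sum_{i,j}S(e_i,e_j)T(e_i,e_j)$ for a $g$-orthonormal basis $(e_i)$, and $\langle S,T\rangle_{L^2}=\int_M\langle S,T\rangle_g\,\mathrm{vol}_g$. The Dirichlet energy of a smooth map $\varphi:M\to N$ is $E_2(\varphi)=\frac12\int_M|\mathrm d\varphi|^2\,\mathrm{vol}_g$, where $|\mathrm d\varphi|^2=\sum_i h(\mathrm d\varphi\, e_i,\mathrm d\varphi\, e_i)$. The map $\varphi$ is called restricted harmonic if it is smooth, $E_2(\varphi)<\infty$, and $$\frac{d}{dt}\Big|_{t=0}E_2(\varphi\circ\psi_t)=0$$ for every smooth curve $\psi_t$, $t\in\mathbb R$, with $\psi_0=\mathrm{id}_M$, of volume preserving diffeomorphisms of $(M,g)$ of compact support (the support being contained, locally uniformly in $t$, in a compact set). Let $\Gamma_0(TM)$ be the vector space of smooth compactly supported vector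 fields $X$ on $M$ with $\mathrm{div}\,X=0$, and let $\mathcal L_X$ denote the Lie derivative. **Proposition.** Let $\varphi:(M,g)\to(N,h)$ be restricted harmonic. Then for all $X,Y\in\Gamma_0(TM)$ the function $\langle\mathcal L_X\varphi^*h,\mathcal L_Yg\rangle_g$ is integrable, and $$\mathsf{Hess}:\Gamma_0(TM)\times\Gamma_0(TM)\to\mathbb R,\qquad \mathsf{Hess}(X,Y)=\tfrac12\langle\mathcal L_X\varphi^*h,\mathcal L_Yg\rangle_{L^2}$$ is a symmetric bilinear form: $\mathsf{Hess}(X,Y)=\mathsf{Hess}(Y,X)$ for all $X,Y\in\Gamma_0(TM)$. -/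

import Mathlib

open scoped Manifold ContDiff Topology
open MeasureTheory Bundle

namespace RestrictedHarmonic

/-- The model space `ℝᵐ`; its tangent spaces and those of an `m`-manifold `M` modelled on it are,
as vector spaces, copies of `ℝᵐ`. -/
abbrev E (m : ℕ) : Type := EuclideanSpace ℝ (Fin m)

/-- A smooth Riemannian metric on the tangent bundle of `M`. -/
abbrev Metric (m : ℕ) (M : Type*) [TopologicalSpace M] [ChartedSpace (E m) M]
    [IsManifold 𝓘(ℝ, E m) ∞ M] :=
  ContMDiffRiemannianMetric 𝓘(ℝ, E m) ∞ (E m) (fun x : M ↦ TangentSpace 𝓘(ℝ, E m) x)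

/-- Smooth vector fields `Γ(TM)`. -/
abbrev SmoothField (m : ℕ) (M : Type*) [TopologicalSpace M] [ChartedSpace (E m) M]
    [IsManifold 𝓘(ℝ, E m) ∞ M] :=
  ContMDiffSection 𝓘(ℝ, E m) (E m) ∞ (fun x : M ↦ TangentSpace 𝓘(ℝ, E m) x)

/-- Fields of (bilinear) functions of two tangent vectors; used for `(0,2)` tensor fields. -/
abbrev Tensor (m : ℕ) (M : Type*) [TopologicalSpace M] [ChartedSpace (E m) M] :=
  (x : M) → TangentSpace 𝓘(ℝ, E m) x → TangentSpace 𝓘(ℝ, E m) x → ℝ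

section Definitions

variable {m n : ℕ} {M N : Type*}
  [TopologicalSpace M] [ChartedSpace (E m) M]
  [TopologicalSpace N] [ChartedSpace (E n) N]

/-- The standard basis vector `∂ᵢ` of `ℝᵐ`. -/
noncomputable def basisVec (i : Fin m) : E m := EuclideanSpace.single i 1

/-- The pullback `(f*β)(v, w) = β(df v, df w)` of a `(0,2)` tensor by a map. -/
noncomputable def pullback (f : M → N) (β : Tensor n N) : Tensor m M := fun x v w ↦
  β (f x) (mfderiv 𝓘(ℝ, E m) 𝓘(ℝ, E n) f x v) (mfderiv 𝓘(ℝ, E m) 𝓘(ℝ, E n) f x w)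

/-- The coordinate expression, in the chart around `p`, of a `(0,2)` tensor: its pullback by the
inverse of the chart, a function of a point `y` and two vectors of `ℝᵐ`. -/
noncomputable def tensorInChart (p : M) (α : Tensor m M) (y : E m) (v w : E m) : ℝ :=
  pullback (m := m) (extChartAt 𝓘(ℝ, E m) p).symm α y v w

/-- The coordinate expression, in the chart around `p`, of a vector field. -/
noncomputable def fieldInChart (p : M) (X : (x : M) → TangentSpace 𝓘(ℝ, E m) x) (y : E m) : E m :=
  mfderiv 𝓘(ℝ, E m) 𝓘(ℝ, E m) (extChartAt 𝓘(ℝ, E m) p) ((extChartAt 𝓘(ℝ, E m) p).symm y)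
    (X ((extChartAt 𝓘(ℝ, E m) p).symm y))

/-- The Lie derivative of a `(0,2)` tensor `α` along `X`. In the coordinates `y` of the chart
around `x` it is
`(L_X α)(v, w) = X[α(v, w)] + α(DX v, w) + α(v, DX w)` for constant coordinate fields `v, w`, i.e.
`(L_X α)ᵢⱼ = Xᵏ ∂ₖ αᵢⱼ + (∂ᵢ Xᵏ) αₖⱼ + (∂ⱼ Xᵏ) αᵢₖ`. -/
noncomputable def lieDeriv (X : (x : M) → TangentSpace 𝓘(ℝ, E m) x) (α : Tensor m M) :
    Tensor m M := fun x v w ↦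
  let y₀ : E m := extChartAt 𝓘(ℝ, E m) x x
  let v' : E m := mfderiv 𝓘(ℝ, E m) 𝓘(ℝ, E m) (extChartAt 𝓘(ℝ, E m) x) x v
  let w' : E m := mfderiv 𝓘(ℝ, E m) 𝓘(ℝ, E m) (extChartAt 𝓘(ℝ, E m) x) x w
  fderiv ℝ (fun y ↦ tensorInChart x α y v' w') y₀ (fieldInChart x X y₀)
    + tensorInChart x α y₀ (fderiv ℝ (fieldInChart x X) y₀ v') w'
    + tensorInChart x α y₀ v' (fderiv ℝ (fieldInChart x X) y₀ w')

end Definitions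

section Riemannian

variable {m n : ℕ} {M N : Type*}
  [TopologicalSpace M] [ChartedSpace (E m) M] [IsManifold 𝓘(ℝ, E m) ∞ M]
  [TopologicalSpace N] [ChartedSpace (E n) N] [IsManifold 𝓘(ℝ, E n) ∞ N]

/-- A Riemannian metric regarded as a `(0,2)` tensor. -/
noncomputable def metricTensor (g : Metric m M) : Tensor m M := fun x v w ↦ g.inner x v w

/-- The Gram matrix `g_{ij}(x) = g_x(∂ᵢ, ∂ⱼ)` in the standard basis of `T_x M = ℝᵐ`. -/
noncomputable def gram (g : Metric m M) (x : M) : Matrix (Fin m) (Fin m) ℝ :=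
  Matrix.of fun i j ↦ g.inner x (basisVec i : E m) (basisVec j : E m)

/-- The pointwise inner product of `(0,2)` tensors, `⟨S, T⟩_g = g^{ik} g^{jl} Sᵢⱼ Tₖₗ`,
i.e. `∑ S(eᵢ, eⱼ) T(eᵢ, eⱼ)` over a `g`-orthonormal basis. -/
noncomputable def tensorInner (g : Metric m M) (S T : Tensor m M) (x : M) : ℝ :=
  ∑ i, ∑ j, ∑ k, ∑ l, (gram g x)⁻¹ i k * (gram g x)⁻¹ j l *
    (S x (basisVec i : E m) (basisVec j : E m) * T x (basisVec k : E m) (basisVec l : E m))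

/-- The density `√(det g_{ij})` of the Riemannian volume in the coordinates of the chart
around `p`. -/
noncomputable def volDensity (g : Metric m M) (p : M) (y : E m) : ℝ :=
  Real.sqrt (Matrix.det (Matrix.of fun i j ↦
    tensorInChart p (metricTensor g) y (basisVec i) (basisVec j)))

/-- The Riemannian volume `√(det g_{ij}) dy` on the domain of the chart around `p`, as a
measure on `M`. -/
noncomputable def chartVolume [MeasurableSpace M] (g : Metric m M) (p : M) : Measure M :=
  (((volume : Measure (E m)).restrict (extChartAt 𝓘(ℝ, E m) p).target).withDensity
    fun y ↦ ENNReal.ofReal (volDensity g p y)).map (extChartAt 𝓘(ℝ, E m) p).symm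

/-- The Riemannian volume measure `vol_g`: the least measure that dominates the volume of each
chart. As these agree on overlaps, it restricts to `√(det g_{ij}) dy` on every chart domain. -/
noncomputable def vol [MeasurableSpace M] (g : Metric m M) : Measure M := ⨆ p : M, chartVolume g p

/-- The divergence `div X = (1/√det g) ∑ᵢ ∂ᵢ(√det g Xⁱ)` of a vector field, computed at `x` in the
chart around `x`. -/
noncomputable def divergence (g : Metric m M) (X : (x : M) → TangentSpace 𝓘(ℝ, E m) x) (x : M) :
    ℝ :=
  (volDensity g x (extChartAt 𝓘(ℝ, E m) x x))⁻¹ *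
    ∑ i, fderiv ℝ (fun y ↦ volDensity g x y * fieldInChart x X y i)
      (extChartAt 𝓘(ℝ, E m) x x) (basisVec i)

/-- `|dφ|² = ∑ᵢ h(dφ eᵢ, dφ eᵢ) = g^{ij} (φ*h)ᵢⱼ` for a map `φ : (M, g) → (N, h)`. -/
noncomputable def normSqDeriv (g : Metric m M) (h : Metric n N) (φ : M → N) (x : M) : ℝ :=
  ∑ i, ∑ j, (gram g x)⁻¹ i j *
    pullback φ (metricTensor h) x (basisVec i : E m) (basisVec j : E m)

/-- The Dirichlet energy `E₂(φ) = ½ ∫ |dφ|² vol_g`. -/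
noncomputable def dirichletEnergy [MeasurableSpace M] (g : Metric m M) (h : Metric n N)
    (φ : M → N) : ℝ :=
  (1 / 2) * ∫ x, normSqDeriv g h φ x ∂(vol g)

/-- A smooth curve `t ↦ ψ_t` through the identity in the group of compactly supported, volume
preserving diffeomorphisms of `(M, g)`. -/
structure IsSDiffCurve [MeasurableSpace M] (g : Metric m M)
    (ψ : ℝ → Diffeomorph 𝓘(ℝ, E m) 𝓘(ℝ, E m) M M ∞) : Prop where
  zero : ∀ x, ψ 0 x = x
  smooth : ContMDiff (𝓘(ℝ, ℝ).prod 𝓘(ℝ, E m)) 𝓘(ℝ, E m) ∞ fun q : ℝ × M ↦ ψ q.1 q.2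
  volumePreserving : ∀ t, MeasurePreserving (ψ t) (vol g) (vol g)
  /-- compact support, locally uniformly in `t` -/
  compactSupport : ∀ t₀, ∃ K : Set M, IsCompact K ∧ ∀ᶠ t in 𝓝 t₀, ∀ x ∉ K, ψ t x = x

/-- `φ : (M, g) → (N, h)` is restricted harmonic: it is smooth, has finite Dirichlet energy, and
is critical for the energy along every smooth curve of compactly supported volume preserving
diffeomorphisms through the identity. -/
structure IsRestrictedHarmonic [MeasurableSpace M] (g : Metric m M) (h : Metric n N)
    (φ : M → N) : Prop where
  smooth : ContMDiff 𝓘(ℝ, E m) 𝓘(ℝ, E n) ∞ φ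
  finiteEnergy : Integrable (normSqDeriv g h φ) (vol g)
  critical : ∀ ψ : ℝ → Diffeomorph 𝓘(ℝ, E m) 𝓘(ℝ, E m) M M ∞, IsSDiffCurve g ψ →
    HasDerivAt (fun t ↦ dirichletEnergy g h (φ ∘ ψ t)) 0 0

theorem contDiffAt_fieldInChart (X : SmoothField m M) (p : M) :
    ContDiffAt ℝ ∞ (fieldInChart p X) (extChartAt 𝓘(ℝ, E m) p p) := by
  have : IsManifold 𝓘(ℝ, E m) 1 M := IsManifold.of_le (n := ∞) (by simp)
  have h1 := contMDiffAt_section p |>.1 (X.contMDiff p)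
  have h2 : ContMDiffAt 𝓘(ℝ, E m) 𝓘(ℝ, E m) ∞ (extChartAt 𝓘(ℝ, E m) p).symm
      (extChartAt 𝓘(ℝ, E m) p p) :=
    (contMDiffOn_extChartAt_symm p).contMDiffAt (extChartAt_target_mem_nhds p)
  have h3 := ContMDiffAt.comp_of_eq h1 h2 (by simp)
  refine (contMDiffAt_iff_contDiffAt.1 h3).congr_of_eventuallyEq ?_
  filter_upwards [extChartAt_target_mem_nhds (I := 𝓘(ℝ, E m)) p] with y hy
  have hy' : (extChartAt 𝓘(ℝ, E m) p).symm y ∈ (chartAt (E m) p).source := by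
    simpa using (extChartAt 𝓘(ℝ, E m) p).map_target hy
  have h4 := DFunLike.congr_fun (TangentBundle.continuousLinearMapAt_trivializationAt
    (I := 𝓘(ℝ, E m)) hy') (X ((extChartAt 𝓘(ℝ, E m) p).symm y))
  refine h4.symm.trans ?_
  rw [Trivialization.continuousLinearMapAt_apply, Trivialization.linearMapAt_apply,
    if_pos (by simpa using hy')]
  rfl

theorem contDiffAt_metricInChart (g : Metric m M) (p : M) (v w : E m) :
    ContDiffAt ℝ ∞ (fun y ↦ tensorInChart p (metricTensor g) y v w)
      (extChartAt 𝓘(ℝ, E m) p p) := by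
  have : IsManifold 𝓘(ℝ, E m) 1 M := IsManifold.of_le (n := ∞) (by simp)
  have h1 := contMDiffAt_section p |>.1 (g.contMDiff p)
  have h2 : ContMDiffAt 𝓘(ℝ, E m) 𝓘(ℝ, E m) ∞ (extChartAt 𝓘(ℝ, E m) p).symm
      (extChartAt 𝓘(ℝ, E m) p p) :=
    (contMDiffOn_extChartAt_symm p).contMDiffAt (extChartAt_target_mem_nhds p)
  have h3 := contMDiffAt_iff_contDiffAt.1 (ContMDiffAt.comp_of_eq h1 h2 (by simp))
  refine ((h3.clm_apply (contDiffAt_const (c := v))).clm_apply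
    (contDiffAt_const (c := w))).congr_of_eventuallyEq ?_
  filter_upwards [extChartAt_target_mem_nhds (I := 𝓘(ℝ, E m)) p] with y hy
  have hy' : (extChartAt 𝓘(ℝ, E m) p).symm y ∈ (chartAt (E m) p).source := by
    simpa using (extChartAt 𝓘(ℝ, E m) p).map_target hy
  have h4 := TangentBundle.symmL_trivializationAt (I := 𝓘(ℝ, E m)) hy'
  rw [modelWithCornersSelf_coe, Set.range_id, mfderivWithin_univ,
    (extChartAt 𝓘(ℝ, E m) p).right_inv hy] at h4
  have h5 (u : E m) : mfderiv 𝓘(ℝ, E m) 𝓘(ℝ, E m) (extChartAt 𝓘(ℝ, E m) p).symm y u =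
      (trivializationAt (E m) (TangentSpace 𝓘(ℝ, E m)) p).symm
        ((extChartAt 𝓘(ℝ, E m) p).symm y) u :=
    (DFunLike.congr_fun h4 u).symm.trans (Trivialization.symmL_apply _ (by simpa using hy') u)
  have h6 : tensorInChart p (metricTensor g) y v w = g.inner ((extChartAt 𝓘(ℝ, E m) p).symm y)
      ((trivializationAt (E m) (TangentSpace 𝓘(ℝ, E m)) p).symm
        ((extChartAt 𝓘(ℝ, E m) p).symm y) v)
      ((trivializationAt (E m) (TangentSpace 𝓘(ℝ, E m)) p).symm
        ((extChartAt 𝓘(ℝ, E m) p).symm y) w) := by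
    rw [← h5, ← h5]
    rfl
  simp only [Function.comp_apply, hom_trivializationAt_apply]
  rw [h6, inCoordinates_apply_eq₂ (by simpa using hy') (by simpa using hy') (by simp)]
  simp

theorem differentiableAt_volDensity (g : Metric m M) (p : M) :
    DifferentiableAt ℝ (volDensity g p) (extChartAt 𝓘(ℝ, E m) p p) := by
  have : IsManifold 𝓘(ℝ, E m) 1 M := IsManifold.of_le (n := ∞) (by simp)
  refine DifferentiableAt.sqrt ?_ ?_
  · simp only [Matrix.det_apply]
    refine DifferentiableAt.fun_sum fun σ _ ↦ DifferentiableAt.const_smul ?_ _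
    refine (contDiffAt_prod fun i _ ↦ ?_ : ContDiffAt ℝ ∞ _ _).differentiableAt (by simp)
    exact contDiffAt_metricInChart g p _ _
  · have h1 (u v : E m) : tensorInChart p (metricTensor g) (extChartAt 𝓘(ℝ, E m) p p) u v =
        g.inner p u v := by
      have h2 := mfderivWithin_range_extChartAt_symm (I := 𝓘(ℝ, E m)) (x := p)
      rw [modelWithCornersSelf_coe, Set.range_id, mfderivWithin_univ] at h2
      have h3 (u : E m) : mfderiv 𝓘(ℝ, E m) 𝓘(ℝ, E m) (extChartAt 𝓘(ℝ, E m) p).symm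
          (extChartAt 𝓘(ℝ, E m) p p) u = u := DFunLike.congr_fun h2 u
      unfold tensorInChart pullback metricTensor
      rw [h3, h3, (extChartAt 𝓘(ℝ, E m) p).left_inv (mem_extChartAt_source p)]
    simp only [h1]
    refine ne_of_gt (Matrix.PosDef.det_pos (Matrix.posDef_iff_dotProduct_mulVec.2 ⟨?_, ?_⟩))
    · ext i j
      exact g.symm p _ _
    · intro c hc
      have h4 : (WithLp.toLp 2 c : E m) = ∑ i, c i • basisVec i := by
        ext j
        simp [basisVec, Pi.single_apply]
      have hne : (WithLp.toLp 2 c : E m) ≠ 0 := fun h ↦ hc (by simpa using congrArg WithLp.ofLp h)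
      have h5 := g.pos p (WithLp.toLp 2 c : E m) hne
      let B : E m →ₗ[ℝ] E m →ₗ[ℝ] ℝ := LinearMap.mk₂ ℝ (fun u v ↦ g.inner p u v)
        (fun u u' v ↦ DFunLike.congr_fun ((g.inner p).map_add u u') v)
        (fun c u v ↦ DFunLike.congr_fun ((g.inner p).map_smul c u) v)
        (fun u v v' ↦ (g.inner p u).map_add v v') (fun c u v ↦ (g.inner p u).map_smul c v)
      change 0 < B (WithLp.toLp 2 c) (WithLp.toLp 2 c) at h5
      change 0 < c ⬝ᵥ (Matrix.of fun i j ↦ B (basisVec i) (basisVec j)).mulVec c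
      rw [h4] at h5
      refine h5.trans_eq ?_
      simp only [map_sum, LinearMap.sum_apply, map_smul, LinearMap.smul_apply, smul_eq_mul,
        dotProduct, Matrix.mulVec, Matrix.of_apply]
      simp only [Finset.mul_sum]
      rw [Finset.sum_comm]
      refine Finset.sum_congr rfl fun i _ ↦ ?_
      refine Finset.sum_congr rfl fun j _ ↦ ?_
      ring

theorem divergence_add (g : Metric m M) (X Y : SmoothField m M) (x : M) :
    divergence g (X + Y : SmoothField m M) x = divergence g X x + divergence g Y x := by
  have hρ := differentiableAt_volDensity g x
  have hX (Z : SmoothField m M) (i : Fin m) : DifferentiableAt ℝ (fun y ↦ fieldInChart x Z y i)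
      (extChartAt 𝓘(ℝ, E m) x x) :=
    differentiableAt_euclidean.1 ((contDiffAt_fieldInChart Z x).differentiableAt (by simp)) i
  have h (i : Fin m) : (fun y ↦ volDensity g x y * fieldInChart x (X + Y : SmoothField m M) y i) =
      (fun y ↦ volDensity g x y * fieldInChart x X y i) +
        fun y ↦ volDensity g x y * fieldInChart x Y y i := by
    funext y
    have : fieldInChart x (X + Y : SmoothField m M) y = fieldInChart x X y + fieldInChart x Y y :=
      map_add _ _ _
    rw [Pi.add_apply, this, PiLp.add_apply, mul_add]
  simp only [divergence, ← mul_add, ← Finset.sum_add_distrib, h]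
  congr 2 with i
  exact DFunLike.congr_fun (fderiv_add (hρ.mul (hX X i)) (hρ.mul (hX Y i))) (basisVec i)

theorem divergence_smul (g : Metric m M) (c : ℝ) (X : SmoothField m M) (x : M) :
    divergence g (c • X : SmoothField m M) x = c * divergence g X x := by
  have h (i : Fin m) : (fun y ↦ volDensity g x y * fieldInChart x (c • X : SmoothField m M) y i) =
      c • (fun y ↦ volDensity g x y * fieldInChart x X y i) := by
    funext y
    have : fieldInChart x (c • X : SmoothField m M) y = c • fieldInChart x X y :=
      (mfderiv 𝓘(ℝ, E m) 𝓘(ℝ, E m) (extChartAt 𝓘(ℝ, E m) x)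
        ((extChartAt 𝓘(ℝ, E m) x).symm y)).map_smul c _
    rw [Pi.smul_apply, this, PiLp.smul_apply, smul_eq_mul, smul_eq_mul, mul_left_comm]
  simp only [divergence, h, fderiv_const_smul_field]
  simp [Finset.mul_sum, mul_left_comm]

/-- `Γ₀(TM)`: the space of smooth divergenceless vector fields of compact support. -/
def divFreeFields (g : Metric m M) : Submodule ℝ (SmoothField m M) where
  carrier := {X | IsCompact (closure {x | X x ≠ 0}) ∧ ∀ x, divergence g X x = 0}
  add_mem' := by
    rintro X Y ⟨hX, hX'⟩ ⟨hY, hY'⟩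
    refine ⟨(hX.union hY).of_isClosed_subset isClosed_closure ?_, fun x ↦ ?_⟩
    · rw [← closure_union]
      refine closure_mono fun x hx ↦ ?_
      by_contra h
      simp only [Set.mem_union, Set.mem_ofPred_eq, not_or, not_not] at h
      exact hx (by simp [h.1, h.2])
    · rw [divergence_add, hX', hY', add_zero]
  zero_mem' := by
    have h (x : M) : divergence g (0 : SmoothField m M) x = 0 := by
      simpa using divergence_smul g 0 0 x
    exact ⟨by simp, h⟩
  smul_mem' := by
    rintro c X ⟨hX, hX'⟩
    refine ⟨hX.of_isClosed_subset isClosed_closure (closure_mono fun x hx ↦ ?_), fun x ↦ ?_⟩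
    · intro h
      exact hx (by simp [h])
    · rw [divergence_smul, hX', mul_zero]

/-- The integrand `⟨L_X φ*h, L_Y g⟩_g`. -/
noncomputable def hessDensity (g : Metric m M) (h : Metric n N) (φ : M → N)
    (X Y : divFreeFields g) : M → ℝ :=
  tensorInner g (lieDeriv X.1 (pullback φ (metricTensor h))) (lieDeriv Y.1 (metricTensor g))

/-- `Hess(X, Y) = ½ ⟨L_X φ*h, L_Y g⟩_{L²}`. -/
noncomputable def hess [MeasurableSpace M] (g : Metric m M) (h : Metric n N) (φ : M → N)
    (X Y : divFreeFields g) : ℝ :=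
  (1 / 2) * ∫ x, hessDensity g h φ X Y x ∂(vol g)

end Riemannian

end RestrictedHarmonic

/-! Write S = φ*h. Differentiating the trace of a (0,2) tensor A along X gives ⟨A, L_X g⟩ = tr_g(L_X
A) - X(tr_g A) (`innerC_lieT_metricT`). With A = L_X S and A = L_Y S, and with [L_Y, L_X] = L_[Y,X]
(`lieT_bracket`), the difference ⟨L_X S, L_Y g⟩ - ⟨L_Y S, L_X g⟩ becomes tr_g(L_[Y,X] S) - Y(tr_g
L_X S) + X(tr_g L_Y S). The last two terms integrate to zero by the divergence theorem
(`integral_der_eq_zero`). The integral of the first is twice the first variation of the energy along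
[Y,X], which vanishes because φ is critical and [Y,X] is again divergence free.

Criticality concerns curves of volume preserving diffeomorphisms, so flows are needed. To work
inside single charts, [Y,X] is split by a partition of unity into the fields `cutoffBracket χ Y X`,
which act by f ↦ Y(χ Xf) - X(χ Yf). Each is supported in a chart domain, and the divergence theorem
for X and Y shows that ∫ Zf = 0 for each such field Z. This weak form of div Z = 0 makes ∫ f∘ψ_t
constant along the flow of Z, so the flow preserves volume (`IsLocalField.isSDiffCurve`).
Differentiation under the integral sign then gives ∫ tr_g(L_Z S) = 0
(`IsRestrictedHarmonic.integral_trT_lieT_eq_zero`).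

The flow of Z is transported from ℝᵐ, where its smoothness in time and initial point jointly comes
from the implicit function theorem in the Banach space of continuous curves (`contDiff_flow`).
Tensor identities are proved for fields of bilinear forms on ℝᵐ and carried to the manifold by
naturality under changes of chart. -/

namespace RestrictedHarmonic

/-! ### Superposition operators γ ↦ V ∘ γ on spaces of continuous maps. -/

section Nemytskii

open ContinuousMap

variable {K : Type} [TopologicalSpace K] [CompactSpace K]
  {F F' : Type} [NormedAddCommGroup F] [NormedSpace ℝ F] [NormedAddCommGroup F'] [NormedSpace ℝ F']

set_option synthInstance.maxHeartbeats 200000 in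
/-- Pointwise application of a continuous family of operators to a continuous family of vectors. -/
noncomputable def applyFamily : C(K, F →L[ℝ] F') →L[ℝ] C(K, F) →L[ℝ] C(K, F') :=
  LinearMap.mkContinuous₂
    (LinearMap.mk₂ ℝ (fun (A : C(K, F →L[ℝ] F')) (γ : C(K, F)) ↦ (⟨fun s ↦ A s (γ s), by fun_prop⟩ : C(K, F')))
      (fun _ _ _ ↦ by ext; simp) (fun _ _ _ ↦ by ext; simp)
      (fun _ _ _ ↦ by ext; simp) (fun _ _ _ ↦ by ext; simp)) 1 (by
    intro A γ
    rw [ContinuousMap.norm_le _ (by positivity)]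
    intro s
    calc ‖A s (γ s)‖ ≤ ‖A s‖ * ‖γ s‖ := (A s).le_opNorm _
      _ ≤ 1 * ‖A‖ * ‖γ‖ := by
        rw [one_mul]
        gcongr
        · exact A.norm_coe_le_norm s
        · exact γ.norm_coe_le_norm s)

@[simp] theorem applyFamily_apply (A : C(K, F →L[ℝ] F')) (γ : C(K, F)) (s : K) :
    applyFamily A γ s = A s (γ s) := rfl

/-- Mean value inequality on the segment from `a` to `b`, where DV differs from DV(a) by at most C‖b
- a‖. The constant does not depend on `a`, which is what survives passing to the sup norm. -/
theorem norm_sub_sub_fderiv_le {V : F → F'} (hV : ContDiff ℝ ∞ V) {C : NNReal}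
    (hC : LipschitzWith C (fderiv ℝ V)) (a b : F) :
    ‖V b - V a - fderiv ℝ V a (b - a)‖ ≤ C * ‖b - a‖ ^ 2 := by
  have h := Convex.norm_image_sub_le_of_norm_hasFDerivWithin_le' (𝕜 := ℝ) (f := V) (f' := fderiv ℝ V)
    (φ := fderiv ℝ V a) (C := C * ‖b - a‖) (s := segment ℝ a b) (x := a) (y := b)
    (fun x _ ↦ ((hV.differentiable (by simp)) x).hasFDerivAt.hasFDerivWithinAt) (fun x hx ↦ ?_)
    (convex_segment a b) (left_mem_segment ℝ a b) (right_mem_segment ℝ a b)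
  · rw [pow_two, ← mul_assoc]
    exact h
  · refine (hC.norm_sub_le x a).trans ?_
    gcongr
    have := norm_sub_le_of_mem_segment hx
    simpa [norm_sub_rev] using this

set_option synthInstance.maxHeartbeats 200000 in
theorem hasFDerivAt_comp_continuousMap {V : F → F'} (hV : ContDiff ℝ ∞ V)
    (hc : HasCompactSupport V) (γ : C(K, F)) :
    HasFDerivAt (fun γ : C(K, F) ↦ (⟨V, hV.continuous⟩ : C(F, F')).comp γ)
      (applyFamily ((⟨fderiv ℝ V, hV.continuous_fderiv (by simp)⟩ : C(F, F →L[ℝ] F')).comp γ)) γ := by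
  obtain ⟨C, hC⟩ := ContDiff.lipschitzWith_of_hasCompactSupport (hc.fderiv ℝ)
    (hV.fderiv_right (m := ∞) (by simp)) (by simp)
  rw [hasFDerivAt_iff_isLittleO_nhds_zero]
  refine Asymptotics.IsBigO.trans_isLittleO (g := fun h : C(K, F) ↦ ‖h‖ ^ 2) ?_ ?_
  · refine Asymptotics.IsBigO.of_bound C (Filter.Eventually.of_forall fun h ↦ ?_)
    rw [ContinuousMap.norm_le _ (by positivity)]
    intro s
    have h1 := norm_sub_sub_fderiv_le hV hC (γ s) (γ s + h s)
    rw [add_sub_cancel_left] at h1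
    refine (le_of_eq (by rfl)).trans (h1.trans ?_)
    rw [Real.norm_eq_abs, abs_of_nonneg (by positivity)]
    gcongr
    exact h.norm_coe_le_norm s
  · have := Asymptotics.isLittleO_norm_pow_id (E' := C(K, F)) (n := 2) (by norm_num)
    exact this

set_option synthInstance.maxHeartbeats 200000 in
-- The derivative is the superposition operator of DV followed by the continuous linear map
-- `applyFamily`, so induction on the order applies. The target space varies in the induction
-- because DV takes values in a space of operators.
theorem contDiff_nat_comp_continuousMap (k : ℕ) : ∀ {F' : Type} [NormedAddCommGroup F']
    [NormedSpace ℝ F'] {V : F → F'} (hV : ContDiff ℝ ∞ V) (_ : HasCompactSupport V),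
    ContDiff ℝ k (fun γ : C(K, F) ↦ (⟨V, hV.continuous⟩ : C(F, F')).comp γ) := by
  induction k with
  | zero =>
    intro F' _ _ V hV hc
    exact contDiff_zero.2 (ContinuousMap.continuous_postcomp _)
  | succ k ih =>
    intro F' _ _ V hV hc
    push_cast
    rw [contDiff_succ_iff_hasFDerivAt]
    refine ⟨_, ?_, fun γ ↦ hasFDerivAt_comp_continuousMap hV hc γ⟩
    exact (applyFamily (K := K) (F := F) (F' := F')).contDiff.comp
      (ih (hV.fderiv_right (m := ∞) (by simp)) (hc.fderiv ℝ))

theorem contDiff_comp_continuousMap {V : F → F'} (hV : ContDiff ℝ ∞ V)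
    (hc : HasCompactSupport V) :
    ContDiff ℝ ∞ (fun γ : C(K, F) ↦ (⟨V, hV.continuous⟩ : C(F, F')).comp γ) :=
  contDiff_infty.2 fun k ↦ contDiff_nat_comp_continuousMap k hV hc

end Nemytskii

/-! ### The integration operator on curves over the unit interval. -/

section Volterra

variable {F : Type} [NormedAddCommGroup F] [NormedSpace ℝ F]

/-- Integration from `0` of continuous curves parametrized by the unit interval. -/
noncomputable def primitive [CompleteSpace F] : C(unitInterval, F) →L[ℝ] C(unitInterval, F) :=
  LinearMap.mkContinuous
    { toFun := fun γ ↦ ⟨fun s ↦ ∫ r in (0 : ℝ)..s, γ (Set.projIcc 0 1 zero_le_one r), by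
        have h : Continuous fun r ↦ γ (Set.projIcc 0 1 zero_le_one r) := by fun_prop
        exact (intervalIntegral.continuous_primitive (fun a b ↦ h.intervalIntegrable a b) 0).comp
          continuous_subtype_val⟩
      map_add' := fun γ δ ↦ by
        have h (γ : C(unitInterval, F)) :
          Continuous fun r ↦ γ (Set.projIcc 0 1 zero_le_one r) := by fun_prop
        ext s
        simp [intervalIntegral.integral_add ((h γ).intervalIntegrable _ _)
          ((h δ).intervalIntegrable _ _)]
      map_smul' := fun c γ ↦ by
        ext s
        simp [intervalIntegral.integral_smul] } 1 (by
    intro γ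
    rw [ContinuousMap.norm_le _ (by positivity)]
    intro s
    have := intervalIntegral.norm_integral_le_of_norm_le_const (a := 0) (b := (s : ℝ)) (C := ‖γ‖)
      (f := fun r ↦ γ (Set.projIcc 0 1 zero_le_one r)) (fun r _ ↦ γ.norm_coe_le_norm _)
    refine this.trans ?_
    rw [sub_zero, abs_of_nonneg s.2.1, mul_comm]
    gcongr
    exact s.2.2)

theorem primitive_apply [CompleteSpace F] (γ : C(unitInterval, F)) (s : unitInterval) :
    primitive γ s = ∫ r in (0 : ℝ)..s, γ (Set.projIcc 0 1 zero_le_one r) := rfl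

theorem norm_primitive_le [CompleteSpace F] (γ : C(unitInterval, F)) : ‖primitive γ‖ ≤ ‖γ‖ :=
  (LinearMap.mkContinuous_norm_le _ zero_le_one _ |> fun h ↦
    ((primitive (F := F)).le_opNorm γ).trans (by
      have h' : ‖primitive (F := F)‖ ≤ 1 := h
      nlinarith [norm_nonneg γ]))

end Volterra

/-! ### Global flows of compactly supported fields on a Banach space, and their smoothness. -/

section Flow

variable {F : Type} [NormedAddCommGroup F] [NormedSpace ℝ F] [CompleteSpace F] {V : F → F}

/-- Compact support makes V bounded and globally Lipschitz, so Picard–Lindelöf applies on every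
interval (-a, a); uniqueness glues the solutions. -/
theorem exists_integralCurve (hV : ContDiff ℝ ∞ V) (hc : HasCompactSupport V) (x : F) :
    ∃ c : ℝ → F, c 0 = x ∧ ∀ t, HasDerivAt c (V (c t)) t := by
  obtain ⟨K, hK⟩ := ContDiff.lipschitzWith_of_hasCompactSupport hc hV (by simp)
  obtain ⟨L, hL⟩ := hc.exists_bound_of_continuous hV.continuous
  have hL0 : 0 ≤ L := (norm_nonneg _).trans (hL x)
  have loc (a : ℝ) (ha : 0 < a) : ∃ c : ℝ → F, c 0 = x ∧
      ∀ t ∈ Set.Ioo (-a) a, HasDerivAt c (V (c t)) t := by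
    have hp : IsPicardLindelof (fun _ ↦ V) (tmin := -a) (tmax := a)
        ⟨0, by constructor <;> linarith⟩ x ⟨L * a, by positivity⟩ 0 ⟨L, hL0⟩ K := by
      refine IsPicardLindelof.of_time_independent (fun y _ ↦ hL y) hK.lipschitzOnWith ?_
      simp
      exact le_refl (L * a)
    obtain ⟨c, h0, h1⟩ := hp.exists_eq_forall_mem_Icc_hasDerivWithinAt₀
    exact ⟨c, h0, fun t ht ↦ (h1 t ⟨ht.1.le, ht.2.le⟩).hasDerivAt (Icc_mem_nhds ht.1 ht.2)⟩
  choose! c hc0 hc1 using loc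
  have huniq (a b : ℝ) (ha : 0 < a) (hab : a ≤ b) : Set.EqOn (c a) (c b) (Set.Ioo (-a) a) := by
    refine ODE_solution_unique_of_mem_Ioo (v := fun _ ↦ V) (s := fun _ ↦ Set.univ) (K := K) (t₀ := 0)
      (fun t _ ↦ hK.lipschitzOnWith) (by simpa using ha)
      (fun t ht ↦ ⟨hc1 a ha t ht, trivial⟩)
      (fun t ht ↦ ⟨hc1 b (by linarith) t ⟨by linarith [ht.1], by linarith [ht.2]⟩, trivial⟩) ?_
    rw [hc0 a ha, hc0 b (by linarith)]
  -- At time t the solution on (-(|t|+1), |t|+1) is used; near t this curve agrees with the single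
  -- solution of parameter |t|+2, hence is differentiable.
  refine ⟨fun t ↦ c (|t| + 1) t, hc0 _ (by positivity), fun t ↦ ?_⟩
  have hev : (fun t ↦ c (|t| + 1) t) =ᶠ[𝓝 t] c (|t| + 2) := by
    have : ∀ᶠ s in 𝓝 t, |s| < |t| + 1 := continuous_abs.continuousAt.eventually_lt
      continuousAt_const (by linarith)
    filter_upwards [this] with s hs
    refine huniq _ _ (by positivity) (by linarith) ?_
    rw [Set.mem_Ioo, ← abs_lt]
    linarith
  have h := hc1 (|t| + 2) (by positivity) t (by rw [Set.mem_Ioo, ← abs_lt]; linarith)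
  have := h.congr_of_eventuallyEq hev
  rwa [← hev.eq_of_nhds] at this

/-- The flow of a smooth vector field of compact support. -/
noncomputable def flow (hV : ContDiff ℝ ∞ V) (hc : HasCompactSupport V) (t : ℝ) (x : F) : F :=
  (exists_integralCurve hV hc x).choose t

variable (hV : ContDiff ℝ ∞ V) (hc : HasCompactSupport V)

theorem flow_zero (x : F) : flow hV hc 0 x = x := (exists_integralCurve hV hc x).choose_spec.1

theorem hasDerivAt_flow (t : ℝ) (x : F) :
    HasDerivAt (fun t ↦ flow hV hc t x) (V (flow hV hc t x)) t :=
  (exists_integralCurve hV hc x).choose_spec.2 t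

include hV hc in
theorem integralCurve_eq_flow {c : ℝ → F} (h : ∀ t, HasDerivAt c (V (c t)) t) (t : ℝ) :
    c t = flow hV hc t (c 0) := by
  obtain ⟨K, hK⟩ := ContDiff.lipschitzWith_of_hasCompactSupport hc hV (by simp)
  have := ODE_solution_unique_univ (v := fun _ ↦ V) (s := fun _ ↦ Set.univ) (K := K) (t₀ := 0)
    (f := c) (g := fun t ↦ flow hV hc t (c 0))
    (fun t ↦ hK.lipschitzOnWith) (fun t ↦ ⟨h t, trivial⟩)
    (fun t ↦ ⟨hasDerivAt_flow hV hc t _, trivial⟩) (flow_zero hV hc _).symm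
  exact congrFun this t

theorem flow_add (s t : ℝ) (x : F) : flow hV hc (s + t) x = flow hV hc s (flow hV hc t x) := by
  have h (r : ℝ) : HasDerivAt (fun s ↦ flow hV hc (s + t) x) (V (flow hV hc (r + t) x)) r :=
    (hasDerivAt_flow hV hc (r + t) x).comp_add_const r t
  simpa using integralCurve_eq_flow hV hc h s

theorem flow_of_eq_zero {x : F} (hx : V x = 0) (t : ℝ) : flow hV hc t x = x :=
  (integralCurve_eq_flow hV hc (c := fun _ ↦ x) (fun t ↦ by simpa [hx] using hasDerivAt_const t x)
    t).symm

/-- The equation `γ(s) = x + t ∫₀ˢ V(γ)` satisfied by the flow lines `γ(s) = Ψ(ts, x)`. -/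
noncomputable def flowEquation (q : (ℝ × F) × C(unitInterval, F)) : C(unitInterval, F) :=
  q.2 - ContinuousMap.const _ q.1.2 -
    q.1.1 • primitive ((⟨V, hV.continuous⟩ : C(F, F)).comp q.2)

/-- The constant curves, as a linear map. -/
noncomputable def constCurve (F : Type) [NormedAddCommGroup F] [NormedSpace ℝ F] :
    F →L[ℝ] C(unitInterval, F) :=
  LinearMap.mkContinuous
    { toFun := ContinuousMap.const _
      map_add' := fun _ _ ↦ rfl
      map_smul' := fun _ _ ↦ rfl } 1 (fun x ↦ by
        rw [ContinuousMap.norm_le _ (by positivity)]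
        intro s
        exact (one_mul ‖x‖).ge)

include hc in
theorem contDiff_flowEquation : ContDiff ℝ ∞ (flowEquation hV) := by
  have h1 : ContDiff ℝ ∞ fun q : (ℝ × F) × C(unitInterval, F) ↦ constCurve F q.1.2 :=
    (constCurve F).contDiff.comp (contDiff_snd.comp contDiff_fst)
  have h2 := (primitive (F := F)).contDiff.comp ((contDiff_comp_continuousMap (K := unitInterval) hV hc).comp
    (contDiff_snd (E := ℝ × F)))
  exact (contDiff_snd.sub h1).sub ((contDiff_fst.comp contDiff_fst).smul h2)

/-- The flow lines as elements of the space of continuous curves. -/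
noncomputable def flowLine (q : ℝ × F) : C(unitInterval, F) :=
  ⟨fun s ↦ flow hV hc (q.1 * s) q.2, by
    have : Continuous fun t ↦ flow hV hc t q.2 :=
      continuous_iff_continuousAt.2 fun t ↦ (hasDerivAt_flow hV hc t _).continuousAt
    fun_prop⟩

theorem flowEquation_flowLine (q : ℝ × F) : flowEquation hV (q, flowLine hV hc q) = 0 := by
  ext s
  have h1 (r : ℝ) : HasDerivAt (fun r ↦ flow hV hc (q.1 * r) q.2)
      (q.1 • V (flow hV hc (q.1 * r) q.2)) r := by
    have h := (hasDerivAt_flow hV hc (q.1 * r) q.2).scomp r ((hasDerivAt_id r).const_mul q.1)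
    rw [mul_one] at h
    exact h
  have hcont : Continuous fun r ↦ flow hV hc (q.1 * r) q.2 :=
    continuous_iff_continuousAt.2 fun t ↦ (h1 t).continuousAt
  have h2 := intervalIntegral.integral_eq_sub_of_hasDerivAt (a := 0) (b := (s : ℝ))
    (fun r _ ↦ h1 r) ((continuous_const.smul (hV.continuous.comp hcont)).intervalIntegrable _ _)
  have h3 : (primitive ((⟨V, hV.continuous⟩ : C(F, F)).comp (flowLine hV hc q))) s
      = ∫ r in (0 : ℝ)..s, V (flow hV hc (q.1 * r) q.2) := by
    rw [primitive_apply]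
    refine intervalIntegral.integral_congr fun r hr ↦ ?_
    rw [Set.uIcc_of_le s.2.1] at hr
    have : (Set.projIcc (0 : ℝ) 1 zero_le_one r : ℝ) = r := by
      rw [Set.projIcc_of_mem zero_le_one ⟨hr.1, hr.2.trans s.2.2⟩]
    simp [flowLine, this]
  rw [intervalIntegral.integral_smul] at h2
  simp only [mul_zero, flow_zero] at h2
  simp only [flowEquation, ContinuousMap.sub_apply, ContinuousMap.smul_apply, h3, h2,
    ContinuousMap.const_apply, ContinuousMap.zero_apply]
  simp [flowLine]

/-- The map γ ↦ x + t∫V(γ) is a contraction with constant |t|C < 1, so it has at most one fixed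
point. -/
theorem flowEquation_unique {C : NNReal} (hC : LipschitzWith C V) {q : ℝ × F}
    (hq : |q.1| * C < 1) {γ δ : C(unitInterval, F)} (hγ : flowEquation hV (q, γ) = 0)
    (hδ : flowEquation hV (q, δ) = 0) : γ = δ := by
  have h1 : γ - δ = q.1 • primitive ((⟨V, hV.continuous⟩ : C(F, F)).comp γ -
      (⟨V, hV.continuous⟩ : C(F, F)).comp δ) := by
    rw [map_sub, smul_sub]
    simp only [flowEquation] at hγ hδ
    have := hγ.trans hδ.symm
    rw [sub_sub, sub_sub, sub_eq_sub_iff_add_eq_add] at this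
    rw [sub_eq_sub_iff_add_eq_add]
    have h2 : (γ + q.1 • primitive ((⟨V, hV.continuous⟩ : C(F, F)).comp δ)) + ContinuousMap.const _ q.2
      = (δ + q.1 • primitive ((⟨V, hV.continuous⟩ : C(F, F)).comp γ)) + ContinuousMap.const _ q.2 := by
      rw [add_assoc, add_assoc, add_comm _ (ContinuousMap.const _ q.2),
        add_comm _ (ContinuousMap.const _ q.2)]
      exact this
    rw [add_right_cancel h2, add_comm]
  have h2 : ‖γ - δ‖ ≤ |q.1| * C * ‖γ - δ‖ := by
    conv_lhs => rw [h1]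
    rw [norm_smul, Real.norm_eq_abs, mul_assoc]
    gcongr
    refine (norm_primitive_le _).trans ?_
    rw [ContinuousMap.norm_le _ (by positivity)]
    intro s
    refine (hC.norm_sub_le (γ s) (δ s)).trans ?_
    gcongr
    exact (γ - δ).norm_coe_le_norm s
  have h3 : ‖γ - δ‖ = 0 := by nlinarith [norm_nonneg (γ - δ)]
  exact sub_eq_zero.1 (norm_eq_zero.1 h3)

/-- Implicit function theorem for `flowEquation`: its partial derivative in the curve is 1 - B with
‖B‖ ≤ |t|C < 1, invertible by the Neumann series. Uniqueness identifies the smooth implicit function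
with the flow lines. -/
theorem contDiffAt_flow_of_small {C : NNReal} (hC : LipschitzWith C V) {q : ℝ × F}
    (hq : |q.1| * C < 1) : ContDiffAt ℝ ∞ (fun q : ℝ × F ↦ flow hV hc q.1 q.2) q := by
  have hcd := (contDiff_flowEquation hV hc).contDiffAt (x := (q, flowLine hV hc q))
  set γ := flowLine hV hc q
  let B : C(unitInterval, F) →L[ℝ] C(unitInterval, F) := q.1 • (primitive.comp (applyFamily
    ((⟨fderiv ℝ V, hV.continuous_fderiv (by simp)⟩ : C(F, F →L[ℝ] F)).comp γ)))
  have hB : ‖B‖ < 1 := by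
    refine lt_of_le_of_lt ?_ hq
    refine ContinuousLinearMap.opNorm_le_bound _ (by positivity) fun δ ↦ ?_
    change ‖q.1 • primitive _‖ ≤ _
    rw [norm_smul, Real.norm_eq_abs, mul_assoc]
    gcongr
    refine (norm_primitive_le _).trans ?_
    rw [ContinuousMap.norm_le _ (by positivity)]
    intro s
    refine ((fderiv ℝ V (γ s)).le_opNorm (δ s)).trans ?_
    gcongr
    · exact norm_fderiv_le_of_lipschitz ℝ hC
    · exact δ.norm_coe_le_norm s
  have hpart : HasFDerivAt (fun δ ↦ flowEquation hV (q, δ)) (1 - B) γ := by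
    have h1 := (primitive (F := F)).hasFDerivAt.comp γ
      (hasFDerivAt_comp_continuousMap (K := unitInterval) hV hc γ)
    exact ((hasFDerivAt_id γ).sub_const (ContinuousMap.const _ q.2)).sub (h1.const_smul q.1)
  have hcomp : fderiv ℝ (flowEquation hV) (q, γ) ∘L .inr ℝ (ℝ × F) C(unitInterval, F) = 1 - B := by
    have h1 := (hcd.differentiableAt (by simp)).hasFDerivAt.comp γ
      (hasFDerivAt_prodMk_right q γ)
    exact h1.unique hpart
  have hinv : (fderiv ℝ (flowEquation hV) (q, γ) ∘L
      .inr ℝ (ℝ × F) C(unitInterval, F)).IsInvertible := by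
    rw [hcomp]
    exact ⟨ContinuousLinearEquiv.ofUnit (Units.oneSub B hB), rfl⟩
  have hs := hcd.contDiffAt_implicitFunction (by simp) hinv
  have hz := hcd.eventually_apply_implicitFunction (by simp) hinv
  have hsmall : ∀ᶠ p : ℝ × F in 𝓝 q, |p.1| * C < 1 :=
    ContinuousAt.eventually_lt (by fun_prop) continuousAt_const hq
  have heq : ∀ᶠ p in 𝓝 q, flowLine hV hc p = hcd.implicitFunction (by simp) hinv p := by
    filter_upwards [hz, hsmall] with p hp hp'
    exact flowEquation_unique hV hC hp' (flowEquation_flowLine hV hc p)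
      (hp.trans (flowEquation_flowLine hV hc q))
  -- The flow line with parameter t, evaluated at s = 1, is the flow at time t.
  have hev := (ContinuousMap.evalCLM ℝ (1 : unitInterval) (M := F)).contDiff.contDiffAt.comp q hs
  refine hev.congr_of_eventuallyEq ?_
  filter_upwards [heq] with p hp
  simp [← hp, flowLine]

/-- The flow at time t is the n-th iterate of the flow at time t/n; for n > |t|C every factor is in
the range of `contDiffAt_flow_of_small`. -/
theorem contDiff_flow : ContDiff ℝ ∞ (fun q : ℝ × F ↦ flow hV hc q.1 q.2) := by
  obtain ⟨C, hC⟩ := ContDiff.lipschitzWith_of_hasCompactSupport hc hV (by simp)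
  rw [contDiff_iff_contDiffAt]
  intro q
  obtain ⟨n, hn⟩ := exists_nat_gt (|q.1| * C)
  have hn0 : (0 : ℝ) < n := lt_of_le_of_lt (by positivity) hn
  have hiter (k : ℕ) (t : ℝ) (x : F) : (flow hV hc t)^[k] x = flow hV hc (k * t) x := by
    induction k with
    | zero => simp [flow_zero]
    | succ k ih => rw [Function.iterate_succ_apply', ih, ← flow_add]; push_cast; ring_nf
  have hk (k : ℕ) : ContDiffAt ℝ ∞
      (fun q : ℝ × F ↦ (flow hV hc (q.1 / n))^[k] q.2) q := by
    induction k with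
    | zero => exact contDiffAt_snd
    | succ k ih =>
      simp only [Function.iterate_succ_apply']
      refine ContDiffAt.comp (x := q) (g := fun q : ℝ × F ↦ flow hV hc q.1 q.2)
        (f := fun q : ℝ × F ↦ (q.1 / n, (flow hV hc (q.1 / n))^[k] q.2)) ?_
        ((contDiffAt_fst.div_const _).prodMk ih)
      refine contDiffAt_flow_of_small hV hc hC ?_
      rw [abs_div, abs_of_pos hn0, div_mul_eq_mul_div, div_lt_one hn0]
      exact hn
  refine (hk n).congr_of_eventuallyEq (Filter.Eventually.of_forall fun p ↦ ?_)
  simp only [hiter]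
  rw [mul_div_cancel₀ _ hn0.ne']

end Flow

/-! ### Pullbacks, Lie derivatives and brackets on ℝᵐ. -/

section Coordinates

variable {m n : ℕ}

/-- Bilinear forms on `ℝᵐ`. -/
abbrev Bil (m : ℕ) : Type := E m →L[ℝ] E m →L[ℝ] ℝ

noncomputable instance : NormedAddCommGroup (E m →L[ℝ] E n →L[ℝ] ℝ) :=
  ContinuousLinearMap.toNormedAddCommGroup

noncomputable instance : NormedSpace ℝ (E m →L[ℝ] E n →L[ℝ] ℝ) :=
  ContinuousLinearMap.toNormedSpace

noncomputable instance : AddCommGroup (E m →L[ℝ] E n →L[ℝ] ℝ) :=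
  ContinuousLinearMap.addCommGroup

noncomputable instance {k : ℕ} : NormedAddCommGroup (E k →L[ℝ] E m →L[ℝ] E n →L[ℝ] ℝ) :=
  ContinuousLinearMap.toNormedAddCommGroup

noncomputable instance {k : ℕ} : NormedSpace ℝ (E k →L[ℝ] E m →L[ℝ] E n →L[ℝ] ℝ) :=
  ContinuousLinearMap.toNormedSpace

noncomputable instance {k : ℕ} : AddCommGroup (E k →L[ℝ] E m →L[ℝ] E n →L[ℝ] ℝ) :=
  ContinuousLinearMap.addCommGroup

theorem minSmoothness_two_le_infty : minSmoothness ℝ 2 ≤ (∞ : ℕ∞ω) := by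
  simp only [minSmoothness_of_isRCLikeNormedField]
  exact WithTop.coe_le_coe.2 (le_top : (2 : ℕ∞) ≤ ⊤)

/-- The pullback of a bilinear form by a linear map. -/
noncomputable def pull (B : Bil n) (P : E m →L[ℝ] E n) : Bil m := B.bilinearComp P P

@[simp] theorem pull_apply (B : Bil n) (P : E m →L[ℝ] E n) (v w : E m) :
    pull B P v w = B (P v) (P w) := rfl

theorem pull_id (B : Bil m) : pull B (ContinuousLinearMap.id ℝ (E m)) = B := rfl

theorem pull_comp {k : ℕ} (B : Bil n) (P : E m →L[ℝ] E n) (Q : E k →L[ℝ] E m) :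
    pull B (P.comp Q) = pull (pull B P) Q := rfl

/-- The Lie derivative of a field of bilinear forms on `ℝᵐ`. -/
noncomputable def lieC (U : E m → E m) (A : E m → Bil m) (y : E m) : Bil m :=
  fderiv ℝ A y (U y) + (A y).bilinearComp (fderiv ℝ U y) (.id ℝ _) +
    (A y).bilinearComp (.id ℝ _) (fderiv ℝ U y)

theorem lieC_apply (U : E m → E m) (A : E m → Bil m) (y v w : E m) :
    lieC U A y v w = fderiv ℝ A y (U y) v w + A y (fderiv ℝ U y v) w + A y v (fderiv ℝ U y w) :=
  rfl

theorem bilinearComp_eq (B : Bil n) (P Q : E m →L[ℝ] E n) :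
    B.bilinearComp P Q = ((B.comp P).flip.comp Q).flip := rfl

theorem contDiffAt_bilinearComp {G : Type*} [NormedAddCommGroup G] [NormedSpace ℝ G]
    {B : G → Bil n} {P Q : G → E m →L[ℝ] E n} {x : G} {k : ℕ∞ω} (hB : ContDiffAt ℝ k B x)
    (hP : ContDiffAt ℝ k P x) (hQ : ContDiffAt ℝ k Q x) :
    ContDiffAt ℝ k (fun z ↦ (B z).bilinearComp (P z) (Q z)) x := by
  simp only [bilinearComp_eq]
  have hflip {a b : ℕ} {f : G → E a →L[ℝ] E b →L[ℝ] ℝ} (hf : ContDiffAt ℝ k f x) :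
      ContDiffAt ℝ k (fun z ↦ (f z).flip) x :=
    (ContinuousLinearMap.flipₗᵢ ℝ (E a) (E b) ℝ).contDiff.contDiffAt.comp x hf
  exact hflip ((hflip (hB.clm_comp hP)).clm_comp hQ)

theorem contDiffAt_pull {G : Type*} [NormedAddCommGroup G] [NormedSpace ℝ G]
    {B : G → Bil n} {P : G → E m →L[ℝ] E n} {x : G} {k : ℕ∞ω} (hB : ContDiffAt ℝ k B x)
    (hP : ContDiffAt ℝ k P x) : ContDiffAt ℝ k (fun z ↦ pull (B z) (P z)) x :=
  contDiffAt_bilinearComp hB hP hP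

theorem contDiffAt_lieC {U : E m → E m} {A : E m → Bil m} {y : E m} (hU : ContDiffAt ℝ ∞ U y)
    (hA : ContDiffAt ℝ ∞ A y) : ContDiffAt ℝ ∞ (lieC U A) y := by
  have h1 := (hA.fderiv_right (m := ∞) (by simp)).clm_apply hU
  have h2 := hU.fderiv_right (m := ∞) (by simp)
  exact (h1.add (contDiffAt_bilinearComp hA h2 contDiffAt_const)).add
    (contDiffAt_bilinearComp hA contDiffAt_const h2)

theorem lieC_congr {U U' : E m → E m} {A A' : E m → Bil m} {y : E m} (hU : U =ᶠ[𝓝 y] U')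
    (hA : A =ᶠ[𝓝 y] A') : lieC U A y = lieC U' A' y := by
  simp only [lieC, hU.fderiv_eq, hA.fderiv_eq, hU.eq_of_nhds, hA.eq_of_nhds]

theorem fderiv_apply_apply {G : Type*} [NormedAddCommGroup G] [NormedSpace ℝ G]
    {A : G → Bil m} {y : G} (hA : DifferentiableAt ℝ A y) (v w : E m) (u : G) :
    fderiv ℝ A y u v w = fderiv ℝ (fun z ↦ A z v w) y u := by
  have h1 := (hA.hasFDerivAt.clm_apply (hasFDerivAt_const v y)).clm_apply (hasFDerivAt_const w y)
  rw [h1.fderiv]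
  simp

/-- Derivative of `z ↦ B_z(P_z, Q_z)`. -/
theorem fderiv_apply_apply_comp {G : Type*} [NormedAddCommGroup G] [NormedSpace ℝ G]
    {B : G → Bil n} {P Q : G → E n} {x : G} {B' : G →L[ℝ] Bil n} {P' Q' : G →L[ℝ] E n}
    (hB : HasFDerivAt B B' x) (hP : HasFDerivAt P P' x) (hQ : HasFDerivAt Q Q' x) (u : G) :
    fderiv ℝ (fun z ↦ B z (P z) (Q z)) x u =
      B' u (P x) (Q x) + B x (P' u) (Q x) + B x (P x) (Q' u) := by
  rw [((hB.clm_apply hP).clm_apply hQ).fderiv]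
  simp
  ring

/-- Naturality of the Lie derivative for τ-related fields: the terms with D²τ are absorbed by
differentiating Dτ·U' = U∘τ and using the symmetry of D²τ. With τ a transition map, this gives
independence of the chart. -/
theorem lieC_pull {τ : E m → E m} {A : E m → Bil m} {U U' : E m → E m} {y : E m}
    (hτ : ContDiffAt ℝ ∞ τ y) (hA : DifferentiableAt ℝ A (τ y)) (hU : DifferentiableAt ℝ U (τ y))
    (hU' : DifferentiableAt ℝ U' y) (hrel : ∀ᶠ z in 𝓝 y, fderiv ℝ τ z (U' z) = U (τ z)) :
    lieC U' (fun z ↦ pull (A (τ z)) (fderiv ℝ τ z)) y = pull (lieC U A (τ y)) (fderiv ℝ τ y) := by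
  have hd := hτ.differentiableAt (by simp)
  have hd2 : DifferentiableAt ℝ (fderiv ℝ τ) y :=
    (hτ.fderiv_right (m := ∞) (by simp)).differentiableAt (by simp)
  have hAτ : HasFDerivAt (fun z ↦ A (τ z)) (fderiv ℝ A (τ y) ∘L fderiv ℝ τ y) y :=
    hA.hasFDerivAt.comp y hd.hasFDerivAt
  have hpull : DifferentiableAt ℝ (fun z ↦ pull (A (τ z)) (fderiv ℝ τ z)) y := by
    simp only [pull, bilinearComp_eq]
    have hflip {f : E m → Bil m} (hf : DifferentiableAt ℝ f y) :
        DifferentiableAt ℝ (fun z ↦ (f z).flip) y :=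
      (ContinuousLinearMap.flipₗᵢ ℝ (E m) (E m) ℝ).differentiable.differentiableAt.comp y hf
    exact hflip ((hflip (hAτ.differentiableAt.clm_comp hd2)).clm_comp hd2)
  have hv (v : E m) : HasFDerivAt (fun z ↦ fderiv ℝ τ z v) ((fderiv ℝ (fderiv ℝ τ) y).flip v) y := by
    have := hd2.hasFDerivAt.clm_apply (hasFDerivAt_const v y)
    convert! this using 1
    ext; simp
  -- The relation between the fields, differentiated in the direction `v`.
  have hrel' (v : E m) : fderiv ℝ (fderiv ℝ τ) y v (U' y) + fderiv ℝ τ y (fderiv ℝ U' y v) =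
      fderiv ℝ U (τ y) (fderiv ℝ τ y v) := by
    have h1 := hd2.hasFDerivAt.clm_apply hU'.hasFDerivAt
    have h2 := hU.hasFDerivAt.comp y hd.hasFDerivAt
    have h3 := h2.unique (h1.congr_of_eventuallyEq (hrel.mono fun z hz ↦ hz.symm))
    have := DFunLike.congr_fun h3 v
    simp only [ContinuousLinearMap.comp_apply, _root_.add_apply,
      ContinuousLinearMap.flip_apply] at this
    rw [this, add_comm]
  have hsymm (v w : E m) : fderiv ℝ (fderiv ℝ τ) y v w = fderiv ℝ (fderiv ℝ τ) y w v :=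
    (hτ.isSymmSndFDerivAt minSmoothness_two_le_infty) v w
  ext v w
  rw [lieC_apply, fderiv_apply_apply hpull]
  simp only [pull_apply]
  rw [fderiv_apply_apply_comp hAτ (hv v) (hv w), lieC_apply, ← hrel', ← hrel', ← hrel.self_of_nhds]
  simp only [ContinuousLinearMap.comp_apply, ContinuousLinearMap.flip_apply, map_add,
    _root_.add_apply]
  rw [hsymm (U' y) v, hsymm (U' y) w]
  ring

/-- As for `lieC_pull`: the two D²τ terms cancel by symmetry. -/
theorem lieBracket_rel {τ : E m → E m} {U U' W W' : E m → E m} {y : E m}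
    (hτ : ContDiffAt ℝ ∞ τ y) (hU : DifferentiableAt ℝ U (τ y))
    (hU' : DifferentiableAt ℝ U' y) (hW : DifferentiableAt ℝ W (τ y))
    (hW' : DifferentiableAt ℝ W' y)
    (hrelU : ∀ᶠ z in 𝓝 y, fderiv ℝ τ z (U' z) = U (τ z))
    (hrelW : ∀ᶠ z in 𝓝 y, fderiv ℝ τ z (W' z) = W (τ z)) :
    fderiv ℝ τ y (VectorField.lieBracket ℝ U' W' y) = VectorField.lieBracket ℝ U W (τ y) := by
  have hd := hτ.differentiableAt (by simp)
  have hd2 : DifferentiableAt ℝ (fderiv ℝ τ) y :=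
    (hτ.fderiv_right (m := ∞) (by simp)).differentiableAt (by simp)
  have key {X X' : E m → E m} (hX : DifferentiableAt ℝ X (τ y)) (hX' : DifferentiableAt ℝ X' y)
      (hrel : ∀ᶠ z in 𝓝 y, fderiv ℝ τ z (X' z) = X (τ z)) (v : E m) :
      fderiv ℝ (fderiv ℝ τ) y v (X' y) + fderiv ℝ τ y (fderiv ℝ X' y v) =
      fderiv ℝ X (τ y) (fderiv ℝ τ y v) := by
    have h1 := hd2.hasFDerivAt.clm_apply hX'.hasFDerivAt
    have h2 := hX.hasFDerivAt.comp y hd.hasFDerivAt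
    have h3 := h2.unique (h1.congr_of_eventuallyEq (hrel.mono fun z hz ↦ hz.symm))
    have := DFunLike.congr_fun h3 v
    simp only [ContinuousLinearMap.comp_apply, _root_.add_apply,
      ContinuousLinearMap.flip_apply] at this
    rw [this, add_comm]
  have hsymm (v w : E m) : fderiv ℝ (fderiv ℝ τ) y v w = fderiv ℝ (fderiv ℝ τ) y w v :=
    (hτ.isSymmSndFDerivAt minSmoothness_two_le_infty) v w
  simp only [VectorField.lieBracket]
  rw [map_sub, ← hrelU.self_of_nhds, ← hrelW.self_of_nhds, ← key hU hU' hrelU,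
    ← key hW hW' hrelW, hsymm (U' y) (W' y)]
  abel

theorem fderiv_lieC_apply {U : E m → E m} {A : E m → Bil m} {y : E m}
    (hU : ContDiffAt ℝ ∞ U y) (hA : ContDiffAt ℝ ∞ A y) (u v w : E m) :
    fderiv ℝ (lieC U A) y u v w =
      fderiv ℝ (fderiv ℝ A) y u (U y) v w + fderiv ℝ A y (fderiv ℝ U y u) v w +
      fderiv ℝ A y u (fderiv ℝ U y v) w + A y (fderiv ℝ (fderiv ℝ U) y u v) w +
      (fderiv ℝ A y u v (fderiv ℝ U y w) + A y v (fderiv ℝ (fderiv ℝ U) y u w)) := by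
  have hA1 := (hA.differentiableAt (by simp)).hasFDerivAt
  have hU1 := (hU.differentiableAt (by simp)).hasFDerivAt
  have hA2 : HasFDerivAt (fderiv ℝ A) _ y :=
    ((hA.fderiv_right (m := ∞) (by simp)).differentiableAt (by simp)).hasFDerivAt
  have hU2 : HasFDerivAt (fderiv ℝ U) _ y :=
    ((hU.fderiv_right (m := ∞) (by simp)).differentiableAt (by simp)).hasFDerivAt
  rw [fderiv_apply_apply ((contDiffAt_lieC hU hA).differentiableAt (by simp))]
  have h1 := ((hA2.clm_apply hU1).clm_apply (hasFDerivAt_const v y)).clm_apply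
    (hasFDerivAt_const w y)
  have h2 := (hA1.clm_apply (hU2.clm_apply (hasFDerivAt_const v y))).clm_apply
    (hasFDerivAt_const w y)
  have h3 := (hA1.clm_apply (hasFDerivAt_const v y)).clm_apply
    (hU2.clm_apply (hasFDerivAt_const w y))
  have h := (h1.add h2).add h3
  have h' := DFunLike.congr_fun h.fderiv u
  simp only [lieC_apply]
  refine h'.trans ?_
  simp
  ring

/-- The second derivatives of A cancel by symmetry, the mixed first-order products cancel in pairs,
and the second derivatives of U and W assemble into the derivative of [W, U]. -/
theorem lieC_commutator {U W : E m → E m} {A : E m → Bil m} {y : E m}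
    (hU : ContDiffAt ℝ ∞ U y) (hW : ContDiffAt ℝ ∞ W y) (hA : ContDiffAt ℝ ∞ A y) :
    lieC W (lieC U A) y - lieC U (lieC W A) y = lieC (VectorField.lieBracket ℝ W U) A y := by
  have hsA (v w : E m) : fderiv ℝ (fderiv ℝ A) y v w = fderiv ℝ (fderiv ℝ A) y w v :=
    (hA.isSymmSndFDerivAt minSmoothness_two_le_infty) v w
  have hsU (v w : E m) : fderiv ℝ (fderiv ℝ U) y v w = fderiv ℝ (fderiv ℝ U) y w v :=
    (hU.isSymmSndFDerivAt minSmoothness_two_le_infty) v w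
  have hsW (v w : E m) : fderiv ℝ (fderiv ℝ W) y v w = fderiv ℝ (fderiv ℝ W) y w v :=
    (hW.isSymmSndFDerivAt minSmoothness_two_le_infty) v w
  have hU1 := (hU.differentiableAt (by simp)).hasFDerivAt
  have hW1 := (hW.differentiableAt (by simp)).hasFDerivAt
  have hU2 : HasFDerivAt (fderiv ℝ U) _ y :=
    ((hU.fderiv_right (m := ∞) (by simp)).differentiableAt (by simp)).hasFDerivAt
  have hW2 : HasFDerivAt (fderiv ℝ W) _ y :=
    ((hW.fderiv_right (m := ∞) (by simp)).differentiableAt (by simp)).hasFDerivAt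
  have hbr (v : E m) : fderiv ℝ (VectorField.lieBracket ℝ W U) y v =
      fderiv ℝ (fderiv ℝ U) y v (W y) + fderiv ℝ U y (fderiv ℝ W y v) -
      (fderiv ℝ (fderiv ℝ W) y v (U y) + fderiv ℝ W y (fderiv ℝ U y v)) := by
    have h' := DFunLike.congr_fun ((hU2.clm_apply hW1).sub (hW2.clm_apply hU1)).fderiv v
    refine Eq.trans ?_ (h'.trans ?_)
    · rfl
    · simp [add_comm]
  ext v w
  simp only [_root_.sub_apply]
  rw [lieC_apply W, lieC_apply U (lieC W A), lieC_apply (VectorField.lieBracket ℝ W U),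
    fderiv_lieC_apply hU hA, fderiv_lieC_apply hW hA, hbr, hbr]
  simp only [lieC_apply, VectorField.lieBracket, map_sub, map_add, _root_.sub_apply,
    _root_.add_apply]
  rw [hsA (W y) (U y), hsU (W y) v, hsU (W y) w, hsW (U y) v, hsW (U y) w]
  ring

theorem lieC_add {U W : E m → E m} (A : E m → Bil m) {y : E m} (hU : DifferentiableAt ℝ U y)
    (hW : DifferentiableAt ℝ W y) : lieC (U + W) A y = lieC U A y + lieC W A y := by
  ext v w
  simp only [lieC_apply, _root_.add_apply, fderiv_add hU hW, Pi.add_apply, map_add]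
  ring

theorem lieC_smul (c : ℝ) (U : E m → E m) (A : E m → Bil m) (y : E m) :
    lieC (c • U) A y = c • lieC U A y := by
  ext v w
  simp only [lieC_apply, _root_.smul_apply, fderiv_const_smul_field, Pi.smul_apply,
    map_smul, smul_eq_mul]
  ring

end Coordinates

/-! ### Traces, inner products and densities through Gram matrices. -/

section Matrices

variable {m : ℕ}

/-- The matrix of a bilinear form in the standard basis. -/
noncomputable def mat (B : Bil m) : Matrix (Fin m) (Fin m) ℝ :=
  Matrix.of fun i j ↦ B (basisVec i) (basisVec j)

theorem mat_apply (B : Bil m) (i j : Fin m) : mat B i j = B (basisVec i) (basisVec j) := rfl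

theorem mat_add (A B : Bil m) : mat (A + B) = mat A + mat B := rfl

theorem mat_sub (A B : Bil m) : mat (A - B) = mat A - mat B := rfl

/-- The matrix of a linear map in the standard basis. -/
noncomputable def lmat (P : E m →L[ℝ] E m) : Matrix (Fin m) (Fin m) ℝ :=
  Matrix.of fun i j ↦ P (basisVec j) i

theorem sum_smul_basisVec (v : E m) : ∑ i, v i • basisVec i = v := by
  ext j
  simp [basisVec, Pi.single_apply]

theorem apply_basisVec_left (B : Bil m) (v w : E m) : B v w = ∑ i, v i * B (basisVec i) w := by
  conv_lhs => rw [← sum_smul_basisVec v]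
  simp

theorem apply_basisVec_right (B : Bil m) (v w : E m) : B v w = ∑ i, B v (basisVec i) * w i := by
  conv_lhs => rw [← sum_smul_basisVec w]
  simp [mul_comm]

theorem mat_comp_left (B : Bil m) (P : E m →L[ℝ] E m) :
    mat (B.bilinearComp P (.id ℝ _)) = (lmat P).transpose * mat B := by
  ext i j
  simp only [mat_apply, Matrix.mul_apply, lmat, Matrix.transpose_apply, Matrix.of_apply]
  exact apply_basisVec_left B (P (basisVec i)) (basisVec j)

theorem mat_comp_right (B : Bil m) (P : E m →L[ℝ] E m) :
    mat (B.bilinearComp (.id ℝ _) P) = mat B * lmat P := by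
  ext i j
  simp only [mat_apply, Matrix.mul_apply, lmat, Matrix.of_apply]
  exact apply_basisVec_right B (basisVec i) (P (basisVec j))

theorem mat_pull (B : Bil m) (P : E m →L[ℝ] E m) :
    mat (pull B P) = (lmat P).transpose * mat B * lmat P := by
  rw [← mat_comp_left, ← mat_comp_right]
  rfl

theorem lmat_comp (P Q : E m →L[ℝ] E m) : lmat (P.comp Q) = lmat P * lmat Q := by
  ext i j
  simp only [lmat, Matrix.mul_apply, Matrix.of_apply, ContinuousLinearMap.comp_apply]
  conv_lhs => rw [← sum_smul_basisVec (Q (basisVec j))]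
  simp [mul_comm]

theorem lmat_id : lmat (.id ℝ (E m)) = 1 := by
  ext i j
  simp [lmat, basisVec, Matrix.one_apply]

theorem det_lmat (P : E m →L[ℝ] E m) : (lmat P).det = P.det := by
  have : lmat P = LinearMap.toMatrix (EuclideanSpace.basisFun (Fin m) ℝ).toBasis
      (EuclideanSpace.basisFun (Fin m) ℝ).toBasis (P : E m →ₗ[ℝ] E m) := by
    ext i j
    simp [lmat, LinearMap.toMatrix_apply, basisVec]
  rw [this, LinearMap.det_toMatrix]

/-- The trace of `A` with respect to `G`. -/
noncomputable def trC (G A : Bil m) : ℝ := ∑ i, ∑ j, (mat G)⁻¹ i j * mat A i j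

/-- The inner product of `A` and `B` with respect to `G`. -/
noncomputable def innerC (G A B : Bil m) : ℝ :=
  ∑ i, ∑ j, ∑ k, ∑ l, (mat G)⁻¹ i k * (mat G)⁻¹ j l * (mat A i j * mat B k l)

theorem trC_eq_trace (G A : Bil m) : trC G A = ((mat G)⁻¹ * (mat A).transpose).trace := by
  simp [trC, Matrix.trace, Matrix.mul_apply]

theorem innerC_eq_trace (G A B : Bil m) :
    innerC G A B = ((mat G)⁻¹.transpose * mat A * (mat G)⁻¹ * (mat B).transpose).trace := by
  simp only [innerC, Matrix.trace, Matrix.mul_apply, Matrix.diag_apply, Matrix.transpose_apply,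
    Finset.sum_mul]
  have h1 (k l j i : Fin m) : (mat G)⁻¹ i k * mat A i j * (mat G)⁻¹ j l * mat B k l =
      (mat G)⁻¹ i k * (mat G)⁻¹ j l * (mat A i j * mat B k l) := by ring
  simp only [h1]
  have h2 : ∀ f : Fin m → Fin m → Fin m → Fin m → ℝ, ∑ i, ∑ j, ∑ k, ∑ l, f i j k l =
      ∑ k, ∑ l, ∑ j, ∑ i, f i j k l := by
    intro f
    rw [Finset.sum_comm]
    simp_rw [Finset.sum_comm (γ := Fin m) (s := Finset.univ) (t := Finset.univ)
      (f := fun i k ↦ ∑ l, f i _ k l)]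
    rw [Finset.sum_comm]
    refine Finset.sum_congr rfl fun k _ ↦ ?_
    simp_rw [Finset.sum_comm (γ := Fin m) (s := Finset.univ) (t := Finset.univ)
      (f := fun i l ↦ f i _ k l)]
    rw [Finset.sum_comm]
  exact h2 _

theorem trC_add (G A B : Bil m) : trC G (A + B) = trC G A + trC G B := by
  simp [trC, mat_add, mul_add, Finset.sum_add_distrib]

theorem trC_sub (G A B : Bil m) : trC G (A - B) = trC G A - trC G B := by
  simp [trC, mat_sub, mul_sub, Finset.sum_sub_distrib]

theorem isUnit_lmat {P Q : E m →L[ℝ] E m} (h : P.comp Q = .id ℝ _) : IsUnit (lmat P).det := by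
  rw [← Matrix.isUnit_iff_isUnit_det]
  have := lmat_comp P Q
  rw [h, lmat_id] at this
  exact IsUnit.of_mul_eq_one _ this.symm

/-- Pulling back changes matrices by congruence, and the factors P and P⁻¹ cancel by cyclicity of
the trace. The one-sided inverse `Q` serves only to make the square matrix of P invertible. -/
theorem trC_pull (G A : Bil m) {P Q : E m →L[ℝ] E m} (h : P.comp Q = .id ℝ _) :
    trC (pull G P) (pull A P) = trC G A := by
  have hP := isUnit_lmat h
  have hPt : IsUnit (lmat P).transpose.det := by rwa [Matrix.det_transpose]
  rw [trC_eq_trace, trC_eq_trace, mat_pull, mat_pull, Matrix.mul_inv_rev, Matrix.mul_inv_rev,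
    Matrix.transpose_mul, Matrix.transpose_mul, Matrix.transpose_transpose]
  rw [show (lmat P)⁻¹ * ((mat G)⁻¹ * (lmat P).transpose⁻¹) *
      ((lmat P).transpose * ((mat A).transpose * lmat P)) =
      (lmat P)⁻¹ * ((mat G)⁻¹ * ((lmat P).transpose⁻¹ * (lmat P).transpose) *
      (mat A).transpose * lmat P) by simp only [Matrix.mul_assoc]]
  rw [Matrix.nonsing_inv_mul _ hPt, Matrix.mul_one, Matrix.trace_mul_comm, Matrix.mul_assoc,
    Matrix.mul_nonsing_inv _ hP, Matrix.mul_one]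

theorem innerC_pull (G A B : Bil m) {P Q : E m →L[ℝ] E m} (h : P.comp Q = .id ℝ _) :
    innerC (pull G P) (pull A P) (pull B P) = innerC G A B := by
  have hP := isUnit_lmat h
  have hPt : IsUnit (lmat P).transpose.det := by rwa [Matrix.det_transpose]
  rw [innerC_eq_trace, innerC_eq_trace, mat_pull, mat_pull, mat_pull]
  set p := lmat P
  simp only [Matrix.mul_inv_rev, Matrix.transpose_mul, Matrix.transpose_transpose,
    Matrix.transpose_nonsing_inv, Matrix.mul_assoc]
  rw [show p⁻¹ * ((mat G).transpose⁻¹ * (p.transpose⁻¹ * (p.transpose * (mat A * (p *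
      (p⁻¹ * ((mat G)⁻¹ * (p.transpose⁻¹ * (p.transpose * ((mat B).transpose * p)))))))))) =
      p⁻¹ * ((mat G).transpose⁻¹ * (p.transpose⁻¹ * p.transpose) * mat A * (p * p⁻¹) * (mat G)⁻¹ *
        (p.transpose⁻¹ * p.transpose) * (mat B).transpose * p) by simp only [Matrix.mul_assoc]]
  rw [Matrix.nonsing_inv_mul _ hPt, Matrix.mul_nonsing_inv _ hP, Matrix.trace_mul_comm]
  simp only [Matrix.mul_one, Matrix.mul_assoc, Matrix.mul_nonsing_inv _ hP]

/-- The Riemannian density of a bilinear form. -/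
noncomputable def dens (G : Bil m) : ℝ := Real.sqrt (mat G).det

/-- The determinant is multiplied by (det P)²; its root supplies the Jacobian in the change of
variables between charts. -/
theorem dens_pull (G : Bil m) (P : E m →L[ℝ] E m) : dens (pull G P) = |P.det| * dens G := by
  rw [dens, mat_pull, Matrix.det_mul, Matrix.det_mul, Matrix.det_transpose, det_lmat, dens,
    show P.det * (mat G).det * P.det = P.det ^ 2 * (mat G).det by ring,
    Real.sqrt_mul (sq_nonneg _), Real.sqrt_sq_eq_abs]

/-- Symmetric positive definite bilinear forms. -/
structure IsMetric (G : Bil m) : Prop where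
  symm : ∀ v w, G v w = G w v
  pos : ∀ v, v ≠ 0 → 0 < G v v

theorem IsMetric.pull {G : Bil m} (hG : IsMetric G) {P Q : E m →L[ℝ] E m}
    (h : Q.comp P = .id ℝ _) : IsMetric (pull G P) where
  symm _ _ := hG.symm _ _
  pos v hv := hG.pos (P v) fun h0 ↦ hv (by
    have := DFunLike.congr_fun h v
    rw [ContinuousLinearMap.comp_apply, h0, map_zero] at this
    exact this.symm)

theorem IsMetric.posDef {G : Bil m} (hG : IsMetric G) : (mat G).PosDef := by
  refine Matrix.posDef_iff_dotProduct_mulVec.2 ⟨?_, ?_⟩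
  · ext i j
    exact hG.symm _ _
  · intro c hc
    have hne : (WithLp.toLp 2 c : E m) ≠ 0 := fun h ↦ hc (by simpa using congrArg WithLp.ofLp h)
    refine (hG.pos _ hne).trans_eq ?_
    rw [apply_basisVec_left]
    simp only [dotProduct, Matrix.mulVec, star_trivial]
    refine Finset.sum_congr rfl fun i _ ↦ ?_
    rw [apply_basisVec_right]
    rfl

theorem IsMetric.det_pos {G : Bil m} (hG : IsMetric G) : 0 < (mat G).det := hG.posDef.det_pos

theorem IsMetric.dens_pos {G : Bil m} (hG : IsMetric G) : 0 < dens G := Real.sqrt_pos.2 hG.det_pos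

theorem IsMetric.mat_transpose {G : Bil m} (hG : IsMetric G) : (mat G).transpose = mat G := by
  ext i j
  exact hG.symm _ _

section Smooth

variable {G : Type*} [NormedAddCommGroup G] [NormedSpace ℝ G] {k : ℕ∞ω} {x : G}

theorem contDiffAt_det {A : G → Matrix (Fin m) (Fin m) ℝ}
    (hA : ∀ i j, ContDiffAt ℝ k (fun z ↦ A z i j) x) : ContDiffAt ℝ k (fun z ↦ (A z).det) x := by
  simp only [Matrix.det_apply]
  refine ContDiffAt.sum fun σ _ ↦ ContDiffAt.const_smul _ ?_
  exact contDiffAt_prod fun i _ ↦ hA _ _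

theorem contDiffAt_inv {A : G → Matrix (Fin m) (Fin m) ℝ}
    (hA : ∀ i j, ContDiffAt ℝ k (fun z ↦ A z i j) x) (hx : (A x).det ≠ 0) (i j : Fin m) :
    ContDiffAt ℝ k (fun z ↦ (A z)⁻¹ i j) x := by
  simp only [Matrix.inv_def, Ring.inverse_eq_inv', Matrix.smul_apply, Matrix.adjugate_apply,
    smul_eq_mul]
  refine ((contDiffAt_det hA).inv hx).mul (contDiffAt_det fun a b ↦ ?_)
  by_cases h : a = j
  · subst h
    simpa using contDiffAt_const
  · simpa [Matrix.updateRow_ne h] using hA a b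

theorem contDiffAt_mat {A : G → Bil m} (hA : ContDiffAt ℝ k A x) (i j : Fin m) :
    ContDiffAt ℝ k (fun z ↦ mat (A z) i j) x :=
  (hA.clm_apply contDiffAt_const).clm_apply contDiffAt_const

theorem contDiffAt_trC {B A : G → Bil m} (hB : ContDiffAt ℝ k B x) (hA : ContDiffAt ℝ k A x)
    (hx : IsMetric (B x)) : ContDiffAt ℝ k (fun z ↦ trC (B z) (A z)) x := by
  refine ContDiffAt.sum fun i _ ↦ ContDiffAt.sum fun j _ ↦ ?_
  exact (contDiffAt_inv (contDiffAt_mat hB) hx.det_pos.ne' i j).mul (contDiffAt_mat hA i j)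

theorem contDiffAt_innerC {B A A' : G → Bil m} (hB : ContDiffAt ℝ k B x)
    (hA : ContDiffAt ℝ k A x) (hA' : ContDiffAt ℝ k A' x)
    (hx : IsMetric (B x)) : ContDiffAt ℝ k (fun z ↦ innerC (B z) (A z) (A' z)) x := by
  have hi := contDiffAt_inv (contDiffAt_mat hB) hx.det_pos.ne'
  refine ContDiffAt.sum fun i _ ↦ ContDiffAt.sum fun j _ ↦ ContDiffAt.sum fun p _ ↦
    ContDiffAt.sum fun l _ ↦ ?_
  exact ((hi i p).mul (hi j l)).mul ((contDiffAt_mat hA i j).mul (contDiffAt_mat hA' p l))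

theorem contDiffAt_dens {B : G → Bil m} (hB : ContDiffAt ℝ k B x) (hx : IsMetric (B x)) :
    ContDiffAt ℝ k (fun z ↦ dens (B z)) x :=
  (contDiffAt_det (contDiffAt_mat hB)).sqrt hx.det_pos.ne'

end Smooth

end Matrices

/-! ### Differential identities for traces, densities and pullbacks along a flow. -/

section Identities

variable {m : ℕ}

theorem mat_fderiv {A : E m → Bil m} {y : E m} (hA : DifferentiableAt ℝ A y) (u : E m)
    (i j : Fin m) : mat (fderiv ℝ A y u) i j = fderiv ℝ (fun z ↦ mat (A z) i j) y u :=
  fderiv_apply_apply hA _ _ _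

theorem mat_lieC (U : E m → E m) (A : E m → Bil m) (y : E m) :
    mat (lieC U A y) = mat (fderiv ℝ A y (U y)) + (lmat (fderiv ℝ U y)).transpose * mat (A y) +
      mat (A y) * lmat (fderiv ℝ U y) := by
  rw [lieC, mat_add, mat_add, mat_comp_left, mat_comp_right]

theorem fderiv_inv_mat {G : E m → Bil m} {y : E m} (hG : ContDiffAt ℝ ∞ G y) (hm : IsMetric (G y))
    (u : E m) (i j : Fin m) : fderiv ℝ (fun z ↦ (mat (G z))⁻¹ i j) y u =
      -((mat (G y))⁻¹ * mat (fderiv ℝ G y u) * (mat (G y))⁻¹) i j := by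
  let dN : Matrix (Fin m) (Fin m) ℝ := Matrix.of fun i j ↦ fderiv ℝ (fun z ↦ (mat (G z))⁻¹ i j) y u
  have hN (i j : Fin m) : DifferentiableAt ℝ (fun z ↦ (mat (G z))⁻¹ i j) y :=
    (contDiffAt_inv (contDiffAt_mat hG) hm.det_pos.ne' i j).differentiableAt (by simp)
  have hM (i j : Fin m) : DifferentiableAt ℝ (fun z ↦ mat (G z) i j) y :=
    (contDiffAt_mat hG i j).differentiableAt (by simp)
  have hunit : IsUnit (mat (G y)).det := hm.det_pos.ne'.isUnit
  -- The product rule applied to G⁻¹G = 1, which holds near `y` because the determinant stays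
  -- nonzero.
  have key : dN * mat (G y) + (mat (G y))⁻¹ * mat (fderiv ℝ G y u) = 0 := by
    ext a b
    have h1 := HasFDerivAt.fun_sum (u := Finset.univ) fun c _ ↦
      (hN a c).hasFDerivAt.mul (hM c b).hasFDerivAt
    have hev : ∀ᶠ z in 𝓝 y, (mat (G z)).det ≠ 0 :=
      (contDiffAt_det (contDiffAt_mat hG)).continuousAt.eventually_ne hm.det_pos.ne'
    have h2 : (fun z ↦ ∑ c, (mat (G z))⁻¹ a c * mat (G z) c b) =ᶠ[𝓝 y]
        fun _ ↦ (1 : Matrix (Fin m) (Fin m) ℝ) a b := by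
      filter_upwards [hev] with z hz
      rw [← Matrix.mul_apply, Matrix.nonsing_inv_mul _ hz.isUnit]
    have h3 := DFunLike.congr_fun (h1.unique ((hasFDerivAt_const _ y).congr_of_eventuallyEq h2)) u
    rw [Matrix.add_apply, Matrix.mul_apply, Matrix.mul_apply, ← Finset.sum_add_distrib]
    refine Eq.trans ?_ (h3.trans rfl)
    rw [_root_.sum_apply]
    refine Finset.sum_congr rfl fun c _ ↦ ?_
    rw [mat_fderiv (hG.differentiableAt (by simp))]
    simp [dN]
    ring
  have h4 : dN = -((mat (G y))⁻¹ * mat (fderiv ℝ G y u) * (mat (G y))⁻¹) := by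
    have h5 := congrArg (· * (mat (G y))⁻¹) (eq_neg_of_add_eq_zero_left key)
    simpa only [Matrix.mul_assoc, Matrix.mul_nonsing_inv _ hunit, Matrix.mul_one,
      Matrix.neg_mul] using h5
  exact congrFun (congrFun h4 i) j

theorem fderiv_trC {G A : E m → Bil m} {y : E m} (hG : ContDiffAt ℝ ∞ G y)
    (hA : ContDiffAt ℝ ∞ A y) (hm : IsMetric (G y)) (u : E m) :
    fderiv ℝ (fun z ↦ trC (G z) (A z)) y u =
      trC (G y) (fderiv ℝ A y u) - ((mat (G y))⁻¹ * mat (fderiv ℝ G y u) * (mat (G y))⁻¹ *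
        (mat (A y)).transpose).trace := by
  have hN (i j : Fin m) : DifferentiableAt ℝ (fun z ↦ (mat (G z))⁻¹ i j) y :=
    (contDiffAt_inv (contDiffAt_mat hG) hm.det_pos.ne' i j).differentiableAt (by simp)
  have hM (i j : Fin m) : DifferentiableAt ℝ (fun z ↦ mat (A z) i j) y :=
    (contDiffAt_mat hA i j).differentiableAt (by simp)
  have h1 := HasFDerivAt.fun_sum (u := Finset.univ) fun i _ ↦
    HasFDerivAt.fun_sum (u := Finset.univ) fun j _ ↦
      (hN i j).hasFDerivAt.mul (hM i j).hasFDerivAt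
  refine (DFunLike.congr_fun h1.fderiv u).trans ?_
  simp only [_root_.sum_apply, _root_.add_apply, _root_.smul_apply, smul_eq_mul,
    fderiv_inv_mat hG hm, trC, Matrix.trace, Matrix.diag_apply]
  rw [← Finset.sum_sub_distrib]
  refine Finset.sum_congr rfl fun i _ ↦ ?_
  rw [Matrix.mul_apply, ← Finset.sum_sub_distrib]
  refine Finset.sum_congr rfl fun j _ ↦ ?_
  rw [mat_fderiv (hA.differentiableAt (by simp)), Matrix.transpose_apply]
  ring

theorem IsMetric.transpose_mat_fderiv {G : E m → Bil m} {y : E m} (hG : ContDiffAt ℝ ∞ G y)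
    (hm : ∀ᶠ z in 𝓝 y, IsMetric (G z)) (u : E m) :
    (mat (fderiv ℝ G y u)).transpose = mat (fderiv ℝ G y u) := by
  ext i j
  rw [Matrix.transpose_apply, mat_fderiv (hG.differentiableAt (by simp)),
    mat_fderiv (hG.differentiableAt (by simp))]
  have : (fun z ↦ mat (G z) j i) =ᶠ[𝓝 y] fun z ↦ mat (G z) i j := by
    filter_upwards [hm] with z hz
    exact hz.symm _ _
  rw [this.fderiv_eq]

/-- The Lie derivative of the trace of a `(0,2)` tensor: `⟨A, L_U G⟩ = tr (L_U A) - U (tr A)`. -/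
theorem innerC_lieC {G A : E m → Bil m} {U : E m → E m} {y : E m} (hG : ContDiffAt ℝ ∞ G y)
    (hA : ContDiffAt ℝ ∞ A y) (hm : ∀ᶠ z in 𝓝 y, IsMetric (G z)) :
    innerC (G y) (A y) (lieC U G y) =
      trC (G y) (lieC U A y) - fderiv ℝ (fun z ↦ trC (G z) (A z)) y (U y) := by
  have hmy := hm.self_of_nhds
  have hdG := IsMetric.transpose_mat_fderiv hG hm (U y)
  have hGt := hmy.mat_transpose
  have hu : IsUnit (mat (G y)).det := hmy.det_pos.ne'.isUnit
  rw [fderiv_trC hG hA hmy, innerC_eq_trace, trC_eq_trace, trC_eq_trace, mat_lieC, mat_lieC]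
  set M := mat (G y)
  set a := mat (A y)
  set dG := mat (fderiv ℝ G y (U y))
  set dA := mat (fderiv ℝ A y (U y))
  set J := lmat (fderiv ℝ U y)
  have hNt : M⁻¹.transpose = M⁻¹ := by rw [Matrix.transpose_nonsing_inv, hGt]
  simp only [Matrix.transpose_add, Matrix.transpose_mul, Matrix.transpose_transpose, hdG, hGt, hNt,
    Matrix.mul_add, Matrix.trace_add]
  -- `e1` and `e2` match the DU terms of L_U G with those of tr(L_U A); `e3` matches the ∂_U G term
  -- with the derivative of the inverse metric in U(tr A). Only G is symmetric here, so `a` is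
  -- transposed with care.
  have e1 : (M⁻¹ * a * M⁻¹ * (M * J)).trace = (M⁻¹ * (J.transpose * a.transpose)).trace := by
    rw [← Matrix.trace_transpose (M⁻¹ * (J.transpose * a.transpose))]
    simp only [Matrix.transpose_mul, Matrix.transpose_transpose, hNt]
    rw [Matrix.mul_assoc _ M⁻¹, ← Matrix.mul_assoc M⁻¹ M, Matrix.nonsing_inv_mul _ hu,
      Matrix.one_mul, Matrix.mul_assoc M⁻¹, Matrix.trace_mul_comm]
  have e2 : (M⁻¹ * a * M⁻¹ * (J.transpose * M)).trace = (M⁻¹ * (a.transpose * J)).trace := by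
    rw [← Matrix.trace_transpose (M⁻¹ * (a.transpose * J))]
    simp only [Matrix.transpose_mul, Matrix.transpose_transpose, hNt]
    rw [← Matrix.mul_assoc, Matrix.trace_mul_comm]
    simp only [← Matrix.mul_assoc]
    rw [Matrix.mul_nonsing_inv _ hu, Matrix.one_mul, Matrix.trace_mul_comm, ← Matrix.mul_assoc]
  have e3 : (M⁻¹ * dG * M⁻¹ * a.transpose).trace = (M⁻¹ * a * M⁻¹ * dG).trace := by
    rw [← Matrix.trace_transpose]
    simp only [Matrix.transpose_mul, Matrix.transpose_transpose, hNt, hdG]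
    rw [Matrix.trace_mul_comm, ← Matrix.trace_mul_comm dG]
    simp only [Matrix.mul_assoc]
    rw [Matrix.trace_mul_comm dG]
    simp only [Matrix.mul_assoc]
    rw [Matrix.trace_mul_comm]
    simp only [Matrix.mul_assoc]
    rw [Matrix.trace_mul_comm]
    simp only [Matrix.mul_assoc]
  rw [e1, e2, e3]
  ring

/-- Jacobi's formula. -/
theorem fderiv_det {M : E m → Matrix (Fin m) (Fin m) ℝ} {y : E m}
    (hM : ∀ i j, DifferentiableAt ℝ (fun z ↦ M z i j) y) (u : E m) :
    fderiv ℝ (fun z ↦ (M z).det) y u =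
      ((M y).adjugate * Matrix.of fun i j ↦ fderiv ℝ (fun z ↦ M z i j) y u).trace := by
  simp only [Matrix.det_apply]
  have h1 := HasFDerivAt.fun_sum (u := Finset.univ) fun (σ : Equiv.Perm (Fin m)) _ ↦
    (HasFDerivAt.finsetProd (u := Finset.univ) fun i _ ↦
      (hM (σ i) i).hasFDerivAt).const_smul (Equiv.Perm.sign σ)
  refine (DFunLike.congr_fun h1.fderiv u).trans ?_
  simp only [_root_.sum_apply, _root_.smul_apply, Matrix.trace, Matrix.diag_apply]
  -- Cramer's rule: a diagonal entry of adj(M)·M' is det M with one column replaced by its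
  -- derivative, matching one term of the Leibniz rule for the determinant.
  have h3 (i : Fin m) : ((M y).adjugate * Matrix.of fun i j ↦ fderiv ℝ (fun z ↦ M z i j) y u) i i =
      ((M y).updateCol i fun k ↦ fderiv ℝ (fun z ↦ M z k i) y u).det := by
    rw [← Matrix.cramer_apply, Matrix.cramer_eq_adjugate_mulVec]
    rfl
  simp only [h3, Matrix.det_apply, Finset.smul_sum]
  rw [Finset.sum_comm]
  refine Finset.sum_congr rfl fun i _ ↦ Finset.sum_congr rfl fun σ _ ↦ ?_
  congr 1
  rw [← Finset.mul_prod_erase Finset.univ _ (Finset.mem_univ i)]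
  simp only [Matrix.updateCol_self, smul_eq_mul]
  rw [mul_comm]
  congr 1
  refine Finset.prod_congr rfl fun j hj ↦ ?_
  rw [Matrix.updateCol_ne (Finset.ne_of_mem_erase hj)]

theorem fderiv_dens {G : E m → Bil m} {y : E m} (hG : ContDiffAt ℝ ∞ G y) (hm : IsMetric (G y))
    (u : E m) : fderiv ℝ (fun z ↦ dens (G z)) y u =
      1 / 2 * dens (G y) * ((mat (G y))⁻¹ * mat (fderiv ℝ G y u)).trace := by
  have hM (i j : Fin m) : DifferentiableAt ℝ (fun z ↦ mat (G z) i j) y :=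
    (contDiffAt_mat hG i j).differentiableAt (by simp)
  have hd : DifferentiableAt ℝ (fun z ↦ (mat (G z)).det) y :=
    (contDiffAt_det (contDiffAt_mat hG)).differentiableAt (by simp)
  have h1 : mat (fderiv ℝ G y u) = Matrix.of fun i j ↦ fderiv ℝ (fun z ↦ mat (G z) i j) y u := by
    ext i j
    exact mat_fderiv (hG.differentiableAt (by simp)) u i j
  have hdet := hm.det_pos
  refine (DFunLike.congr_fun (hd.hasFDerivAt.sqrt hdet.ne').fderiv u).trans ?_
  rw [_root_.smul_apply, fderiv_det hM, ← h1, Matrix.inv_def, Ring.inverse_eq_inv', Matrix.smul_mul,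
    Matrix.trace_smul, smul_eq_mul, smul_eq_mul, dens]
  have hs := Real.sqrt_pos.2 hdet
  have hs2 := Real.mul_self_sqrt hdet.le
  field_simp
  rw [sq, hs2, mul_comm]

/-- The divergence in terms of the Lie derivative of the metric. -/
theorem sum_fderiv_dens_mul {G : E m → Bil m} {U : E m → E m} {y : E m} (hG : ContDiffAt ℝ ∞ G y)
    (hm : ∀ᶠ z in 𝓝 y, IsMetric (G z)) (hU : DifferentiableAt ℝ U y) :
    ∑ i, fderiv ℝ (fun z ↦ dens (G z) * U z i) y (basisVec i) =
      1 / 2 * dens (G y) * trC (G y) (lieC U G y) := by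
  have hmy := hm.self_of_nhds
  have hdG := IsMetric.transpose_mat_fderiv hG hm (U y)
  have hGt := hmy.mat_transpose
  have hu : IsUnit (mat (G y)).det := hmy.det_pos.ne'.isUnit
  have hUi (i : Fin m) : DifferentiableAt ℝ (fun z ↦ U z i) y := differentiableAt_euclidean.1 hU i
  have hd : DifferentiableAt ℝ (fun z ↦ dens (G z)) y :=
    (contDiffAt_dens hG hmy).differentiableAt (by simp)
  have h1 (i : Fin m) : fderiv ℝ (fun z ↦ dens (G z) * U z i) y (basisVec i) =
      dens (G y) * lmat (fderiv ℝ U y) i i + U y i * fderiv ℝ (fun z ↦ dens (G z)) y (basisVec i) := by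
    refine (DFunLike.congr_fun (hd.hasFDerivAt.mul (hUi i).hasFDerivAt).fderiv _).trans ?_
    simp only [_root_.add_apply, _root_.smul_apply, smul_eq_mul]
    congr 2
    have := (EuclideanSpace.proj (𝕜 := ℝ) i).hasFDerivAt.comp y hU.hasFDerivAt
    exact DFunLike.congr_fun this.fderiv _
  have h2 : ∑ i, U y i * fderiv ℝ (fun z ↦ dens (G z)) y (basisVec i) =
      fderiv ℝ (fun z ↦ dens (G z)) y (U y) := by
    conv_rhs => rw [← sum_smul_basisVec (U y)]
    simp
  simp only [h1]
  rw [Finset.sum_add_distrib, h2, ← Finset.mul_sum, fderiv_dens hG hmy, trC_eq_trace, mat_lieC]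
  simp only [Matrix.transpose_add, Matrix.transpose_mul, Matrix.transpose_transpose, hdG, hGt,
    Matrix.mul_add, Matrix.trace_add]
  rw [← Matrix.mul_assoc _ (mat (G y)), Matrix.nonsing_inv_mul _ hu, Matrix.one_mul,
    ← Matrix.mul_assoc, Matrix.trace_mul_comm (_ * (lmat _).transpose), ← Matrix.mul_assoc,
    Matrix.mul_nonsing_inv _ hu, Matrix.one_mul, Matrix.trace_transpose,
    show ∑ i, lmat (fderiv ℝ U y) i i = (lmat (fderiv ℝ U y)).trace from rfl]
  ring

/-- The derivative of the pullback of a field of bilinear forms by a curve of maps. -/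
theorem hasDerivAt_pull_flow {Ψ : ℝ × E m → E m} (hΨ : ContDiff ℝ ∞ Ψ) (h0 : ∀ y, Ψ (0, y) = y)
    {V : E m → E m} (hV : ∀ y, HasDerivAt (fun t ↦ Ψ (t, y)) (V y) 0) {A : E m → Bil m} {y : E m}
    (hA : ContDiffAt ℝ ∞ A y) :
    HasDerivAt (fun t ↦ pull (A (Ψ (t, y))) (fderiv ℝ (fun z ↦ Ψ (t, z)) y)) (lieC V A y) 0 := by
  have hd (q : ℝ × E m) : HasFDerivAt Ψ (fderiv ℝ Ψ q) q :=
    (hΨ.differentiable (by simp) q).hasFDerivAt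
  have hd2 (q : ℝ × E m) : HasFDerivAt (fderiv ℝ Ψ) (fderiv ℝ (fderiv ℝ Ψ) q) q :=
    ((hΨ.fderiv_right (m := ∞) (by simp)).differentiable (by simp) q).hasFDerivAt
  have hpart (t : ℝ) (z : E m) : fderiv ℝ (fun z ↦ Ψ (t, z)) z =
      (fderiv ℝ Ψ (t, z)).comp (.inr ℝ ℝ (E m)) :=
    ((hd (t, z)).comp z (hasFDerivAt_prodMk_right t z)).fderiv
  have htime (z : E m) : fderiv ℝ Ψ (0, z) (1, 0) = V z := by
    have h := ((hd (0, z)).comp (0 : ℝ) (hasFDerivAt_prodMk_left (0 : ℝ) z)).hasDerivAt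
    simpa using h.unique (hV z)
  -- DV is a mixed second derivative of Ψ at t = 0; with the symmetry of D²Ψ below, it is also the
  -- time derivative of the spatial differential.
  have hVd (v : E m) : fderiv ℝ V y v = fderiv ℝ (fderiv ℝ Ψ) (0, y) (0, v) (1, 0) := by
    have h1 := ((hd2 (0, y)).clm_apply (hasFDerivAt_const ((1 : ℝ), (0 : E m)) (0, y))).comp y
      (hasFDerivAt_prodMk_right (0 : ℝ) y)
    have h2 : ((fun q ↦ fderiv ℝ Ψ q ((1 : ℝ), (0 : E m))) ∘ fun z ↦ ((0 : ℝ), z)) = V := by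
      funext z
      exact htime z
    rw [h2] at h1
    rw [h1.fderiv]
    simp
  have hsymm (u v : ℝ × E m) : fderiv ℝ (fderiv ℝ Ψ) (0, y) u v =
      fderiv ℝ (fderiv ℝ Ψ) (0, y) v u :=
    (hΨ.contDiffAt.isSymmSndFDerivAt minSmoothness_two_le_infty) u v
  have hP (v : E m) : HasDerivAt (fun t ↦ fderiv ℝ (fun z ↦ Ψ (t, z)) y v) (fderiv ℝ V y v) 0 := by
    have h1 := (((hd2 (0, y)).clm_apply (hasFDerivAt_const ((0 : ℝ), v) (0, y))).comp (0 : ℝ)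
      (hasFDerivAt_prodMk_left (0 : ℝ) y)).hasDerivAt
    simp only [hpart]
    rw [hVd, hsymm]
    convert! h1 using 1
    simp
  have hAt : HasDerivAt (fun t ↦ A (Ψ (t, y))) (fderiv ℝ A y (V y)) 0 := by
    have h1 : HasFDerivAt A (fderiv ℝ A y) (Ψ (0, y)) := by
      rw [h0]
      exact (hA.differentiableAt (by simp)).hasFDerivAt
    exact h1.comp_hasDerivAt 0 (hV y)
  have hid : fderiv ℝ (fun z ↦ Ψ (0, z)) y = .id ℝ (E m) := by
    simp only [h0]
    exact fderiv_fun_id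
  have hdiff : DifferentiableAt ℝ
      (fun t ↦ pull (A (Ψ (t, y))) (fderiv ℝ (fun z ↦ Ψ (t, z)) y)) 0 := by
    refine (contDiffAt_pull (k := ∞) ?_ ?_).differentiableAt (by simp)
    · refine ContDiffAt.comp (g := A) (f := fun t ↦ Ψ (t, y)) (0 : ℝ) (by rwa [h0]) ?_
      exact (hΨ.comp (contDiff_id.prodMk contDiff_const)).contDiffAt
    · simp only [hpart]
      exact ((hΨ.fderiv_right (m := ∞) (by simp)).comp
        (contDiff_id.prodMk contDiff_const)).contDiffAt.clm_comp contDiffAt_const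
  -- Differentiability of the form-valued curve is already known, so its derivative is identified by
  -- testing on pairs of vectors.
  have h := hdiff.hasDerivAt
  convert! h using 1
  ext v w
  have h1 := (h.clm_apply (hasDerivAt_const (0 : ℝ) v)).clm_apply (hasDerivAt_const (0 : ℝ) w)
  have h2 := (hAt.clm_apply (hP v)).clm_apply (hP w)
  have h3 := h2.unique h1
  rw [hid, h0] at h3
  simp only [_root_.add_apply, map_zero, add_zero] at h3
  rw [lieC_apply]
  exact h3

theorem HasDerivAt.trC {G : Bil m} {F : ℝ → Bil m} {F' : Bil m} {t : ℝ} (hF : HasDerivAt F F' t) :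
    HasDerivAt (fun t ↦ trC G (F t)) (trC G F') t := by
  refine HasDerivAt.fun_sum fun i _ ↦ HasDerivAt.fun_sum fun j _ ↦ HasDerivAt.const_mul _ ?_
  have := (hF.clm_apply (hasDerivAt_const t (basisVec i))).clm_apply
    (hasDerivAt_const t (basisVec j))
  simpa [mat_apply] using this

end Identities

/-! ### Coordinate expressions on manifolds and their behaviour under change of chart. -/

section MapDerivative

variable {m n k : ℕ} {M N L : Type*}
  [TopologicalSpace M] [ChartedSpace (E m) M]
  [TopologicalSpace N] [ChartedSpace (E n) N]
  [TopologicalSpace L] [ChartedSpace (E k) L]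

/-- The extended chart around `p`. -/
noncomputable abbrev ext (m : ℕ) {M : Type*} [TopologicalSpace M] [ChartedSpace (E m) M] (p : M) :
    PartialEquiv M (E m) := extChartAt 𝓘(ℝ, E m) p

variable (m n) in
/-- The derivative of a map between manifolds, as a map between the model spaces. -/
noncomputable def mder (φ : M → N) (x : M) : E m →L[ℝ] E n := mfderiv 𝓘(ℝ, E m) 𝓘(ℝ, E n) φ x

theorem mder_comp {ψ : N → L} {φ : M → N} (x : M)
    (hψ : MDifferentiableAt 𝓘(ℝ, E n) 𝓘(ℝ, E k) ψ (φ x))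
    (hφ : MDifferentiableAt 𝓘(ℝ, E m) 𝓘(ℝ, E n) φ x) :
    mder m k (ψ ∘ φ) x = (mder n k ψ (φ x)).comp (mder m n φ x) := mfderiv_comp x hψ hφ

theorem mder_eq_fderiv (f : E m → E n) (y : E m) : mder m n f y = fderiv ℝ f y := mfderiv_eq_fderiv

theorem mder_congr {φ ψ : M → N} {x : M} (h : φ =ᶠ[𝓝 x] ψ) : mder m n φ x = mder m n ψ x :=
  h.mfderiv_eq

theorem mder_id (x : M) : mder m m (id : M → M) x = .id ℝ _ := mfderiv_id

variable (m) in
/-- The derivative of the chart around `p`. -/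
noncomputable def dchart (p x : M) : E m →L[ℝ] E m := mder m m (ext m p) x

/-- The derivative of the inverse of the chart around `p`. -/
noncomputable def dsymm (p : M) (y : E m) : E m →L[ℝ] E m := mder m m (ext m p).symm y

variable (m n) in
/-- The expression of a map in the charts around `p` and `q`. -/
noncomputable def localRep (p : M) (q : N) (φ : M → N) : E m → E n := ext n q ∘ φ ∘ (ext m p).symm

/-- The coordinate expression of a field of bilinear forms in the chart around `p`. -/
noncomputable def rep (p : M) (T : M → Bil m) (y : E m) : Bil m :=
  pull (T ((ext m p).symm y)) (dsymm p y)

/-- The pullback of a field of bilinear forms. -/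
noncomputable def pullT (φ : M → N) (T : N → Bil n) (x : M) : Bil m := pull (T (φ x)) (mder m n φ x)

theorem fieldInChart_eq (p : M) (X : M → E m) (y : E m) :
    fieldInChart p X y = dchart m p ((ext m p).symm y) (X ((ext m p).symm y)) := rfl

theorem symm_mem_source {p : M} {y : E m} (hy : y ∈ (ext m p).target) :
    (ext m p).symm y ∈ (ext m p).source := (ext m p).map_target hy

variable [IsManifold 𝓘(ℝ, E m) ∞ M] [IsManifold 𝓘(ℝ, E n) ∞ N]

theorem isManifold_one : IsManifold 𝓘(ℝ, E m) 1 M := IsManifold.of_le (n := ∞) (by simp)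

theorem contMDiffAt_ext {p x : M} (hx : x ∈ (ext m p).source) :
    ContMDiffAt 𝓘(ℝ, E m) 𝓘(ℝ, E m) ∞ (ext m p) x :=
  contMDiffAt_extChartAt' (by rwa [← extChartAt_source 𝓘(ℝ, E m)])

theorem contMDiffAt_ext_symm {p : M} {y : E m} (hy : y ∈ (ext m p).target) :
    ContMDiffAt 𝓘(ℝ, E m) 𝓘(ℝ, E m) ∞ (ext m p).symm y :=
  (contMDiffOn_extChartAt_symm p).contMDiffAt ((isOpen_extChartAt_target p).mem_nhds hy)

omit [IsManifold 𝓘(ℝ, E m) ∞ M] in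
theorem target_mem_nhds {p : M} {y : E m} (hy : y ∈ (ext m p).target) :
    (ext m p).target ∈ 𝓝 y := (isOpen_extChartAt_target p).mem_nhds hy

theorem dchart_comp_dsymm {p : M} {y : E m} (hy : y ∈ (ext m p).target) :
    (dchart m p ((ext m p).symm y)).comp (dsymm p y) = .id ℝ (E m) := by
  rw [dchart, dsymm, ← mder_comp]
  · rw [← mder_id y]
    refine mder_congr ?_
    filter_upwards [target_mem_nhds hy] with z hz
    exact (ext m p).right_inv hz
  · exact (contMDiffAt_ext (symm_mem_source hy)).mdifferentiableAt (by simp)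
  · exact (contMDiffAt_ext_symm hy).mdifferentiableAt (by simp)

theorem dsymm_comp_dchart {p : M} {y : E m} (hy : y ∈ (ext m p).target) :
    (dsymm p y).comp (dchart m p ((ext m p).symm y)) = .id ℝ (E m) := by
  have h : dsymm p y = mder m m (ext m p).symm (ext m p ((ext m p).symm y)) := by
    rw [(ext m p).right_inv hy]; rfl
  rw [dchart, h, ← mder_comp]
  · rw [← mder_id ((ext m p).symm y)]
    refine mder_congr ?_
    filter_upwards [(isOpen_extChartAt_source (I := 𝓘(ℝ, E m)) p).mem_nhds (symm_mem_source hy)]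
      with z hz
    exact (ext m p).left_inv hz
  · rw [(ext m p).right_inv hy]
    exact (contMDiffAt_ext_symm hy).mdifferentiableAt (by simp)
  · exact (contMDiffAt_ext (symm_mem_source hy)).mdifferentiableAt (by simp)

/-- The tangent space at `p` is identified with ℝᵐ through the preferred chart at `p`, so that chart
has identity differential there. Pointwise definitions made at the centre of a chart become
computable through this. -/
theorem dchart_self (p : M) : dchart m p p = .id ℝ (E m) := by
  have : IsManifold 𝓘(ℝ, E m) 1 M := isManifold_one
  exact mfderiv_extChartAt_self

theorem dsymm_self (p : M) : dsymm p (ext m p p) = .id ℝ (E m) := by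
  have h := dchart_comp_dsymm (mem_extChartAt_target (I := 𝓘(ℝ, E m)) p)
  rw [show (ext m p).symm (ext m p p) = p from (ext m p).left_inv (mem_extChartAt_source p),
    dchart_self] at h
  exact h

theorem rep_self (p : M) (T : M → Bil m) : rep p T (ext m p p) = T p := by
  rw [rep, dsymm_self, pull_id,
    show (ext m p).symm (ext m p p) = p from (ext m p).left_inv (mem_extChartAt_source p)]

theorem fieldInChart_self (p : M) (X : M → E m) : fieldInChart p X (ext m p p) = X p := by
  rw [fieldInChart_eq,
    show (ext m p).symm (ext m p p) = p from (ext m p).left_inv (mem_extChartAt_source p), dchart_self]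
  rfl

section Local

variable {φ : M → N} {p : M} {q : N} {y : E m}

theorem contDiffAt_localRep (hy : y ∈ (ext m p).target)
    (hφ : ContMDiffAt 𝓘(ℝ, E m) 𝓘(ℝ, E n) ∞ φ ((ext m p).symm y))
    (hq : φ ((ext m p).symm y) ∈ (ext n q).source) :
    ContDiffAt ℝ ∞ (localRep m n p q φ) y :=
  contMDiffAt_iff_contDiffAt.1 ((contMDiffAt_ext hq).comp y (hφ.comp y (contMDiffAt_ext_symm hy)))

/-- Chain rule for the two factorizations of the same map near `y`: inverse chart after the local
representative, and φ after the inverse chart. -/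
theorem dsymm_comp_fderiv_localRep (hy : y ∈ (ext m p).target)
    (hφ : ContMDiffAt 𝓘(ℝ, E m) 𝓘(ℝ, E n) ∞ φ ((ext m p).symm y))
    (hq : φ ((ext m p).symm y) ∈ (ext n q).source) :
    (dsymm q (localRep m n p q φ y)).comp (fderiv ℝ (localRep m n p q φ) y) =
      (mder m n φ ((ext m p).symm y)).comp (dsymm p y) := by
  have h1 := hφ.comp y (contMDiffAt_ext_symm hy)
  have hq' : localRep m n p q φ y ∈ (ext n q).target := (ext n q).map_source hq
  rw [← mder_eq_fderiv, dsymm, dsymm, ← mder_comp, ← mder_comp]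
  · refine mder_congr ?_
    filter_upwards [h1.continuousAt.preimage_mem_nhds ((isOpen_extChartAt_source
      (I := 𝓘(ℝ, E n)) q).mem_nhds hq)] with z hz
    exact (ext n q).left_inv hz
  · exact hφ.mdifferentiableAt (by simp)
  · exact (contMDiffAt_ext_symm hy).mdifferentiableAt (by simp)
  · exact (contMDiffAt_ext_symm hq').mdifferentiableAt (by simp)
  · exact ((contMDiffAt_ext hq).comp y h1).mdifferentiableAt (by simp)

theorem fderiv_localRep (hy : y ∈ (ext m p).target)
    (hφ : ContMDiffAt 𝓘(ℝ, E m) 𝓘(ℝ, E n) ∞ φ ((ext m p).symm y))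
    (hq : φ ((ext m p).symm y) ∈ (ext n q).source) :
    fderiv ℝ (localRep m n p q φ) y =
      (dchart n q (φ ((ext m p).symm y))).comp ((mder m n φ ((ext m p).symm y)).comp (dsymm p y)) := by
  have hq' : localRep m n p q φ y ∈ (ext n q).target := (ext n q).map_source hq
  have h := dchart_comp_dsymm hq'
  have h2 : (ext n q).symm (localRep m n p q φ y) = φ ((ext m p).symm y) := (ext n q).left_inv hq
  rw [h2] at h
  rw [← dsymm_comp_fderiv_localRep hy hφ hq, ← ContinuousLinearMap.comp_assoc, h]
  rfl

theorem rep_pullT (hy : y ∈ (ext m p).target)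
    (hφ : ContMDiffAt 𝓘(ℝ, E m) 𝓘(ℝ, E n) ∞ φ ((ext m p).symm y))
    (hq : φ ((ext m p).symm y) ∈ (ext n q).source) (T : N → Bil n) :
    rep p (pullT φ T) y = pull (rep q T (localRep m n p q φ y)) (fderiv ℝ (localRep m n p q φ) y) := by
  rw [rep, rep, pullT, ← pull_comp, ← pull_comp, dsymm_comp_fderiv_localRep hy hφ hq,
    show (ext n q).symm (localRep m n p q φ y) = φ ((ext m p).symm y) from (ext n q).left_inv hq]

end Local

omit [IsManifold 𝓘(ℝ, E m) ∞ M] in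
theorem pullT_id (T : M → Bil m) : pullT id T = T := by
  funext x
  rw [pullT, mder_id]
  rfl

variable (m) in
/-- The transition map from the chart around `p` to the chart around `q`. -/
noncomputable abbrev trans (p q : M) : E m → E m := localRep m m p q id

section Transition

variable {p q : M} {y : E m}

theorem contDiffAt_trans (hy : y ∈ (ext m p).target) (hq : (ext m p).symm y ∈ (ext m q).source) :
    ContDiffAt ℝ ∞ (trans m p q) y := contDiffAt_localRep hy contMDiffAt_id hq

theorem fderiv_trans (hy : y ∈ (ext m p).target) (hq : (ext m p).symm y ∈ (ext m q).source) :
    fderiv ℝ (trans m p q) y = (dchart m q ((ext m p).symm y)).comp (dsymm p y) := by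
  rw [fderiv_localRep hy contMDiffAt_id hq, mder_id]
  rfl

theorem rep_trans (hy : y ∈ (ext m p).target) (hq : (ext m p).symm y ∈ (ext m q).source)
    (T : M → Bil m) : rep p T y = pull (rep q T (trans m p q y)) (fderiv ℝ (trans m p q) y) := by
  conv_lhs => rw [← pullT_id T]
  exact rep_pullT hy contMDiffAt_id hq T

omit [IsManifold 𝓘(ℝ, E m) ∞ M] in
theorem symm_trans (hq : (ext m p).symm y ∈ (ext m q).source) :
    (ext m q).symm (trans m p q y) = (ext m p).symm y := (ext m q).left_inv hq

omit [IsManifold 𝓘(ℝ, E m) ∞ M] in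
theorem trans_mem_target (hq : (ext m p).symm y ∈ (ext m q).source) :
    trans m p q y ∈ (ext m q).target := (ext m q).map_source hq

theorem fieldInChart_trans (hy : y ∈ (ext m p).target)
    (hq : (ext m p).symm y ∈ (ext m q).source) (X : M → E m) :
    fderiv ℝ (trans m p q) y (fieldInChart p X y) = fieldInChart q X (trans m p q y) := by
  rw [fderiv_trans hy hq, fieldInChart_eq, fieldInChart_eq, symm_trans hq]
  have := DFunLike.congr_fun (dsymm_comp_dchart hy) (X ((ext m p).symm y))
  rw [ContinuousLinearMap.comp_apply] at this ⊢
  rw [this]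
  rfl

omit [IsManifold 𝓘(ℝ, E m) ∞ M] in
theorem eventually_mem_transition (hy : y ∈ (ext m p).target)
    (hq : (ext m p).symm y ∈ (ext m q).source) :
    ∀ᶠ z in 𝓝 y, z ∈ (ext m p).target ∧ (ext m p).symm z ∈ (ext m q).source :=
  Filter.Eventually.and (target_mem_nhds hy) (((continuousOn_extChartAt_symm p).continuousAt
    (target_mem_nhds hy)).preimage_mem_nhds ((isOpen_extChartAt_source (I := 𝓘(ℝ, E m)) q).mem_nhds hq))

omit [IsManifold 𝓘(ℝ, E m) ∞ M] in
theorem symm_mem_source_self (p : M) (y : E m) :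
    (ext m p).symm y ∈ (ext m ((ext m p).symm y)).source := mem_extChartAt_source _

end Transition

/-- Smooth fields of bilinear forms. -/
def SmoothT (T : M → Bil m) : Prop := ∀ p, ∀ y ∈ (ext m p).target, ContDiffAt ℝ ∞ (rep p T) y

/-- Smooth vector fields, in terms of coordinate expressions. -/
def SmoothF (X : M → E m) : Prop := ∀ p, ∀ y ∈ (ext m p).target, ContDiffAt ℝ ∞ (fieldInChart p X) y

/-- A point of the chart at `p` is the centre of its own preferred chart; the hypothesis applies
there and is transported by the transition map. -/
theorem smoothT_of_center {T : M → Bil m} (h : ∀ p, ContDiffAt ℝ ∞ (rep p T) (ext m p p)) :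
    SmoothT T := by
  intro p y hy
  have hq := symm_mem_source_self p y
  set q := (ext m p).symm y with hqdef
  have h1 : trans m p q y = ext m q q := rfl
  have h2 := h q
  rw [← h1] at h2
  refine (contDiffAt_pull (h2.comp y (contDiffAt_trans hy hq))
    ((contDiffAt_trans hy hq).fderiv_right (m := ∞) (by simp))).congr_of_eventuallyEq ?_
  filter_upwards [eventually_mem_transition hy hq] with z hz
  exact rep_trans hz.1 hz.2 T

theorem smoothF_of_center {X : M → E m} (h : ∀ p, ContDiffAt ℝ ∞ (fieldInChart p X) (ext m p p)) :
    SmoothF X := by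
  intro p y hy
  have hq := symm_mem_source_self p y
  set q := (ext m p).symm y with hqdef
  have h1 : trans m p q y = ext m q q := rfl
  have h2 := h q
  rw [← h1] at h2
  have hp : (ext m q).symm (trans m p q y) ∈ (ext m p).source := by
    rw [symm_trans hq]
    exact symm_mem_source hy
  -- Vectors are pushed forward, not pulled back, so returning to the chart at `p` needs the
  -- differential of the inverse transition.
  have h3 := contDiffAt_trans (trans_mem_target hq) hp
  have h4 := (h3.fderiv_right (m := ∞) (by simp)).clm_apply h2
  refine (h4.comp y (contDiffAt_trans hy hq)).congr_of_eventuallyEq ?_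
  filter_upwards [eventually_mem_transition hy hq] with z hz
  have hp' : (ext m q).symm (trans m p q z) ∈ (ext m p).source := by
    rw [symm_trans hz.2]
    exact symm_mem_source hz.1
  have hz3 : trans m q p (trans m p q z) = z := by
    have := symm_trans hz.2
    change ext m p ((ext m q).symm (trans m p q z)) = z
    rw [this]
    exact (ext m p).right_inv hz.1
  simp only [Function.comp_apply]
  rw [fieldInChart_trans (trans_mem_target hz.2) hp', hz3]

theorem SmoothF.of_section (X : SmoothField m M) : SmoothF (fun x ↦ X x : M → E m) :=
  smoothF_of_center fun p ↦ contDiffAt_fieldInChart X p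

/-- A Riemannian metric as a field of bilinear forms. -/
noncomputable def metricT (g : Metric m M) : M → Bil m := fun x ↦ g.inner x

theorem isMetric_metricT (g : Metric m M) (x : M) : IsMetric (metricT g x) where
  symm := g.symm x
  pos := g.pos x

theorem isMetric_rep (g : Metric m M) {p : M} {y : E m} (hy : y ∈ (ext m p).target) :
    IsMetric (rep p (metricT g) y) :=
  (isMetric_metricT g _).pull (dchart_comp_dsymm hy)

theorem smoothT_metricT (g : Metric m M) : SmoothT (metricT g) := by
  refine smoothT_of_center fun p ↦ ?_
  -- In finite dimensions an operator-valued map is smooth once its values on basis vectors are;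
  -- used twice, this passes from scalar coefficients to bilinear forms.
  have hclm {F : Type} [NormedAddCommGroup F] [NormedSpace ℝ F] {f : E m → E m →L[ℝ] F} {y : E m}
      (h : ∀ v, ContDiffAt ℝ ∞ (fun z ↦ f z v) y) : ContDiffAt ℝ ∞ f y := by
    have h1 (z : E m) : f z = ∑ i, (EuclideanSpace.proj (𝕜 := ℝ) i).smulRight (f z (basisVec i)) := by
      ext v
      conv_lhs => rw [← sum_smul_basisVec v]
      simp
    rw [funext h1]
    refine ContDiffAt.sum fun i _ ↦ ?_
    exact (ContinuousLinearMap.smulRightL ℝ (E m) F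
      (EuclideanSpace.proj (𝕜 := ℝ) i)).contDiff.contDiffAt.comp y (h (basisVec i))
  exact hclm fun v ↦ hclm fun w ↦ contDiffAt_metricInChart g p v w

theorem SmoothT.pullT {T : N → Bil n} (hT : SmoothT T) {φ : M → N}
    (hφ : ContMDiff 𝓘(ℝ, E m) 𝓘(ℝ, E n) ∞ φ) : SmoothT (m := m) (pullT φ T) := by
  refine smoothT_of_center fun p ↦ ?_
  have hy := mem_extChartAt_target (I := 𝓘(ℝ, E m)) p
  set y : E m := ext m p p
  have hq : φ ((ext m p).symm y) ∈ (ext n (φ ((ext m p).symm y))).source :=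
    mem_extChartAt_source _
  set q := φ ((ext m p).symm y)
  have h1 := contDiffAt_localRep hy hφ.contMDiffAt hq
  refine (contDiffAt_pull ((hT q _ ((ext n q).map_source hq)).comp y h1)
    (h1.fderiv_right (m := ∞) (by simp))).congr_of_eventuallyEq ?_
  have hc : ContinuousAt (φ ∘ (ext m p).symm) y :=
    (hφ.contMDiffAt.comp y (contMDiffAt_ext_symm hy)).continuousAt
  filter_upwards [target_mem_nhds hy, hc.preimage_mem_nhds
    ((isOpen_extChartAt_source (I := 𝓘(ℝ, E n)) q).mem_nhds hq)] with z hz hz'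
  exact rep_pullT hz hφ.contMDiffAt hz' T

/-- The Lie derivative of a field of bilinear forms. -/
noncomputable def lieT (X : M → E m) (T : M → Bil m) (x : M) : Bil m :=
  lieC (fieldInChart x X) (rep x T) (ext m x x)

/-- Smoothness of T lets evaluation on fixed vectors commute with differentiation of the form-valued
coordinate expression. -/
theorem lieDeriv_eq {X : M → E m} {T : M → Bil m} (hT : SmoothT T) :
    lieDeriv X (fun x v w ↦ T x v w) = fun (x : M) (v w : E m) ↦ lieT X T x v w := by
  funext x (v : E m) (w : E m)
  have h := ((hT x _ (mem_extChartAt_target x)).differentiableAt (by simp))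
  have hd (u : E m) : dchart m x x u = u := DFunLike.congr_fun (dchart_self x) u
  change fderiv ℝ (fun y ↦ rep x T y (dchart m x x v) (dchart m x x w)) (ext m x x)
      (fieldInChart x X (ext m x x)) +
    rep x T (ext m x x) (fderiv ℝ (fieldInChart x X) (ext m x x) (dchart m x x v)) (dchart m x x w) +
    rep x T (ext m x x) (dchart m x x v) (fderiv ℝ (fieldInChart x X) (ext m x x) (dchart m x x w)) =
    lieC (fieldInChart x X) (rep x T) (ext m x x) v w
  rw [hd, hd, lieC_apply, fderiv_apply_apply h]

/-- `lieT` uses at each point the chart centred there; `lieC_pull` along the transition map shows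
that any chart gives the same tensor. -/
theorem rep_lieT {X : M → E m} {T : M → Bil m} (hX : SmoothF X) (hT : SmoothT T) {p : M} {y : E m}
    (hy : y ∈ (ext m p).target) : rep p (lieT X T) y = lieC (fieldInChart p X) (rep p T) y := by
  have hq := symm_mem_source_self p y
  set q := (ext m p).symm y with hqdef
  have h1 : trans m p q y = ext m q q := rfl
  have h2 : dsymm p y = fderiv ℝ (trans m p q) y := by
    rw [fderiv_trans hy hq, ← hqdef, dchart_self]
    rfl
  have hev := eventually_mem_transition hy hq
  have h3 : rep p T =ᶠ[𝓝 y] fun z ↦ pull (rep q T (trans m p q z)) (fderiv ℝ (trans m p q) z) := by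
    filter_upwards [hev] with z hz
    exact rep_trans hz.1 hz.2 T
  rw [rep, ← hqdef, lieT, ← h1, h2, lieC_congr (Filter.EventuallyEq.refl _ _) h3, ← lieC_pull
    (contDiffAt_trans hy hq) ((hT q _ (trans_mem_target hq)).differentiableAt (by simp))
    ((hX q _ (trans_mem_target hq)).differentiableAt (by simp))
    ((hX p y hy).differentiableAt (by simp))]
  filter_upwards [hev] with z hz
  exact fieldInChart_trans hz.1 hz.2 X

theorem SmoothT.lieT {X : M → E m} {T : M → Bil m} (hX : SmoothF X) (hT : SmoothT T) :
    SmoothT (lieT X T) := by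
  intro p y hy
  refine (contDiffAt_lieC (hX p y hy) (hT p y hy)).congr_of_eventuallyEq ?_
  filter_upwards [target_mem_nhds hy] with z hz
  exact rep_lieT hX hT hz

theorem trC_rep (g : Metric m M) (T : M → Bil m) {p : M} {y : E m} (hy : y ∈ (ext m p).target) :
    trC (rep p (metricT g) y) (rep p T y) =
      trC (metricT g ((ext m p).symm y)) (T ((ext m p).symm y)) :=
  trC_pull _ _ (dsymm_comp_dchart hy)

theorem innerC_rep (g : Metric m M) (T T' : M → Bil m) {p : M} {y : E m}
    (hy : y ∈ (ext m p).target) :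
    innerC (rep p (metricT g) y) (rep p T y) (rep p T' y) =
      innerC (metricT g ((ext m p).symm y)) (T ((ext m p).symm y)) (T' ((ext m p).symm y)) :=
  innerC_pull _ _ _ (dsymm_comp_dchart hy)

/-- The trace of a `(0,2)` tensor with respect to a metric. -/
noncomputable def trT (g : Metric m M) (T : M → Bil m) (x : M) : ℝ := trC (metricT g x) (T x)

theorem volDensity_eq (g : Metric m M) (p : M) (y : E m) :
    volDensity g p y = dens (rep p (metricT g) y) := rfl

theorem normSqDeriv_eq (g : Metric m M) (h : Metric n N) (φ : M → N) :
    normSqDeriv g h φ = trT g (pullT φ (metricT h)) := rfl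

theorem tensorInner_eq (g : Metric m M) (S T : M → Bil m) (x : M) :
    tensorInner g (fun x v w ↦ S x v w) (fun x v w ↦ T x v w) x =
      innerC (metricT g x) (S x) (T x) := rfl

end MapDerivative

/-! ### Derivatives along fields, brackets, and divergence as a trace. -/

section Derivations

variable {m n : ℕ} {M N : Type*}
  [TopologicalSpace M] [ChartedSpace (E m) M] [IsManifold 𝓘(ℝ, E m) ∞ M]
  [TopologicalSpace N] [ChartedSpace (E n) N] [IsManifold 𝓘(ℝ, E n) ∞ N]

variable (m) in
/-- Smooth functions. -/
abbrev SmoothS (f : M → ℝ) : Prop := ContMDiff 𝓘(ℝ, E m) 𝓘(ℝ, ℝ) ∞ f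

theorem SmoothS.contDiffAt {f : M → ℝ} (hf : SmoothS m f) {p : M} {y : E m}
    (hy : y ∈ (ext m p).target) : ContDiffAt ℝ ∞ (fun z ↦ f ((ext m p).symm z)) y :=
  contMDiffAt_iff_contDiffAt.1 (hf.contMDiffAt.comp y (contMDiffAt_ext_symm hy))

theorem contMDiffAt_of_chart {f : M → ℝ} {p x : M} (hx : x ∈ (ext m p).source)
    (h : ContDiffAt ℝ ∞ (fun z ↦ f ((ext m p).symm z)) (ext m p x)) :
    ContMDiffAt 𝓘(ℝ, E m) 𝓘(ℝ, ℝ) ∞ f x := by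
  have h1 := ContMDiffAt.comp x (contMDiffAt_iff_contDiffAt.2 h) (contMDiffAt_ext hx)
  refine h1.congr_of_eventuallyEq ?_
  filter_upwards [(isOpen_extChartAt_source (I := 𝓘(ℝ, E m)) p).mem_nhds hx] with z hz
  simp only [Function.comp_apply]
  rw [(ext m p).left_inv hz]

theorem smoothS_of_chart {f : M → ℝ}
    (h : ∀ p : M, ContDiffAt ℝ ∞ (fun z ↦ f ((ext m p).symm z)) (ext m p p)) : SmoothS m f :=
  fun p ↦ contMDiffAt_of_chart (mem_extChartAt_source p) (h p)

/-- The derivative of a function along a vector field. -/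
noncomputable def der (X : M → E m) (f : M → ℝ) (x : M) : ℝ :=
  fderiv ℝ (fun z ↦ f ((ext m x).symm z)) (ext m x x) (X x)

theorem der_symm {f : M → ℝ} (hf : SmoothS m f) (X : M → E m) {p : M} {y : E m}
    (hy : y ∈ (ext m p).target) : der X f ((ext m p).symm y) =
      fderiv ℝ (fun z ↦ f ((ext m p).symm z)) y (fieldInChart p X y) := by
  have hq := symm_mem_source_self p y
  set q := (ext m p).symm y with hqdef
  have h1 : trans m p q y = ext m q q := rfl
  have h2 : (fun z ↦ f ((ext m p).symm z)) =ᶠ[𝓝 y]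
      (fun z ↦ f ((ext m q).symm z)) ∘ trans m p q := by
    filter_upwards [eventually_mem_transition hy hq] with z hz
    simp only [Function.comp_apply]
    rw [symm_trans hz.2]
  have hd := ((hf.contDiffAt (trans_mem_target hq)).differentiableAt (by simp)).hasFDerivAt.comp y
    ((contDiffAt_trans hy hq).differentiableAt (by simp)).hasFDerivAt
  rw [h2.fderiv_eq, hd.fderiv, ContinuousLinearMap.comp_apply, fieldInChart_trans hy hq, h1, der,
    fieldInChart_self]

theorem SmoothS.der {f : M → ℝ} (hf : SmoothS m f) {X : M → E m} (hX : SmoothF X) :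
    SmoothS m (der X f) := by
  refine smoothS_of_chart fun p ↦ ?_
  have hy := mem_extChartAt_target (I := 𝓘(ℝ, E m)) p
  refine (((hf.contDiffAt hy).fderiv_right (m := ∞) (by simp)).clm_apply
    (hX p _ hy)).congr_of_eventuallyEq ?_
  filter_upwards [target_mem_nhds hy] with z hz
  exact der_symm hf X hz

theorem der_mul {f h : M → ℝ} (hf : SmoothS m f) (hh : SmoothS m h) (X : M → E m) (x : M) :
    der X (fun x ↦ f x * h x) x = f x * der X h x + h x * der X f x := by
  have hy := mem_extChartAt_target (I := 𝓘(ℝ, E m)) x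
  have h1 := ((hf.contDiffAt hy).differentiableAt (by simp)).hasFDerivAt.mul
    ((hh.contDiffAt hy).differentiableAt (by simp)).hasFDerivAt
  have h2 : (ext m x).symm (ext m x x) = x := (ext m x).left_inv (mem_extChartAt_source x)
  refine (DFunLike.congr_fun h1.fderiv _).trans ?_
  rw [_root_.add_apply, _root_.smul_apply, _root_.smul_apply, h2]
  rfl

theorem der_sum {ι : Type*} (s : Finset ι) {f : ι → M → ℝ} (hf : ∀ i ∈ s, SmoothS m (f i))
    (X : M → E m) (x : M) : der X (fun x ↦ ∑ i ∈ s, f i x) x = ∑ i ∈ s, der X (f i) x := by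
  have hy := mem_extChartAt_target (I := 𝓘(ℝ, E m)) x
  have h1 := HasFDerivAt.fun_sum (u := s) fun i hi ↦
    (((hf i hi).contDiffAt hy).differentiableAt (by simp)).hasFDerivAt
  refine (DFunLike.congr_fun h1.fderiv _).trans ?_
  rw [_root_.sum_apply]
  rfl

omit [IsManifold 𝓘(ℝ, E m) ∞ M] in
theorem der_congr {f h : M → ℝ} {x : M} (hfh : f =ᶠ[𝓝 x] h) (X : M → E m) :
    der X f x = der X h x := by
  have h2 : (ext m x).symm (ext m x x) = x := (ext m x).left_inv (mem_extChartAt_source x)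
  have hc : Filter.Tendsto (ext m x).symm (𝓝 (ext m x x)) (𝓝 x) := by
    have := (continuousAt_extChartAt_symm (I := 𝓘(ℝ, E m)) x).tendsto
    rwa [h2] at this
  have h3 : (fun z ↦ f ((ext m x).symm z)) =ᶠ[𝓝 (ext m x x)] fun z ↦ h ((ext m x).symm z) :=
    hc.eventually hfh
  rw [der, der, h3.fderiv_eq]

/-- The Lie bracket of vector fields. -/
noncomputable def bracket (X Y : M → E m) (x : M) : E m :=
  VectorField.lieBracket ℝ (fieldInChart x X) (fieldInChart x Y) (ext m x x)

theorem fieldInChart_bracket {X Y : M → E m} (hX : SmoothF X) (hY : SmoothF Y) {p : M} {y : E m}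
    (hy : y ∈ (ext m p).target) : fieldInChart p (bracket X Y) y =
      VectorField.lieBracket ℝ (fieldInChart p X) (fieldInChart p Y) y := by
  have hq := symm_mem_source_self p y
  set q := (ext m p).symm y with hqdef
  have h1 : trans m p q y = ext m q q := rfl
  have hev := eventually_mem_transition hy hq
  have hD (Z : M → E m) (hZ : SmoothF Z) (p : M) (y : E m) (hy : y ∈ (ext m p).target) :=
    (hZ p y hy).differentiableAt (by simp)
  have h2 := lieBracket_rel (contDiffAt_trans hy hq) (hD X hX q _ (trans_mem_target hq))
    (hD X hX p y hy) (hD Y hY q _ (trans_mem_target hq)) (hD Y hY p y hy)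
    (hev.mono fun z hz ↦ fieldInChart_trans hz.1 hz.2 X)
    (hev.mono fun z hz ↦ fieldInChart_trans hz.1 hz.2 Y)
  have h3 : (dsymm p y).comp (dchart m p q) = .id ℝ (E m) := dsymm_comp_dchart hy
  have h4 : (dchart m p q).comp (dsymm p y) = .id ℝ (E m) := dchart_comp_dsymm hy
  have h5 : fderiv ℝ (trans m p q) y = dsymm p y := by
    rw [fderiv_trans hy hq, ← hqdef, dchart_self]
    rfl
  rw [fieldInChart_eq, ← hqdef, bracket, ← h1, ← h2, h5]
  exact DFunLike.congr_fun h4 _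

theorem contDiffAt_lieBracket {U W : E m → E m} {y : E m} (hU : ContDiffAt ℝ ∞ U y)
    (hW : ContDiffAt ℝ ∞ W y) : ContDiffAt ℝ ∞ (VectorField.lieBracket ℝ U W) y :=
  ((hW.fderiv_right (m := ∞) (by simp)).clm_apply hU).sub
    ((hU.fderiv_right (m := ∞) (by simp)).clm_apply hW)

theorem SmoothF.bracket {X Y : M → E m} (hX : SmoothF X) (hY : SmoothF Y) :
    SmoothF (bracket X Y) := by
  intro p y hy
  refine (contDiffAt_lieBracket (hX p y hy) (hY p y hy)).congr_of_eventuallyEq ?_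
  filter_upwards [target_mem_nhds hy] with z hz
  exact fieldInChart_bracket hX hY hz

/-- The second-order parts of XYf and YXf agree by symmetry of the Hessian in coordinates, leaving
the first-order operator of the bracket. -/
theorem der_bracket {X Y : M → E m} (hX : SmoothF X) (hY : SmoothF Y) {f : M → ℝ}
    (hf : SmoothS m f) (x : M) : der (bracket X Y) f x = der X (der Y f) x - der Y (der X f) x := by
  have hy := mem_extChartAt_target (I := 𝓘(ℝ, E m)) x
  have hF := hf.contDiffAt hy
  have key (Z W : M → E m) (hW : SmoothF W) : der Z (der W f) x =
      fderiv ℝ (fderiv ℝ fun z ↦ f ((ext m x).symm z)) (ext m x x) (Z x) (W x) +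
      fderiv ℝ (fun z ↦ f ((ext m x).symm z)) (ext m x x)
        (fderiv ℝ (fieldInChart x W) (ext m x x) (Z x)) := by
    have h1 : (fun z ↦ der W f ((ext m x).symm z)) =ᶠ[𝓝 (ext m x x)]
        fun z ↦ fderiv ℝ (fun z ↦ f ((ext m x).symm z)) z (fieldInChart x W z) := by
      filter_upwards [target_mem_nhds hy] with z hz
      exact der_symm hf W hz
    have h2 := ((hF.fderiv_right (m := ∞) (by simp)).differentiableAt (by simp)).hasFDerivAt.clm_apply
      ((hW x _ hy).differentiableAt (by simp)).hasFDerivAt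
    rw [der, h1.fderiv_eq, h2.fderiv]
    simp only [_root_.add_apply, ContinuousLinearMap.comp_apply, ContinuousLinearMap.flip_apply,
      fieldInChart_self]
    rw [add_comm]
  rw [key X Y hY, key Y X hX, (hF.isSymmSndFDerivAt minSmoothness_two_le_infty) (X x) (Y x), der,
    bracket, VectorField.lieBracket, map_sub, fieldInChart_self, fieldInChart_self]
  ring

omit [IsManifold 𝓘(ℝ, E m) ∞ M] in
theorem fieldInChart_add (p : M) (X Y : M → E m) :
    fieldInChart p (X + Y) = fieldInChart p X + fieldInChart p Y := by
  funext y
  exact (dchart m p _).map_add _ _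

omit [IsManifold 𝓘(ℝ, E m) ∞ M] in
theorem fieldInChart_sub (p : M) (X Y : M → E m) :
    fieldInChart p (X - Y) = fieldInChart p X - fieldInChart p Y := by
  funext y
  exact (dchart m p _).map_sub _ _

omit [IsManifold 𝓘(ℝ, E m) ∞ M] in
theorem fieldInChart_smul (p : M) (f : M → ℝ) (X : M → E m) (y : E m) :
    fieldInChart p (fun x ↦ f x • X x) y = f ((ext m p).symm y) • fieldInChart p X y :=
  (dchart m p _).map_smul _ _

omit [IsManifold 𝓘(ℝ, E m) ∞ M] in
theorem SmoothF.add {X Y : M → E m} (hX : SmoothF X) (hY : SmoothF Y) : SmoothF (X + Y) := by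
  intro p y hy
  rw [fieldInChart_add]
  exact (hX p y hy).add (hY p y hy)

omit [IsManifold 𝓘(ℝ, E m) ∞ M] in
theorem SmoothF.sub {X Y : M → E m} (hX : SmoothF X) (hY : SmoothF Y) : SmoothF (X - Y) := by
  intro p y hy
  rw [fieldInChart_sub]
  exact (hX p y hy).sub (hY p y hy)

theorem SmoothF.smul {X : M → E m} (hX : SmoothF X) {f : M → ℝ} (hf : SmoothS m f) :
    SmoothF (fun x ↦ f x • X x) := by
  intro p y hy
  rw [funext (fieldInChart_smul p f X)]
  exact (hf.contDiffAt hy).smul (hX p y hy)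

omit [IsManifold 𝓘(ℝ, E m) ∞ M] in
theorem smoothF_zero : SmoothF (0 : M → E m) := by
  intro p y _
  have : fieldInChart p (0 : M → E m) = 0 := by
    funext y
    exact (dchart m p _).map_zero
  rw [this]
  exact contDiffAt_const

omit [IsManifold 𝓘(ℝ, E m) ∞ M] in
theorem lieT_add {X Y : M → E m} (hX : SmoothF X) (hY : SmoothF Y) (T : M → Bil m) (x : M) :
    lieT (X + Y) T x = lieT X T x + lieT Y T x := by
  have hy := mem_extChartAt_target (I := 𝓘(ℝ, E m)) x
  rw [lieT, fieldInChart_add, lieC_add _ ((hX x _ hy).differentiableAt (by simp))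
    ((hY x _ hy).differentiableAt (by simp))]
  rfl

omit [IsManifold 𝓘(ℝ, E m) ∞ M] in
theorem lieT_smul (c : ℝ) (X : M → E m) (T : M → Bil m) (x : M) :
    lieT (c • X) T x = c • lieT X T x := by
  have : fieldInChart x (c • X) = c • fieldInChart x X := by
    funext y
    exact (dchart m x _).map_smul _ _
  rw [lieT, this, lieC_smul]
  rfl

omit [IsManifold 𝓘(ℝ, E m) ∞ M] in
theorem fieldInChart_congr {X Y : M → E m} {x : M} (h : X =ᶠ[𝓝 x] Y) :
    fieldInChart x X =ᶠ[𝓝 (ext m x x)] fieldInChart x Y := by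
  have h2 : (ext m x).symm (ext m x x) = x := (ext m x).left_inv (mem_extChartAt_source x)
  have hc : Filter.Tendsto (ext m x).symm (𝓝 (ext m x x)) (𝓝 x) := by
    have := (continuousAt_extChartAt_symm (I := 𝓘(ℝ, E m)) x).tendsto
    rwa [h2] at this
  filter_upwards [hc.eventually h] with z hz
  rw [fieldInChart_eq, fieldInChart_eq, hz]

omit [IsManifold 𝓘(ℝ, E m) ∞ M] in
theorem lieT_congr {X Y : M → E m} {x : M} (h : X =ᶠ[𝓝 x] Y) (T : M → Bil m) :
    lieT X T x = lieT Y T x :=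
  lieC_congr (fieldInChart_congr h) (Filter.EventuallyEq.refl _ _)

omit [IsManifold 𝓘(ℝ, E m) ∞ M] in
theorem lieT_zero (T : M → Bil m) (x : M) : lieT 0 T x = 0 := by
  simpa using lieT_smul 0 (0 : M → E m) T x

theorem lieT_bracket {X Y : M → E m} (hX : SmoothF X) (hY : SmoothF Y) {T : M → Bil m}
    (hT : SmoothT T) (x : M) : lieT X (lieT Y T) x - lieT Y (lieT X T) x = lieT (bracket X Y) T x := by
  have hy := mem_extChartAt_target (I := 𝓘(ℝ, E m)) x
  have key {Z : M → E m} (hZ : SmoothF Z) :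
      rep x (lieT Z T) =ᶠ[𝓝 (ext m x x)] lieC (fieldInChart x Z) (rep x T) := by
    filter_upwards [target_mem_nhds hy] with z hz
    exact rep_lieT hZ hT hz
  have hb : fieldInChart x (bracket X Y) =ᶠ[𝓝 (ext m x x)]
      VectorField.lieBracket ℝ (fieldInChart x X) (fieldInChart x Y) := by
    filter_upwards [target_mem_nhds hy] with z hz
    exact fieldInChart_bracket hX hY hz
  rw [lieT, lieT, lieT, lieC_congr (Filter.EventuallyEq.refl _ _) (key hX),
    lieC_congr (Filter.EventuallyEq.refl _ _) (key hY),
    lieC_congr hb (Filter.EventuallyEq.refl _ _),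
    lieC_commutator (hY x _ hy) (hX x _ hy) (hT x _ hy)]

theorem trT_symm (g : Metric m M) (T : M → Bil m) {p : M} {y : E m} (hy : y ∈ (ext m p).target) :
    trT g T ((ext m p).symm y) = trC (rep p (metricT g) y) (rep p T y) := (trC_rep g T hy).symm

theorem SmoothT.trT (g : Metric m M) {T : M → Bil m} (hT : SmoothT T) : SmoothS m (trT g T) := by
  refine smoothS_of_chart fun p ↦ ?_
  have hy := mem_extChartAt_target (I := 𝓘(ℝ, E m)) p
  refine (contDiffAt_trC (smoothT_metricT g p _ hy) (hT p _ hy)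
    (isMetric_rep g hy)).congr_of_eventuallyEq ?_
  filter_upwards [target_mem_nhds hy] with z hz
  exact trT_symm g T hz

theorem SmoothT.innerC (g : Metric m M) {T T' : M → Bil m} (hT : SmoothT T) (hT' : SmoothT T') :
    SmoothS m (fun x ↦ innerC (metricT g x) (T x) (T' x)) := by
  refine smoothS_of_chart fun p ↦ ?_
  have hy := mem_extChartAt_target (I := 𝓘(ℝ, E m)) p
  refine (contDiffAt_innerC (smoothT_metricT g p _ hy) (hT p _ hy) (hT' p _ hy)
    (isMetric_rep g hy)).congr_of_eventuallyEq ?_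
  filter_upwards [target_mem_nhds hy] with z hz
  exact (innerC_rep g T T' hz).symm

theorem eventually_isMetric_rep (g : Metric m M) {p : M} {y : E m} (hy : y ∈ (ext m p).target) :
    ∀ᶠ z in 𝓝 y, IsMetric (rep p (metricT g) z) := by
  filter_upwards [target_mem_nhds hy] with z hz
  exact isMetric_rep g hz

/-- This replaces a pairing with L_X g by a trace, up to a derivative along X that integrates to
zero when X is divergence free with compact support. -/
theorem innerC_lieT_metricT (g : Metric m M) {T : M → Bil m} (hT : SmoothT T) (X : M → E m) (x : M) :
    innerC (metricT g x) (T x) (lieT X (metricT g) x) =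
      trT g (lieT X T) x - der X (trT g T) x := by
  have hy := mem_extChartAt_target (I := 𝓘(ℝ, E m)) x
  have h1 : (fun z ↦ trT g T ((ext m x).symm z)) =ᶠ[𝓝 (ext m x x)]
      fun z ↦ trC (rep x (metricT g) z) (rep x T z) := by
    filter_upwards [target_mem_nhds hy] with z hz
    exact trT_symm g T hz
  have h := innerC_lieC (U := fieldInChart x X) (smoothT_metricT g x _ hy) (hT x _ hy)
    (eventually_isMetric_rep g hy)
  rw [rep_self, rep_self, fieldInChart_self, ← h1.fderiv_eq] at h
  exact h

/-- The right side is independent of the chart, whereas `divergence` is computed in the chart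
centred at each point. Hence div X = 0 can be read in every chart, as in `sum_fderiv_eq_zero`. -/
theorem divergence_eq (g : Metric m M) {X : M → E m} (hX : SmoothF X) (x : M) :
    divergence g X x = 1 / 2 * trT g (lieT X (metricT g)) x := by
  have hy := mem_extChartAt_target (I := 𝓘(ℝ, E m)) x
  have h := sum_fderiv_dens_mul (smoothT_metricT g x _ hy) (eventually_isMetric_rep g hy)
    ((hX x _ hy).differentiableAt (by simp))
  have hd := (isMetric_rep g hy).dens_pos
  change (dens (rep x (metricT g) (ext m x x)))⁻¹ * ∑ i, fderiv ℝ (fun y ↦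
    dens (rep x (metricT g) y) * fieldInChart x X y i) (ext m x x) (basisVec i) = _
  rw [h]
  field_simp
  rw [rep_self]
  rfl

theorem sum_fderiv_eq_zero (g : Metric m M) {X : M → E m} (hX : SmoothF X)
    (hdiv : ∀ x, divergence g X x = 0) {p : M} {y : E m} (hy : y ∈ (ext m p).target) :
    ∑ i, fderiv ℝ (fun z ↦ volDensity g p z * fieldInChart p X z i) y (basisVec i) = 0 := by
  have h := sum_fderiv_dens_mul (smoothT_metricT g p _ hy) (eventually_isMetric_rep g hy)
    ((hX p _ hy).differentiableAt (by simp))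
  refine h.trans ?_
  rw [← rep_lieT hX (smoothT_metricT g) hy, ← trT_symm g _ hy]
  have := hdiv ((ext m p).symm y)
  rw [divergence_eq g hX] at this
  have h0 : trT g (lieT X (metricT g)) ((ext m p).symm y) = 0 := by linarith
  rw [h0, mul_zero]

end Derivations

/-! ### Extension by zero and integration by parts on ℝᵐ. -/

section EuclideanIntegrals

variable {m : ℕ} {F : Type*} [NormedAddCommGroup F] [NormedSpace ℝ F]

/-- Near a point outside O the extension vanishes, because the complement of the compact K is an
open neighbourhood of that point. -/
theorem contDiff_indicator {O K : Set (E m)} (hO : IsOpen O) (hK : IsCompact K) (hKO : K ⊆ O)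
    {f : E m → F} (hf : ∀ y ∈ O, ContDiffAt ℝ ∞ f y) (h0 : ∀ y ∈ O, y ∉ K → f y = 0) :
    ContDiff ℝ ∞ (O.indicator f) := by
  rw [contDiff_iff_contDiffAt]
  intro y
  by_cases hy : y ∈ O
  · refine (hf y hy).congr_of_eventuallyEq ?_
    filter_upwards [hO.mem_nhds hy] with z hz
    exact Set.indicator_of_mem hz f
  · refine (contDiffAt_const (c := (0 : F))).congr_of_eventuallyEq ?_
    filter_upwards [hK.isClosed.isOpen_compl.mem_nhds fun h ↦ hy (hKO h)] with z hz
    by_cases hz' : z ∈ O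
    · rw [Set.indicator_of_mem hz', h0 z hz' hz]
    · exact Set.indicator_of_notMem hz' f

omit [NormedSpace ℝ F] in
theorem support_indicator_subset {O K : Set (E m)} {f : E m → F}
    (h0 : ∀ y ∈ O, y ∉ K → f y = 0) : Function.support (O.indicator f) ⊆ K := by
  intro y hy
  by_contra hyK
  by_cases hyO : y ∈ O
  · exact hy (by rw [Set.indicator_of_mem hyO, h0 y hyO hyK])
  · exact hy (Set.indicator_of_notMem hyO f)

omit [NormedSpace ℝ F] in
theorem tsupport_indicator_subset {O K : Set (E m)} (hK : IsCompact K) {f : E m → F}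
    (h0 : ∀ y ∈ O, y ∉ K → f y = 0) : tsupport (O.indicator f) ⊆ K :=
  closure_minimal (support_indicator_subset h0) hK.isClosed

omit [NormedSpace ℝ F] in
theorem hasCompactSupport_indicator {O K : Set (E m)} (hK : IsCompact K) {f : E m → F}
    (h0 : ∀ y ∈ O, y ∉ K → f y = 0) : HasCompactSupport (O.indicator f) :=
  hK.of_isClosed_subset (isClosed_tsupport _) (tsupport_indicator_subset hK h0)

theorem integral_fderiv_eq_zero {f : E m → ℝ} (hf : ContDiff ℝ ∞ f) (hc : HasCompactSupport f)
    (v : E m) : ∫ y, fderiv ℝ f y v = 0 := by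
  have h1 : Integrable (fun y ↦ fderiv ℝ f y v) (volume : Measure (E m)) := by
    refine Continuous.integrable_of_hasCompactSupport
      ((hf.continuous_fderiv (by simp)).clm_apply continuous_const) ?_
    exact (hc.fderiv ℝ).comp_left (g := fun A : E m →L[ℝ] ℝ ↦ A v) (by simp)
  have h2 : Integrable f (volume : Measure (E m)) := hf.continuous.integrable_of_hasCompactSupport hc
  -- Integration by parts against the constant function 1.
  have := integral_mul_fderiv_eq_neg_fderiv_mul_of_integrable (μ := (volume : Measure (E m)))
    (f := fun _ : E m ↦ (1 : ℝ)) (g := f) (v := v) (by simp) (by simpa using h1) (by simpa using h2)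
    (by simp) (fun x _ ↦ hf.differentiable (by simp) x)
  simpa using this

end EuclideanIntegrals

/-! ### The Riemannian measure in charts. -/

section Volume

variable {m : ℕ} {M : Type*}
  [TopologicalSpace M] [ChartedSpace (E m) M] [IsManifold 𝓘(ℝ, E m) ∞ M]
  [MeasurableSpace M] [BorelSpace M]

omit [IsManifold 𝓘(ℝ, E m) ∞ M] in
theorem measurableSet_target_inter_preimage (p : M) {B : Set M} (hB : MeasurableSet B) :
    MeasurableSet ((ext m p).target ∩ (ext m p).symm ⁻¹' B) := by
  have ht : MeasurableSet (ext m p).target := (isOpen_extChartAt_target p).measurableSet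
  have hc : Measurable ((ext m p).target.domRestrict (ext m p).symm) :=
    (continuousOn_iff_continuous_domRestrict.1 (continuousOn_extChartAt_symm p)).measurable
  have := ht.subtype_image (hc hB)
  convert this using 1
  ext y
  simp [and_comm]

omit [IsManifold 𝓘(ℝ, E m) ∞ M] in
theorem aemeasurable_symm (p : M) {μ : Measure (E m)} :
    AEMeasurable (ext m p).symm (μ.restrict (ext m p).target) :=
  (continuousOn_extChartAt_symm p).aemeasurable (isOpen_extChartAt_target p).measurableSet

theorem chartVolume_apply (g : Metric m M) (p : M) {B : Set M} (hB : MeasurableSet B) :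
    chartVolume g p B = ∫⁻ y in (ext m p).target ∩ (ext m p).symm ⁻¹' B,
      ENNReal.ofReal (volDensity g p y) := by
  have hac := withDensity_absolutelyContinuous
    ((volume : Measure (E m)).restrict (ext m p).target) fun y ↦ ENNReal.ofReal (volDensity g p y)
  rw [chartVolume, Measure.map_apply_of_aemeasurable ((aemeasurable_symm p).mono_ac hac) hB,
    withDensity_apply']
  have h1 : MeasurableSet (ext m p).target := (isOpen_extChartAt_target p).measurableSet
  rw [Measure.restrict_restrict' h1, Set.inter_comm]

/-- Change of variables along the transition map, with `dens_pull` cancelling the Jacobian. Only an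
inequality holds, since the chart at `q` may miss part of `B`. -/
theorem chartVolume_le (g : Metric m M) (p q : M) {B : Set M} (hB : MeasurableSet B)
    (hBp : B ⊆ (ext m p).source) : chartVolume g q B ≤ chartVolume g p B := by
  rw [chartVolume_apply g q hB, chartVolume_apply g p hB]
  set S := (ext m q).target ∩ (ext m q).symm ⁻¹' B
  have hS : MeasurableSet S := measurableSet_target_inter_preimage q hB
  have hSp {y} (hy : y ∈ S) : (ext m q).symm y ∈ (ext m p).source := hBp hy.2
  have hinj : Set.InjOn (trans m q p) S := by
    intro y hy z hz hyz
    have h1 := congrArg (ext m p).symm hyz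
    rw [symm_trans (hSp hy), symm_trans (hSp hz)] at h1
    exact (ext m q).symm.injOn hy.1 hz.1 h1
  have hd : ∀ y ∈ S, HasFDerivWithinAt (trans m q p) (fderiv ℝ (trans m q p) y) S y := fun y hy ↦
    ((contDiffAt_trans hy.1 (hSp hy)).differentiableAt (by simp)).hasFDerivAt.hasFDerivWithinAt
  have h1 := lintegral_image_eq_lintegral_abs_det_fderiv_mul volume hS hd hinj
    fun y ↦ ENNReal.ofReal (volDensity g p y)
  have h2 : ∫⁻ y in S, ENNReal.ofReal (volDensity g q y) =
      ∫⁻ y in trans m q p '' S, ENNReal.ofReal (volDensity g p y) := by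
    rw [h1]
    refine setLIntegral_congr_fun hS fun y hy ↦ ?_
    simp only [volDensity_eq]
    rw [rep_trans hy.1 (hSp hy), dens_pull, ENNReal.ofReal_mul (abs_nonneg _)]
  rw [h2]
  refine lintegral_mono_set ?_
  rintro _ ⟨y, hy, rfl⟩
  refine ⟨trans_mem_target (hSp hy), ?_⟩
  rw [Set.mem_preimage, symm_trans (hSp hy)]
  exact hy.2

omit [BorelSpace M] in
theorem chartVolume_le_vol (g : Metric m M) (p : M) : chartVolume g p ≤ vol g :=
  le_iSup (fun p ↦ chartVolume g p) p

theorem vol_apply (g : Metric m M) (p : M) {B : Set M} (hB : MeasurableSet B)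
    (hBp : B ⊆ (ext m p).source) : vol g B = chartVolume g p B := by
  have hs : MeasurableSet (ext m p).source := (isOpen_extChartAt_source p).measurableSet
  refine le_antisymm ?_ (chartVolume_le_vol g p B)
  -- The right side dominates every chart volume, on and off the domain of the chart at `p`
  -- separately, so it dominates the supremum.
  have h : vol g ≤ chartVolume g p + (vol g).restrict (ext m p).sourceᶜ := by
    refine iSup_le fun q ↦ Measure.le_iff.2 fun C hC ↦ ?_
    rw [← measure_inter_add_sdiff C hs, Measure.add_apply, Measure.restrict_apply hC,
      ← Set.sdiff_eq]
    refine add_le_add ?_ ?_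
    · exact (chartVolume_le g p q (hC.inter hs) Set.inter_subset_right).trans
        (measure_mono Set.inter_subset_left)
    · exact chartVolume_le_vol g q _
  refine (h B).trans ?_
  rw [Measure.add_apply, Measure.restrict_apply hB,
    Set.disjoint_iff_inter_eq_empty.1 (Set.disjoint_compl_right_iff_subset.2 hBp)]
  simp

theorem chartVolume_compl_source (g : Metric m M) (p : M) :
    chartVolume g p (ext m p).sourceᶜ = 0 := by
  have hs : MeasurableSet (ext m p).source := (isOpen_extChartAt_source p).measurableSet
  rw [chartVolume_apply g p hs.compl]
  have : (ext m p).target ∩ (ext m p).symm ⁻¹' (ext m p).sourceᶜ = ∅ := by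
    ext y
    simp only [Set.mem_inter_iff, Set.mem_preimage, Set.mem_compl_iff, Set.mem_empty_iff_false,
      iff_false, not_and, not_not]
    exact fun hy ↦ symm_mem_source hy
  rw [this]
  simp

theorem vol_restrict_source (g : Metric m M) (p : M) :
    (vol g).restrict (ext m p).source = chartVolume g p := by
  have hs : MeasurableSet (ext m p).source := (isOpen_extChartAt_source p).measurableSet
  ext B hB
  rw [Measure.restrict_apply hB, vol_apply g p (hB.inter hs) Set.inter_subset_right,
    ← measure_inter_add_sdiff B hs]
  have : chartVolume g p (B \ (ext m p).source) = 0 :=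
    measure_mono_null (fun x hx ↦ hx.2) (chartVolume_compl_source g p)
  rw [this, add_zero]

omit [MeasurableSpace M] [BorelSpace M] in
theorem contDiffAt_volDensity (g : Metric m M) {p : M} {y : E m} (hy : y ∈ (ext m p).target) :
    ContDiffAt ℝ ∞ (volDensity g p) y := by
  have h : ContDiffAt ℝ ∞ (fun z ↦ dens (rep p (metricT g) z)) y :=
    contDiffAt_dens (smoothT_metricT g p y hy) (isMetric_rep g hy)
  have h1 : volDensity g p = fun z ↦ dens (rep p (metricT g) z) := funext (volDensity_eq g p)
  rwa [h1]

omit [MeasurableSpace M] [BorelSpace M] in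
theorem continuousOn_volDensity (g : Metric m M) (p : M) :
    ContinuousOn (volDensity g p) (ext m p).target :=
  fun _ hy ↦ (contDiffAt_volDensity g hy).continuousAt.continuousWithinAt

/-- Integrals of functions supported in a chart domain are computed in the chart. -/
theorem integral_vol_eq (g : Metric m M) (p : M) {f : M → ℝ} (hf : Continuous f)
    (h0 : ∀ x ∉ (ext m p).source, f x = 0) : ∫ x, f x ∂(vol g) =
      ∫ y in (ext m p).target, volDensity g p y * f ((ext m p).symm y) := by
  have ht : MeasurableSet (ext m p).target := (isOpen_extChartAt_target p).measurableSet
  have hac := withDensity_absolutelyContinuous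
    ((volume : Measure (E m)).restrict (ext m p).target) fun y ↦ ENNReal.ofReal (volDensity g p y)
  rw [← setIntegral_eq_integral_of_forall_compl_eq_zero h0, vol_restrict_source, chartVolume,
    integral_map ((aemeasurable_symm p).mono_ac hac) hf.measurable.aestronglyMeasurable,
    integral_withDensity_eq_integral_toReal_smul₀
      ((continuousOn_volDensity g p).aemeasurable ht).ennreal_ofReal
      (Filter.Eventually.of_forall fun y ↦ ENNReal.ofReal_lt_top)]
  refine integral_congr_ae (Filter.Eventually.of_forall fun y ↦ ?_)
  simp only [smul_eq_mul]
  rw [ENNReal.toReal_ofReal (show 0 ≤ volDensity g p y from Real.sqrt_nonneg _)]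

/-- Each point has a neighbourhood whose image lies in a closed ball inside the chart target, where
the continuous density is integrable. -/
theorem isFiniteMeasureOnCompacts_vol (g : Metric m M) : IsFiniteMeasureOnCompacts (vol g) := by
  have : IsLocallyFiniteMeasure (vol g) := by
    refine ⟨fun p ↦ ?_⟩
    have hy := mem_extChartAt_target (I := 𝓘(ℝ, E m)) p
    obtain ⟨r, hr, hball⟩ := Metric.nhds_basis_closedBall.mem_iff.1 (target_mem_nhds hy)
    have hopen : IsOpen ((ext m p).source ∩ ext m p ⁻¹' Metric.ball (ext m p p) r) :=
      (continuousOn_extChartAt p).isOpen_inter_preimage (isOpen_extChartAt_source p) Metric.isOpen_ball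
    refine ⟨_, hopen.mem_nhds ⟨mem_extChartAt_source p, Metric.mem_ball_self hr⟩, ?_⟩
    rw [vol_apply g p hopen.measurableSet Set.inter_subset_left,
      chartVolume_apply g p hopen.measurableSet]
    refine lt_of_le_of_lt (lintegral_mono_set (t := Metric.closedBall (ext m p p) r) ?_) ?_
    · rintro y ⟨hy1, -, hy2⟩
      rw [Set.mem_preimage, (ext m p).right_inv hy1] at hy2
      exact Metric.ball_subset_closedBall hy2
    · have : IntegrableOn (volDensity g p) (Metric.closedBall (ext m p p) r) :=
        ((continuousOn_volDensity g p).mono hball).integrableOn_compact (isCompact_closedBall _ _)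
      exact this.lintegral_lt_top
  infer_instance

end Volume

/-! ### Partitions of unity and the divergence theorem. -/

section DivergenceTheorem

variable {m : ℕ} {M : Type*}
  [TopologicalSpace M] [ChartedSpace (E m) M] [IsManifold 𝓘(ℝ, E m) ∞ M]
  [T2Space M] [SecondCountableTopology M]

/-- A finite smooth partition of unity near a compact set, subordinate to chart domains. -/
theorem exists_finite_partition {K : Set M} (hK : IsCompact K) :
    ∃ (J : Finset M) (χ : M → M → ℝ), (∀ i, SmoothS m (χ i)) ∧
      (∀ i, tsupport (χ i) ⊆ (ext m i).source) ∧ ∀ x ∈ K, ∀ᶠ z in 𝓝 x, ∑ i ∈ J, χ i z = 1 := by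
  have : LocallyCompactSpace M := ChartedSpace.locallyCompactSpace (E m) M
  have : SigmaCompactSpace M := inferInstance
  -- The finite index set is chosen for a compact neighbourhood of K, so that the sum equals 1 near
  -- K and its derivatives vanish on K.
  obtain ⟨K', hK', hKK'⟩ := exists_compact_superset hK
  obtain ⟨f, hf⟩ := SmoothPartitionOfUnity.exists_isSubordinate 𝓘(ℝ, E m) isClosed_univ
    (fun p : M ↦ (ext m p).source) (fun p ↦ isOpen_extChartAt_source p)
    (fun x _ ↦ Set.mem_iUnion.2 ⟨x, mem_extChartAt_source x⟩)
  have hfin := f.locallyFinite.finite_nonempty_inter_compact hK'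
  refine ⟨hfin.toFinset, fun i ↦ f i, fun i ↦ (f i).contMDiff, hf, fun x hx ↦ ?_⟩
  filter_upwards [isOpen_interior.mem_nhds (hKK' hx)] with z hz
  rw [← f.sum_eq_one (Set.mem_univ z), finsum_eq_sum_of_support_subset]
  intro i hi
  rw [Set.Finite.coe_toFinset]
  exact ⟨z, hi, interior_subset hz⟩

/-- Compactly supported fields. -/
def CompactF (X : M → E m) : Prop := IsCompact (closure {x | X x ≠ 0})

omit [IsManifold 𝓘(ℝ, E m) ∞ M] [T2Space M] [SecondCountableTopology M]
  [ChartedSpace (E m) M] in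
theorem eq_zero_of_notMem {X : M → E m} {x : M} (hx : x ∉ closure {x | X x ≠ 0}) : X x = 0 := by
  by_contra h
  exact hx (subset_closure h)

omit [IsManifold 𝓘(ℝ, E m) ∞ M] [T2Space M] [SecondCountableTopology M] in
theorem der_eq_zero_of_field {X : M → E m} {x : M} (hx : X x = 0) (f : M → ℝ) : der X f x = 0 := by
  rw [der, hx, map_zero]

omit [IsManifold 𝓘(ℝ, E m) ∞ M] [T2Space M] [SecondCountableTopology M] in
theorem der_eq_zero_of_notMem_tsupport (X : M → E m) {f : M → ℝ} {x : M} (hx : x ∉ tsupport f) :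
    der X f x = 0 := by
  have h1 : f =ᶠ[𝓝 x] fun _ ↦ (0 : ℝ) := notMem_tsupport_iff_eventuallyEq.1 hx
  rw [der_congr h1, der]
  simp

omit [IsManifold 𝓘(ℝ, E m) ∞ M] [T2Space M] [SecondCountableTopology M] in
theorem hasCompactSupport_der {X : M → E m} (hc : CompactF X) (f : M → ℝ) :
    HasCompactSupport (der X f) := by
  refine hc.of_isClosed_subset (isClosed_tsupport _) (closure_mono fun x hx hX ↦ ?_)
  exact hx (der_eq_zero_of_field hX f)

variable [MeasurableSpace M] [BorelSpace M]

omit [T2Space M] [SecondCountableTopology M] in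
theorem integrable_der (g : Metric m M) {X : M → E m} (hX : SmoothF X) (hc : CompactF X) {f : M → ℝ}
    (hf : SmoothS m f) : Integrable (der X f) (vol g) :=
  have := isFiniteMeasureOnCompacts_vol g
  (hf.der hX).continuous.integrable_of_hasCompactSupport (hasCompactSupport_der hc f)

omit [T2Space M] [SecondCountableTopology M] in
theorem integral_der_eq_zero_of_tsupport_subset (g : Metric m M) {X : M → E m} (hX : SmoothF X)
    (hc : CompactF X) (hdiv : ∀ x, divergence g X x = 0) {f : M → ℝ} (hf : SmoothS m f) {p : M}
    (hp : tsupport f ⊆ (ext m p).source) : ∫ x, der X f x ∂(vol g) = 0 := by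
  -- Compactness comes from X, containment in the chart domain from f; neither support need have
  -- both properties.
  set C := closure {x | X x ≠ 0} ∩ tsupport f
  have hC : IsCompact C := hc.inter_right (isClosed_tsupport f)
  have hCp : C ⊆ (ext m p).source := Set.inter_subset_right.trans hp
  set K := ext m p '' C
  have hK : IsCompact K := hC.image_of_continuousOn ((continuousOn_extChartAt p).mono hCp)
  have hKt : K ⊆ (ext m p).target := by
    rintro _ ⟨x, hx, rfl⟩
    exact (ext m p).map_source (hCp hx)
  have hO : IsOpen (ext m p).target := isOpen_extChartAt_target p
  have hnot {y} (hy : y ∈ (ext m p).target) (hyK : y ∉ K) : (ext m p).symm y ∉ C :=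
    fun h ↦ hyK ⟨_, h, (ext m p).right_inv hy⟩
  -- With ρ the volume density, ρ·Xf = ∑ᵢ ∂ᵢ(ρ Xⁱ f), because ∑ᵢ ∂ᵢ(ρ Xⁱ) = 0. Each `W i`, extended
  -- by zero, is smooth with compact support and its derivatives integrate to zero.
  let W : Fin m → E m → ℝ := fun i y ↦
    (volDensity g p y * fieldInChart p X y i) * f ((ext m p).symm y)
  have hρX {y} (hy : y ∈ (ext m p).target) (i : Fin m) :
      ContDiffAt ℝ ∞ (fun y ↦ volDensity g p y * fieldInChart p X y i) y :=
    (contDiffAt_volDensity g hy).mul (contDiffAt_euclidean.1 (hX p y hy) i)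
  have hW (i : Fin m) : ∀ y ∈ (ext m p).target, ContDiffAt ℝ ∞ (W i) y := fun y hy ↦
    (hρX hy i).mul (hf.contDiffAt hy)
  have hW0 (i : Fin m) : ∀ y ∈ (ext m p).target, y ∉ K → W i y = 0 := by
    intro y hy hyK
    have h1 := hnot hy hyK
    by_cases h2 : (ext m p).symm y ∈ tsupport f
    · have h3 : X ((ext m p).symm y) = 0 := eq_zero_of_notMem fun h ↦ h1 ⟨h, h2⟩
      have : fieldInChart p X y = 0 := by rw [fieldInChart_eq, h3, map_zero]
      simp [W, this]
    · show _ * f _ = 0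
      rw [image_eq_zero_of_notMem_tsupport h2, mul_zero]
  have hcd (i : Fin m) := contDiff_indicator hO hK hKt (hW i) (hW0 i)
  have hcs (i : Fin m) := hasCompactSupport_indicator hK (hW0 i)
  have hint (i : Fin m) := integral_fderiv_eq_zero (hcd i) (hcs i) (basisVec i)
  rw [integral_vol_eq g p (hf.der hX).continuous fun x hx ↦
    der_eq_zero_of_notMem_tsupport X fun h ↦ hx (hp h), ← integral_indicator hO.measurableSet]
  have key : (ext m p).target.indicator (fun y ↦ volDensity g p y * der X f ((ext m p).symm y)) =
      fun y ↦ ∑ i, fderiv ℝ ((ext m p).target.indicator (W i)) y (basisVec i) := by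
    funext y
    by_cases hy : y ∈ (ext m p).target
    · have hev (i : Fin m) : (ext m p).target.indicator (W i) =ᶠ[𝓝 y] W i := by
        filter_upwards [hO.mem_nhds hy] with z hz
        exact Set.indicator_of_mem hz _
      have h1 (i : Fin m) : fderiv ℝ (W i) y (basisVec i) =
          volDensity g p y * fieldInChart p X y i *
            fderiv ℝ (fun z ↦ f ((ext m p).symm z)) y (basisVec i) + f ((ext m p).symm y) *
          fderiv ℝ (fun z ↦ volDensity g p z * fieldInChart p X z i) y (basisVec i) := by
        have h := ((hρX hy i).differentiableAt (by simp)).hasFDerivAt.mul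
          ((hf.contDiffAt hy).differentiableAt (by simp)).hasFDerivAt
        refine (DFunLike.congr_fun h.fderiv _).trans ?_
        simp
      simp only [(hev _).fderiv_eq, h1]
      rw [Set.indicator_of_mem hy, Finset.sum_add_distrib, ← Finset.mul_sum,
        sum_fderiv_eq_zero g hX hdiv hy, mul_zero, add_zero, der_symm hf X hy]
      conv_lhs => rw [← sum_smul_basisVec (fieldInChart p X y)]
      rw [map_sum, Finset.mul_sum]
      refine Finset.sum_congr rfl fun i _ ↦ ?_
      rw [map_smul, smul_eq_mul, mul_assoc]
    · have h1 (i : Fin m) : fderiv ℝ ((ext m p).target.indicator (W i)) y = 0 := by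
        have : y ∉ tsupport ((ext m p).target.indicator (W i)) := fun h ↦
          hy (hKt (tsupport_indicator_subset hK (hW0 i) h))
        rw [(notMem_tsupport_iff_eventuallyEq.1 this).fderiv_eq]
        simp
      rw [Set.indicator_of_notMem hy]
      refine (Finset.sum_eq_zero fun i _ ↦ ?_).symm
      rw [h1 i]
      rfl
  rw [key, integral_finsetSum]
  · exact Finset.sum_eq_zero fun i _ ↦ hint i
  · intro i _
    refine Continuous.integrable_of_hasCompactSupport
      (((hcd i).continuous_fderiv (by simp)).clm_apply continuous_const) ?_
    exact ((hcs i).fderiv ℝ).comp_left (g := fun A : E m →L[ℝ] ℝ ↦ A (basisVec i)) (by simp)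

/-- The divergence theorem for compactly supported divergence free fields. -/
theorem integral_der_eq_zero (g : Metric m M) {X : M → E m} (hX : SmoothF X)
    (hc : CompactF X) (hdiv : ∀ x, divergence g X x = 0) {f : M → ℝ} (hf : SmoothS m f) :
    ∫ x, der X f x ∂(vol g) = 0 := by
  obtain ⟨J, χ, hχ, hsub, hsum⟩ := exists_finite_partition (m := m) hc
  have hχf (i : M) : SmoothS m fun x ↦ χ i x * f x := (hχ i).mul hf
  have key : der X f = fun x ↦ ∑ i ∈ J, der X (fun x ↦ χ i x * f x) x := by
    funext x
    by_cases hx : x ∈ closure {x | X x ≠ 0}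
    · rw [← der_sum J (fun i _ ↦ hχf i)]
      refine der_congr ?_ X
      filter_upwards [hsum x hx] with z hz
      rw [← Finset.sum_mul, hz, one_mul]
    · have h0 := eq_zero_of_notMem hx
      simp [der_eq_zero_of_field h0]
  rw [key, integral_finsetSum _ fun i _ ↦ integrable_der g hX hc (hχf i)]
  refine Finset.sum_eq_zero fun i _ ↦ ?_
  refine integral_der_eq_zero_of_tsupport_subset g hX hc hdiv (hχf i) (p := i) ?_
  exact (tsupport_mul_subset_left (f := χ i) (g := f)).trans (hsub i)

end DivergenceTheorem

/-! ### Differentiation under the integral, and equality of measures by smooth test functions. -/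

section Integrals

variable {M : Type*} [TopologicalSpace M] [MeasurableSpace M] [BorelSpace M]

/-- Differentiation under the integral sign for a family that is constant in `t` off a compact
set. -/
theorem hasDerivAt_integral_of_compact [T2Space M] {μ : Measure M} [IsFiniteMeasureOnCompacts μ]
    {C : Set M} (hC : IsCompact C) {H H' : ℝ → M → ℝ} (hder : ∀ t x, HasDerivAt (H · x) (H' t x) t)
    (hconst : ∀ t, ∀ x ∉ C, H t x = H 0 x) (hcont : ∀ t, Continuous (H t))
    (hcont' : ∀ t, Continuous (H' t))
    (hjoint : ContinuousOn (fun q : ℝ × M ↦ H' q.1 q.2) (Set.univ ×ˢ C))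
    (hint : Integrable (H 0) μ) (t : ℝ) :
    HasDerivAt (fun t ↦ ∫ x, H t x ∂μ) (∫ x, H' t x ∂μ) t := by
  have hzero (t : ℝ) : ∀ x ∉ C, H' t x = 0 := fun x hx ↦ by
    refine (hder t x).unique ?_
    rw [show (H · x) = fun _ ↦ H 0 x from funext fun s ↦ hconst s x hx]
    exact hasDerivAt_const t _
  -- `H t` differs from the integrable `H 0` by a continuous function supported in C; `H 0` itself
  -- need not have compact support.
  have hintt : Integrable (H t) μ := by
    have h1 : Integrable (fun x ↦ H t x - H 0 x) μ := by
      refine ((hcont t).sub (hcont 0)).integrable_of_hasCompactSupport ?_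
      refine HasCompactSupport.intro hC fun x hx ↦ ?_
      rw [Pi.sub_apply, hconst t x hx, sub_self]
    refine (h1.add hint).congr (Filter.Eventually.of_forall fun x ↦ ?_)
    rw [Pi.add_apply, sub_add_cancel]
  obtain ⟨b, hb⟩ := ((isCompact_Icc (a := t - 1) (b := t + 1)).prod hC).exists_bound_of_continuousOn
    (hjoint.mono (Set.prod_mono_left (Set.subset_univ _)))
  refine (hasDerivAt_integral_of_dominated_loc_of_deriv_le (s := Set.Icc (t - 1) (t + 1))
    (bound := C.indicator fun _ ↦ b) (F := H) (F' := H')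
    (Icc_mem_nhds (by linarith) (by linarith)) ?_ hintt (hcont' t).aestronglyMeasurable ?_ ?_ ?_).2
  · exact Filter.Eventually.of_forall fun s ↦ (hcont s).aestronglyMeasurable
  · refine Filter.Eventually.of_forall fun x s hs ↦ ?_
    by_cases hx : x ∈ C
    · rw [Set.indicator_of_mem hx]
      exact hb (s, x) ⟨hs, hx⟩
    · rw [Set.indicator_of_notMem hx, hzero s x hx, norm_zero]
  · rw [integrable_indicator_iff hC.measurableSet]
    exact integrableOn_const hC.measure_lt_top.ne
  · exact Filter.Eventually.of_forall fun x s _ ↦ hder s x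

/-- Regular measures on a manifold are determined by the integrals of smooth compactly supported
functions. -/
theorem measure_eq_of_integral_smooth_eq {m : ℕ} [ChartedSpace (E m) M]
    [IsManifold 𝓘(ℝ, E m) ∞ M] [T2Space M] [SecondCountableTopology M] {μ ν : Measure M}
    [μ.Regular] [ν.Regular]
    (h : ∀ f : M → ℝ, SmoothS m f → HasCompactSupport f → ∫ x, f x ∂μ = ∫ x, f x ∂ν) : μ = ν := by
  have : LocallyCompactSpace M := ChartedSpace.locallyCompactSpace (E m) M
  have : SigmaCompactSpace M := inferInstance
  -- For K ⊆ L ⊆ U, with K and L compact, a bump function f gives μ(K) ≤ ∫ f dμ = ∫ f dν ≤ ν(L) ≤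
  -- ν(U); inner regularity on open sets finishes.
  have key {μ ν : Measure M} [μ.Regular] [ν.Regular]
      (h : ∀ f : M → ℝ, SmoothS m f → HasCompactSupport f → ∫ x, f x ∂μ = ∫ x, f x ∂ν)
      {U : Set M} (hU : IsOpen U) : μ U ≤ ν U := by
    rw [hU.measure_eq_iSup_isCompact]
    refine iSup₂_le fun K hKU ↦ iSup_le fun hK ↦ ?_
    obtain ⟨L, hL, hKL, hLU⟩ := exists_compact_between hK hU hKU
    obtain ⟨f, hf1, hf0, hf⟩ :=
      exists_contMDiffMap_one_nhds_of_subset_interior 𝓘(ℝ, E m) (n := (⊤ : ℕ∞)) hK.isClosed hKL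
    have hcs : HasCompactSupport f := HasCompactSupport.intro hL hf0
    have hcont : Continuous f := f.contMDiff.continuous
    have hone : ∀ x ∈ K, f x = 1 := fun x hx ↦ hf1.self_of_nhdsSet x hx
    have h1 : μ K ≤ ENNReal.ofReal (∫ x, f x ∂μ) := by
      rw [ofReal_integral_eq_lintegral_ofReal (hcont.integrable_of_hasCompactSupport hcs)
        (Filter.Eventually.of_forall fun x ↦ (hf x).1), ← lintegral_indicator_one hK.measurableSet]
      refine lintegral_mono fun x ↦ ?_
      by_cases hx : x ∈ K
      · simp [hx, hone x hx]
      · simp [hx]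
    have h2 : ENNReal.ofReal (∫ x, f x ∂ν) ≤ ν L := by
      rw [ofReal_integral_eq_lintegral_ofReal (hcont.integrable_of_hasCompactSupport hcs)
        (Filter.Eventually.of_forall fun x ↦ (hf x).1), ← lintegral_indicator_one hL.measurableSet]
      refine lintegral_mono fun x ↦ ?_
      by_cases hx : x ∈ L
      · simpa [hx] using (hf x).2
      · simp [hx, hf0 x hx]
    rw [h f f.contMDiff hcs] at h1
    exact h1.trans (h2.trans (measure_mono hLU))
  exact Measure.OuterRegular.ext_isOpen fun U hU ↦
    le_antisymm (key h hU) (key (fun f hf hc ↦ (h f hf hc).symm) hU)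

end Integrals

/-! ### Flows of fields supported in one chart domain. -/

section LocalFlow

variable {m : ℕ} {M : Type*}
  [TopologicalSpace M] [ChartedSpace (E m) M]

/-- Smooth vector fields that vanish off a compact subset `C` of the domain of the chart
around `p`. -/
structure IsLocalField (Z : M → E m) (p : M) (C : Set M) : Prop where
  smooth : SmoothF Z
  isCompact : IsCompact C
  subset : C ⊆ (ext m p).source
  zero : ∀ x ∉ C, Z x = 0

/-- The coordinate expression of a vector field, extended by `0` to all of `ℝᵐ`. -/
noncomputable def chartField (p : M) (Z : M → E m) : E m → E m :=
  (ext m p).target.indicator (fieldInChart p Z)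

theorem chartField_of_mem (Z : M → E m) {p : M} {y : E m} (hy : y ∈ (ext m p).target) :
    chartField p Z y = fieldInChart p Z y := Set.indicator_of_mem hy _

namespace IsLocalField

variable {Z : M → E m} {p : M} {C : Set M} (hl : IsLocalField Z p C)

include hl

theorem isCompact_image : IsCompact (ext m p '' C) :=
  hl.isCompact.image_of_continuousOn ((continuousOn_extChartAt p).mono hl.subset)

theorem image_subset : ext m p '' C ⊆ (ext m p).target := by
  rintro _ ⟨x, hx, rfl⟩
  exact (ext m p).map_source (hl.subset hx)

theorem mem_of_mem_image {x : M} (hx : x ∈ (ext m p).source) (h : ext m p x ∈ ext m p '' C) :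
    x ∈ C := by
  obtain ⟨z, hz, hzx⟩ := h
  rwa [← (ext m p).injOn (hl.subset hz) hx hzx]

theorem fieldInChart_eq_zero {y : E m} (hy : y ∈ (ext m p).target) (hyC : y ∉ ext m p '' C) :
    fieldInChart p Z y = 0 := by
  rw [fieldInChart_eq, hl.zero, map_zero]
  exact fun h ↦ hyC ⟨_, h, (ext m p).right_inv hy⟩

theorem contDiff_chartField : ContDiff ℝ ∞ (chartField p Z) :=
  contDiff_indicator (isOpen_extChartAt_target p) hl.isCompact_image hl.image_subset
    (hl.smooth p) fun _ ↦ hl.fieldInChart_eq_zero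

theorem hasCompactSupport_chartField : HasCompactSupport (chartField p Z) :=
  hasCompactSupport_indicator hl.isCompact_image fun _ ↦ hl.fieldInChart_eq_zero

theorem chartField_eq_zero {y : E m} (hy : y ∉ ext m p '' C) : chartField p Z y = 0 := by
  by_contra h
  exact hy (support_indicator_subset (fun _ ↦ hl.fieldInChart_eq_zero) h)

/-- The flow of the coordinate expression. -/
noncomputable def chartFlow (t : ℝ) (y : E m) : E m :=
  flow hl.contDiff_chartField hl.hasCompactSupport_chartField t y

theorem contDiff_chartFlow : ContDiff ℝ ∞ fun q : ℝ × E m ↦ hl.chartFlow q.1 q.2 :=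
  contDiff_flow _ _

theorem chartFlow_of_notMem (t : ℝ) {y : E m} (hy : y ∉ ext m p '' C) : hl.chartFlow t y = y :=
  flow_of_eq_zero _ _ (hl.chartField_eq_zero hy) t

theorem chartFlow_add (s t : ℝ) (y : E m) :
    hl.chartFlow (s + t) y = hl.chartFlow s (hl.chartFlow t y) := flow_add _ _ s t y

theorem chartFlow_zero (y : E m) : hl.chartFlow 0 y = y := flow_zero _ _ y

theorem hasDerivAt_chartFlow (t : ℝ) (y : E m) :
    HasDerivAt (fun t ↦ hl.chartFlow t y) (chartField p Z (hl.chartFlow t y)) t :=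
  hasDerivAt_flow _ _ t y

/-- A point that left the set would be fixed by the flow at all times, so reversing time could not
bring it back. -/
theorem chartFlow_mem (t : ℝ) {y : E m} (hy : y ∈ ext m p '' C) :
    hl.chartFlow t y ∈ ext m p '' C := by
  by_contra h
  have h1 := hl.chartFlow_of_notMem (-t) h
  rw [← hl.chartFlow_add, neg_add_cancel, hl.chartFlow_zero] at h1
  exact h (h1 ▸ hy)

theorem chartFlow_mem_target (t : ℝ) {y : E m} (hy : y ∈ (ext m p).target) :
    hl.chartFlow t y ∈ (ext m p).target := by
  by_cases h : y ∈ ext m p '' C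
  · exact hl.image_subset (hl.chartFlow_mem t h)
  · rwa [hl.chartFlow_of_notMem t h]

open Classical in
/-- The flow of a vector field supported in a chart domain. -/
noncomputable def localFlow (t : ℝ) (x : M) : M :=
  if x ∈ C then (ext m p).symm (hl.chartFlow t (ext m p x)) else x

theorem localFlow_of_notMem (t : ℝ) {x : M} (hx : x ∉ C) : hl.localFlow t x = x := if_neg hx

/-- The chart formula holds on the whole domain, beyond C, because the chart flow fixes points
outside the image of C. This overlap of the two formulas gives smoothness at the boundary of C. -/
theorem localFlow_of_mem_source (t : ℝ) {x : M} (hx : x ∈ (ext m p).source) :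
    hl.localFlow t x = (ext m p).symm (hl.chartFlow t (ext m p x)) := by
  by_cases h : x ∈ C
  · exact if_pos h
  · rw [hl.localFlow_of_notMem t h, hl.chartFlow_of_notMem t fun h' ↦ h (hl.mem_of_mem_image hx h'),
      (ext m p).left_inv hx]

theorem localFlow_symm (t : ℝ) {y : E m} (hy : y ∈ (ext m p).target) :
    hl.localFlow t ((ext m p).symm y) = (ext m p).symm (hl.chartFlow t y) := by
  rw [hl.localFlow_of_mem_source t (symm_mem_source hy), (ext m p).right_inv hy]

theorem localFlow_zero (x : M) : hl.localFlow 0 x = x := by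
  by_cases h : x ∈ C
  · rw [hl.localFlow_of_mem_source 0 (hl.subset h), hl.chartFlow_zero,
      (ext m p).left_inv (hl.subset h)]
  · exact hl.localFlow_of_notMem 0 h

theorem localFlow_add (s t : ℝ) (x : M) :
    hl.localFlow (s + t) x = hl.localFlow s (hl.localFlow t x) := by
  by_cases h : x ∈ C
  · have hx := hl.subset h
    rw [hl.localFlow_of_mem_source _ hx, hl.localFlow_of_mem_source t hx, hl.chartFlow_add,
      hl.localFlow_symm s (hl.chartFlow_mem_target t ((ext m p).map_source hx))]
  · rw [hl.localFlow_of_notMem _ h, hl.localFlow_of_notMem _ h, hl.localFlow_of_notMem _ h]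

variable [IsManifold 𝓘(ℝ, E m) ∞ M]

theorem contMDiff_uncurry_localFlow [T2Space M] :
    ContMDiff (𝓘(ℝ, ℝ).prod 𝓘(ℝ, E m)) 𝓘(ℝ, E m) ∞ fun q : ℝ × M ↦ hl.localFlow q.1 q.2 := by
  rintro ⟨t, x⟩
  by_cases h : x ∈ C
  · have hx := hl.subset h
    have hy := hl.chartFlow_mem_target t ((ext m p).map_source hx)
    have h1 : ContMDiffAt (𝓘(ℝ, ℝ).prod 𝓘(ℝ, E m)) (𝓘(ℝ, ℝ).prod 𝓘(ℝ, E m)) ∞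
        (fun q : ℝ × M ↦ (q.1, ext m p q.2)) (t, x) :=
      contMDiffAt_fst.prodMk ((contMDiffAt_ext hx).comp (t, x) contMDiffAt_snd)
    have h2 : ContMDiff (𝓘(ℝ, ℝ).prod 𝓘(ℝ, E m)) 𝓘(ℝ, E m) ∞
        fun q : ℝ × E m ↦ hl.chartFlow q.1 q.2 := by
      rw [← modelWithCornersSelf_prod, chartedSpaceSelf_prod]
      exact hl.contDiff_chartFlow.contMDiff
    have h3 := (contMDiffAt_ext_symm hy).comp (t, x) (h2.contMDiffAt.comp (t, x) h1)
    refine h3.congr_of_eventuallyEq ?_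
    filter_upwards [((isOpen_extChartAt_source p).preimage continuous_snd).mem_nhds
      (show (t, x) ∈ Prod.snd ⁻¹' (ext m p).source from hx)] with q hq
    exact hl.localFlow_of_mem_source q.1 hq
  · refine (contMDiffAt_snd (n := ∞)).congr_of_eventuallyEq ?_
    filter_upwards [(hl.isCompact.isClosed.isOpen_compl.preimage continuous_snd).mem_nhds
      (show (t, x) ∈ Prod.snd ⁻¹' Cᶜ from h)] with q hq
    exact hl.localFlow_of_notMem q.1 hq

theorem contMDiff_localFlow [T2Space M] (t : ℝ) :
    ContMDiff 𝓘(ℝ, E m) 𝓘(ℝ, E m) ∞ (hl.localFlow t) :=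
  hl.contMDiff_uncurry_localFlow.comp (contMDiff_const.prodMk contMDiff_id)

/-- The diffeomorphisms in the flow of a vector field supported in a chart domain. -/
noncomputable def localDiffeo [T2Space M] (t : ℝ) :
    Diffeomorph 𝓘(ℝ, E m) 𝓘(ℝ, E m) M M ∞ where
  toFun := hl.localFlow t
  invFun := hl.localFlow (-t)
  left_inv x := by rw [← hl.localFlow_add, neg_add_cancel, hl.localFlow_zero]
  right_inv x := by rw [← hl.localFlow_add, add_neg_cancel, hl.localFlow_zero]
  contMDiff_toFun := hl.contMDiff_localFlow t
  contMDiff_invFun := hl.contMDiff_localFlow (-t)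

theorem hasDerivAt_comp_localFlow {f : M → ℝ} (hf : SmoothS m f) (t : ℝ) (x : M) :
    HasDerivAt (fun t ↦ f (hl.localFlow t x)) (der Z f (hl.localFlow t x)) t := by
  by_cases h : x ∈ C
  · have hx := hl.subset h
    have hy := hl.chartFlow_mem_target t ((ext m p).map_source hx)
    simp only [hl.localFlow_of_mem_source _ hx]
    rw [der_symm hf Z hy, ← chartField_of_mem Z hy]
    exact (((hf.contDiffAt hy).differentiableAt (by simp)).hasFDerivAt).comp_hasDerivAt t
      (hl.hasDerivAt_chartFlow t _)
  · simp only [hl.localFlow_of_notMem _ h]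
    rw [der_eq_zero_of_field (hl.zero x h)]
    exact hasDerivAt_const t _

/-- A field is invariant under its own flow: both sides are the derivative of s ↦ f(ψ_{t+s} x) at s
= 0, read through the group law. -/
theorem der_comp_localFlow [T2Space M] {f : M → ℝ} (hf : SmoothS m f) (t : ℝ) (x : M) :
    der Z (fun x ↦ f (hl.localFlow t x)) x = der Z f (hl.localFlow t x) := by
  have h1 := hl.hasDerivAt_comp_localFlow (hf.comp (hl.contMDiff_localFlow t)) 0 x
  have h2 : HasDerivAt (fun s ↦ f (hl.localFlow (t + s) x)) (der Z f (hl.localFlow (t + 0) x)) 0 :=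
    (hl.hasDerivAt_comp_localFlow hf (t + 0) x).comp_const_add t 0
  simp only [hl.localFlow_add t] at h2
  rw [hl.localFlow_zero] at h1 h2
  exact h1.unique h2

end IsLocalField

end LocalFlow

/-! ### Weakly divergence free fields have volume preserving flows. -/

section VolumePreserving

variable {m : ℕ} {M : Type*}
  [TopologicalSpace M] [ChartedSpace (E m) M] [IsManifold 𝓘(ℝ, E m) ∞ M]
  [T2Space M] [SecondCountableTopology M] [MeasurableSpace M] [BorelSpace M]
  {Z : M → E m} {p : M} {C : Set M}

omit [SecondCountableTopology M] in
-- The time derivative is ∫ (Zf)∘ψ_t = ∫ Z(f∘ψ_t), which vanishes by the weak divergence condition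
-- applied to f∘ψ_t, so the integral keeps its value at t = 0.
theorem IsLocalField.integral_comp_localFlow (hl : IsLocalField Z p C) (g : Metric m M)
    (hdiv : ∀ f : M → ℝ, SmoothS m f → ∫ x, der Z f x ∂(vol g) = 0)
    {f : M → ℝ} (hf : SmoothS m f) (hfc : HasCompactSupport f) (t : ℝ) :
    ∫ x, f (hl.localFlow t x) ∂(vol g) = ∫ x, f x ∂(vol g) := by
  have := isFiniteMeasureOnCompacts_vol g
  have hjoint : Continuous fun q : ℝ × M ↦ der Z f (hl.localFlow q.1 q.2) :=
    (hf.der hl.smooth).continuous.comp hl.contMDiff_uncurry_localFlow.continuous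
  have key (t : ℝ) : HasDerivAt (fun t ↦ ∫ x, f (hl.localFlow t x) ∂(vol g)) 0 t := by
    have h := hasDerivAt_integral_of_compact (μ := vol g) hl.isCompact
      (H := fun t x ↦ f (hl.localFlow t x)) (H' := fun t x ↦ der Z f (hl.localFlow t x))
      (fun t x ↦ hl.hasDerivAt_comp_localFlow hf t x)
      (fun t x hx ↦ by simp only [hl.localFlow_of_notMem _ hx])
      (fun t ↦ hf.continuous.comp (hl.contMDiff_localFlow t).continuous)
      (fun t ↦ (hf.der hl.smooth).continuous.comp (hl.contMDiff_localFlow t).continuous)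
      hjoint.continuousOn
      (by simpa only [hl.localFlow_zero] using hf.continuous.integrable_of_hasCompactSupport hfc) t
    have h0 := hdiv _ (hf.comp (hl.contMDiff_localFlow t))
    simp only [Function.comp_def, hl.der_comp_localFlow hf] at h0
    rwa [h0] at h
  have h := is_const_of_deriv_eq_zero (fun t ↦ (key t).differentiableAt) (fun t ↦ (key t).deriv) t 0
  simpa only [hl.localFlow_zero] using h

theorem isRegular_vol (g : Metric m M) : (vol g).Regular := by
  have : LocallyCompactSpace M := ChartedSpace.locallyCompactSpace (E m) M
  have := isFiniteMeasureOnCompacts_vol g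
  infer_instance

/-- The flow of a divergence free vector field supported in a chart domain. -/
theorem IsLocalField.isSDiffCurve (hl : IsLocalField Z p C) (g : Metric m M)
    (hdiv : ∀ f : M → ℝ, SmoothS m f → ∫ x, der Z f x ∂(vol g) = 0) :
    IsSDiffCurve g hl.localDiffeo where
  zero := hl.localFlow_zero
  smooth := hl.contMDiff_uncurry_localFlow
  volumePreserving t := by
    have := isRegular_vol g
    have h1 : ((vol g).map (hl.localDiffeo t)).Regular :=
      Measure.Regular.map (hl.localDiffeo t).toHomeomorph
    have hm : Measurable (hl.localDiffeo t) := (hl.localDiffeo t).continuous.measurable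
    refine ⟨hm, ?_⟩
    refine measure_eq_of_integral_smooth_eq (m := m) fun f hf hfc ↦ ?_
    rw [integral_map hm.aemeasurable hf.continuous.aestronglyMeasurable]
    exact hl.integral_comp_localFlow g hdiv hf hfc t
  compactSupport _ := ⟨C, hl.isCompact,
    Filter.Eventually.of_forall fun t _ hx ↦ hl.localFlow_of_notMem t hx⟩

end VolumePreserving

/-! ### Linearity of trace and inner product. -/

section Algebra

variable {m : ℕ}

theorem trC_zero (G : Bil m) : trC G 0 = 0 :=
  Finset.sum_eq_zero fun _ _ ↦ Finset.sum_eq_zero fun _ _ ↦ mul_zero _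

theorem trC_sum (G : Bil m) {ι : Type*} (J : Finset ι) (A : ι → Bil m) :
    trC G (∑ i ∈ J, A i) = ∑ i ∈ J, trC G (A i) := by
  classical
  induction J using Finset.induction_on with
  | empty => exact trC_zero G
  | insert i J hi ih => rw [Finset.sum_insert hi, Finset.sum_insert hi, trC_add, ih]

theorem innerC_add_left (G A A' B : Bil m) :
    innerC G (A + A') B = innerC G A B + innerC G A' B := by
  simp only [innerC, mat_add, Matrix.add_apply, add_mul, mul_add, Finset.sum_add_distrib]

theorem innerC_smul_left (c : ℝ) (G A B : Bil m) : innerC G (c • A) B = c * innerC G A B := by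
  have h : mat (c • A) = c • mat A := rfl
  simp only [innerC, h, Matrix.smul_apply, smul_eq_mul, Finset.mul_sum]
  refine Finset.sum_congr rfl fun i _ ↦ Finset.sum_congr rfl fun j _ ↦
    Finset.sum_congr rfl fun k _ ↦ Finset.sum_congr rfl fun l _ ↦ ?_
  ring

end Algebra

/-! ### First variation of ∫ tr_g(ψ_t* S), and of the energy. -/

section FirstVariation

variable {m n k : ℕ} {M N L : Type*}
  [TopologicalSpace M] [ChartedSpace (E m) M] [TopologicalSpace N] [ChartedSpace (E n) N]
  [TopologicalSpace L] [ChartedSpace (E k) L]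

theorem pullT_comp {ψ : N → L} {φ : M → N} (hψ : ContMDiff 𝓘(ℝ, E n) 𝓘(ℝ, E k) ∞ ψ)
    (hφ : ContMDiff 𝓘(ℝ, E m) 𝓘(ℝ, E n) ∞ φ) (T : L → Bil k) :
    pullT (ψ ∘ φ) T = (pullT φ (pullT (m := n) ψ T) : M → Bil m) := by
  funext x
  rw [pullT, mder_comp (n := n) x (hψ.mdifferentiable (by simp) _) (hφ.mdifferentiable (by simp) _),
    pull_comp]
  rfl

theorem pullT_of_eventuallyEq_id {ψ : M → M} {x : M} (h : ψ =ᶠ[𝓝 x] id) (T : M → Bil m) :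
    pullT ψ T x = T x := by
  rw [pullT, mder_congr h, mder_id, h.self_of_nhds]
  rfl

variable [IsManifold 𝓘(ℝ, E m) ∞ M] [T2Space M]
  {Z : M → E m} {p : M} {C : Set M} {S : M → Bil m}

namespace IsLocalField

variable (hl : IsLocalField Z p C)

include hl

/-- The trace of the pullback of a tensor by the flow, in the chart. -/
noncomputable def chartTrace (g : Metric m M) (S : M → Bil m) (q : ℝ × E m) : ℝ :=
  trC (rep p (metricT g) q.2)
    (pull (rep p S (hl.chartFlow q.1 q.2)) (fderiv ℝ (fun z ↦ hl.chartFlow q.1 z) q.2))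

theorem trT_pullT_localFlow (g : Metric m M) (S : M → Bil m) (t : ℝ) {y : E m}
    (hy : y ∈ (ext m p).target) :
    trT g (pullT (hl.localFlow t) S) ((ext m p).symm y) = hl.chartTrace g S (t, y) := by
  have hev : localRep m m p p (hl.localFlow t) =ᶠ[𝓝 y] fun z ↦ hl.chartFlow t z := by
    filter_upwards [target_mem_nhds hy] with z hz
    show ext m p (hl.localFlow t ((ext m p).symm z)) = _
    rw [hl.localFlow_symm t hz, (ext m p).right_inv (hl.chartFlow_mem_target t hz)]
  rw [trT_symm g _ hy, rep_pullT (q := p) hy ((hl.contMDiff_localFlow t).contMDiffAt) ?_ S,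
    hev.fderiv_eq, hev.self_of_nhds]
  · rfl
  · rw [hl.localFlow_symm t hy]
    exact symm_mem_source (hl.chartFlow_mem_target t hy)

omit [T2Space M] in
theorem contDiffAt_chartTrace (g : Metric m M) (hS : SmoothT S) (t : ℝ) {y : E m}
    (hy : y ∈ (ext m p).target) : ContDiffAt ℝ ∞ (hl.chartTrace g S) (t, y) := by
  have hd (q : ℝ × E m) : fderiv ℝ (fun z ↦ hl.chartFlow q.1 z) q.2 =
      (fderiv ℝ (fun q : ℝ × E m ↦ hl.chartFlow q.1 q.2) q).comp (.inr ℝ ℝ (E m)) :=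
    (HasFDerivAt.comp (f := fun z ↦ (q.1, z)) q.2
      (hl.contDiff_chartFlow.differentiable (by simp) q).hasFDerivAt
      (hasFDerivAt_prodMk_right q.1 q.2)).fderiv
  have h1 : ContDiffAt ℝ ∞ (fun q : ℝ × E m ↦ rep p (metricT g) q.2) (t, y) :=
    ContDiffAt.comp (g := rep p (metricT g)) (t, y) (smoothT_metricT g p y hy) contDiffAt_snd
  have h2 : ContDiffAt ℝ ∞ (fun q : ℝ × E m ↦ rep p S (hl.chartFlow q.1 q.2)) (t, y) :=
    ContDiffAt.comp (g := rep p S) (t, y) (hS p _ (hl.chartFlow_mem_target t hy))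
      hl.contDiff_chartFlow.contDiffAt
  have h3 : ContDiffAt ℝ ∞ (fun q : ℝ × E m ↦ fderiv ℝ (fun z ↦ hl.chartFlow q.1 z) q.2) (t, y) := by
    simp only [hd]
    exact (hl.contDiff_chartFlow.contDiffAt.fderiv_right (m := ∞) (by simp)).clm_comp
      contDiffAt_const
  exact contDiffAt_trC h1 (contDiffAt_pull h2 h3) (isMetric_rep g hy)

omit [IsManifold 𝓘(ℝ, E m) ∞ M] in
theorem pullT_localFlow_of_notMem (S : M → Bil m) (t : ℝ) {x : M} (hx : x ∉ C) :
    pullT (hl.localFlow t) S x = S x := by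
  refine pullT_of_eventuallyEq_id ?_ S
  filter_upwards [hl.isCompact.isClosed.isOpen_compl.mem_nhds hx] with z hz
  exact hl.localFlow_of_notMem t hz

theorem hasDerivAt_trT_pullT_localFlow_zero (g : Metric m M) (hS : SmoothT S) (x : M) :
    HasDerivAt (fun t ↦ trT g (pullT (hl.localFlow t) S) x) (trT g (lieT Z S) x) 0 := by
  by_cases h : x ∈ C
  · have hx := hl.subset h
    have hy : ext m p x ∈ (ext m p).target := (ext m p).map_source hx
    rw [← (ext m p).left_inv hx]
    simp only [hl.trT_pullT_localFlow g S _ hy]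
    rw [trT_symm g _ hy, rep_lieT hl.smooth hS hy]
    have hV (y : E m) : HasDerivAt (fun t ↦ hl.chartFlow t y) (chartField p Z y) 0 := by
      simpa only [hl.chartFlow_zero] using hl.hasDerivAt_chartFlow 0 y
    have h1 := hasDerivAt_pull_flow hl.contDiff_chartFlow hl.chartFlow_zero hV (hS p _ hy)
    have h2 : lieC (chartField p Z) (rep p S) (ext m p x) =
        lieC (fieldInChart p Z) (rep p S) (ext m p x) := by
      have hev : chartField p Z =ᶠ[𝓝 (ext m p x)] fieldInChart p Z := by
        filter_upwards [target_mem_nhds hy] with z hz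
        exact chartField_of_mem Z hz
      rw [lieC, lieC, hev.fderiv_eq, hev.self_of_nhds]
    rw [h2] at h1
    exact HasDerivAt.trC (G := rep p (metricT g) (ext m p x)) h1
  · have hz : Z =ᶠ[𝓝 x] 0 := by
      filter_upwards [hl.isCompact.isClosed.isOpen_compl.mem_nhds h] with z hz
      exact hl.zero z hz
    have h0 : trT g (lieT Z S) x = 0 := by
      rw [trT, lieT_congr hz, lieT_zero]
      exact trC_zero _
    rw [h0]
    simp only [trT, hl.pullT_localFlow_of_notMem S _ h]
    exact hasDerivAt_const _ _

/-- By the group law ψ_{t+s}* S = ψ_s*(ψ_t* S), so this is the case of time 0 for the tensor ψ_t* S.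
-/
theorem hasDerivAt_trT_pullT_localFlow (g : Metric m M) (hS : SmoothT S) (t : ℝ) (x : M) :
    HasDerivAt (fun t ↦ trT g (pullT (hl.localFlow t) S) x)
      (trT g (lieT Z (pullT (hl.localFlow t) S)) x) t := by
  have h := hl.hasDerivAt_trT_pullT_localFlow_zero g (hS.pullT (hl.contMDiff_localFlow t)) x
  have h1 (s : ℝ) : (pullT (hl.localFlow s) (pullT (m := m) (hl.localFlow t) S) : M → Bil m) =
      pullT (hl.localFlow (t + s)) S := by
    rw [← pullT_comp (m := m) (n := m) (k := m) (hl.contMDiff_localFlow t) (hl.contMDiff_localFlow s)]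
    congr 1
    exact funext fun x ↦ (hl.localFlow_add t s x).symm
  simp only [h1] at h
  have h2 := HasDerivAt.comp_sub_const (f := fun s ↦ trT g (pullT (hl.localFlow (t + s)) S) x)
    t t (by simpa only [sub_self] using h)
  simpa only [add_sub_cancel] using h2

variable [MeasurableSpace M] [BorelSpace M]

theorem hasDerivAt_integral_trT (g : Metric m M) (hS : SmoothT S)
    (hint : Integrable (trT g S) (vol g)) :
    HasDerivAt (fun t ↦ ∫ x, trT g (pullT (hl.localFlow t) S) x ∂(vol g))
      (∫ x, trT g (lieT Z S) x ∂(vol g)) 0 := by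
  have := isFiniteMeasureOnCompacts_vol g
  have hid : pullT (hl.localFlow 0) S = S := by
    rw [show hl.localFlow 0 = id from funext hl.localFlow_zero, pullT_id]
  have hsm (t : ℝ) := hS.pullT (hl.contMDiff_localFlow t)
  have h := hasDerivAt_integral_of_compact (μ := vol g) hl.isCompact
    (H := fun t ↦ trT g (pullT (hl.localFlow t) S))
    (H' := fun t ↦ trT g (lieT Z (pullT (hl.localFlow t) S)))
    (hl.hasDerivAt_trT_pullT_localFlow g hS)
    (fun t x hx ↦ by simp only [trT, hl.pullT_localFlow_of_notMem S _ hx])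
    (fun t ↦ ((hsm t).trT g).continuous) (fun t ↦ (((hsm t).lieT hl.smooth).trT g).continuous)
    ?_ (by rwa [hid]) 0
  · rwa [hid] at h
  -- Joint continuity in (t, x) over ℝ × C: over the chart domain the integrand is the time
  -- derivative of the smooth function `chartTrace`.
  · have hfd {q : ℝ × M} (hq : q.2 ∈ (ext m p).source) :
        trT g (lieT Z (pullT (hl.localFlow q.1) S)) q.2 =
          fderiv ℝ (hl.chartTrace g S) (q.1, ext m p q.2) (1, 0) := by
      have hy := (ext m p).map_source hq
      refine (hl.hasDerivAt_trT_pullT_localFlow g hS q.1 q.2).unique ?_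
      rw [← (ext m p).left_inv hq]
      simp only [hl.trT_pullT_localFlow g S _ hy]
      rw [(ext m p).left_inv hq]
      exact HasFDerivAt.comp_hasDerivAt (f := fun t ↦ (t, ext m p q.2)) q.1
        ((hl.contDiffAt_chartTrace g hS q.1 hy).differentiableAt (by simp)).hasFDerivAt
        ((hasDerivAt_id q.1).prodMk (hasDerivAt_const q.1 _))
    refine ContinuousOn.congr ?_ fun q hq ↦ hfd (hl.subset hq.2)
    rintro ⟨t, x⟩ ⟨-, hx⟩
    have hx' := hl.subset hx
    have h1 := ((hl.contDiffAt_chartTrace g hS t ((ext m p).map_source hx')).fderiv_right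
      (m := ∞) (by simp)).continuousAt
    have h2 : ContinuousAt (fun q : ℝ × M ↦ (q.1, ext m p q.2)) (t, x) :=
      continuousAt_fst.prodMk ((contMDiffAt_ext hx').continuousAt.comp
        continuousAt_snd)
    exact ((ContinuousAt.comp (x := (t, x)) h1 h2).clm_apply continuousAt_const).continuousWithinAt

end IsLocalField

variable [SecondCountableTopology M] [MeasurableSpace M] [BorelSpace M]
  [IsManifold 𝓘(ℝ, E n) ∞ N]

/-- The first variation of the energy along a field that is divergence free in the weak sense and
supported in a chart domain. -/
theorem IsRestrictedHarmonic.integral_trT_lieT_eq_zero {g : Metric m M} {h : Metric n N} {φ : M → N}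
    (hφ : IsRestrictedHarmonic g h φ) (hl : IsLocalField Z p C)
    (hdiv : ∀ f : M → ℝ, SmoothS m f → ∫ x, der Z f x ∂(vol g) = 0) :
    ∫ x, trT g (lieT Z (pullT φ (metricT h))) x ∂(vol g) = 0 := by
  have hS := (smoothT_metricT h).pullT hφ.smooth
  have h1 := hφ.critical hl.localDiffeo (hl.isSDiffCurve g hdiv)
  have h2 := (hl.hasDerivAt_integral_trT g hS hφ.finiteEnergy).const_mul (1 / 2 : ℝ)
  -- By functoriality of pullback, the energy density of φ∘ψ_t is half the trace of ψ_t*(φ*h).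
  have h3 : (fun t ↦ dirichletEnergy g h (φ ∘ hl.localDiffeo t)) =
      fun t ↦ 1 / 2 * ∫ x, trT g (pullT (hl.localFlow t) (pullT (m := m) φ (metricT h))) x ∂(vol g) := by
    funext t
    rw [dirichletEnergy, normSqDeriv_eq]
    rw [← pullT_comp (m := m) (n := m) (k := n) hφ.smooth (hl.contMDiff_localFlow t)]
    rfl
  rw [h3] at h1
  have h4 := h2.unique h1
  linarith

end FirstVariation

/-! ### Splitting a bracket into pieces supported in chart domains. -/

section Decomposition

variable {m : ℕ} {M : Type*}
  [TopologicalSpace M] [ChartedSpace (E m) M] [IsManifold 𝓘(ℝ, E m) ∞ M]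

omit [IsManifold 𝓘(ℝ, E m) ∞ M] [ChartedSpace (E m) M] in
theorem eventuallyEq_zero_of_notMem {X : M → E m} {x : M} (hx : x ∉ closure {x | X x ≠ 0}) :
    X =ᶠ[𝓝 x] 0 := by
  filter_upwards [isClosed_closure.isOpen_compl.mem_nhds hx] with z hz
  exact eq_zero_of_notMem hz

omit [IsManifold 𝓘(ℝ, E m) ∞ M] in
theorem lieT_eq_zero_of_notMem {X : M → E m} {x : M} (hx : x ∉ closure {x | X x ≠ 0})
    (T : M → Bil m) : lieT X T x = 0 := by
  rw [lieT_congr (eventuallyEq_zero_of_notMem hx), lieT_zero]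

omit [IsManifold 𝓘(ℝ, E m) ∞ M] in
theorem bracket_eq_zero_of_notMem (Y : M → E m) {X : M → E m} {x : M}
    (hx : x ∉ closure {x | X x ≠ 0}) : bracket Y X x = 0 := by
  have h := fieldInChart_congr (eventuallyEq_zero_of_notMem hx)
  have h0 : fieldInChart x (0 : M → E m) = 0 := funext fun y ↦ (dchart m x _).map_zero
  rw [h0] at h
  rw [bracket, VectorField.lieBracket_eq]
  simp only [h.fderiv_eq, h.self_of_nhds]
  simp

/-- The part of `[Y, X]` that corresponds to a cutoff function `χ`; it acts on functions by
`f ↦ Y (χ X f) - X (χ Y f)`. -/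
noncomputable def cutoffBracket (χ : M → ℝ) (Y X : M → E m) : M → E m :=
  ((fun x ↦ χ x • bracket Y X x) + fun x ↦ der Y χ x • X x) - fun x ↦ der X χ x • Y x

omit [IsManifold 𝓘(ℝ, E m) ∞ M] in
theorem cutoffBracket_apply (χ : M → ℝ) (Y X : M → E m) (x : M) :
    cutoffBracket χ Y X x = χ x • bracket Y X x + der Y χ x • X x - der X χ x • Y x := rfl

theorem SmoothF.cutoffBracket {χ : M → ℝ} {Y X : M → E m} (hχ : SmoothS m χ) (hY : SmoothF Y)
    (hX : SmoothF X) : SmoothF (cutoffBracket χ Y X) :=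
  (((hY.bracket hX).smul hχ).add (hX.smul (hχ.der hY))).sub (hY.smul (hχ.der hX))

/-- The two terms with derivatives of χ are exactly the Leibniz corrections. The resulting form, a
derivative along Y minus one along X, makes the field weakly divergence free for every χ whenever X
and Y are divergence free with compact support. -/
theorem der_cutoffBracket {χ f : M → ℝ} {Y X : M → E m} (hχ : SmoothS m χ) (hY : SmoothF Y)
    (hX : SmoothF X) (hf : SmoothS m f) (x : M) : der (cutoffBracket χ Y X) f x =
      der Y (fun x ↦ χ x * der X f x) x - der X (fun x ↦ χ x * der Y f x) x := by
  rw [der_mul hχ (hf.der hX), der_mul hχ (hf.der hY)]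
  have h : der (cutoffBracket χ Y X) f x = χ x * der (bracket Y X) f x + der Y χ x * der X f x -
      der X χ x * der Y f x := by
    simp only [der, cutoffBracket_apply, map_sub, map_add, map_smul, smul_eq_mul]
  rw [h, der_bracket hY hX hf]
  ring

omit [IsManifold 𝓘(ℝ, E m) ∞ M] in
theorem cutoffBracket_eq_zero_of_notMem {χ : M → ℝ} {X : M → E m} (Y : M → E m) {x : M}
    (hx : x ∉ closure {x | X x ≠ 0} ∩ tsupport χ) : cutoffBracket χ Y X x = 0 := by
  rw [cutoffBracket_apply]
  by_cases h : x ∈ tsupport χ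
  · have h1 : x ∉ closure {x | X x ≠ 0} := fun h' ↦ hx ⟨h', h⟩
    rw [bracket_eq_zero_of_notMem Y h1, eq_zero_of_notMem h1,
      der_eq_zero_of_field (eq_zero_of_notMem h1)]
    simp
  · rw [image_eq_zero_of_notMem_tsupport h, der_eq_zero_of_notMem_tsupport Y h,
      der_eq_zero_of_notMem_tsupport X h]
    simp

/-- The cutoffs add up to 1 near the support of X, so their derivatives add up to 0 there; outside
that support every term vanishes. -/
theorem sum_cutoffBracket {J : Finset M} {χ : M → M → ℝ} (hχ : ∀ i, SmoothS m (χ i))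
    {X : M → E m} (Y : M → E m)
    (hsum : ∀ x ∈ closure {x | X x ≠ 0}, ∀ᶠ z in 𝓝 x, ∑ i ∈ J, χ i z = 1) (x : M) :
    ∑ i ∈ J, cutoffBracket (χ i) Y X x = bracket Y X x := by
  by_cases hx : x ∈ closure {x | X x ≠ 0}
  · have h1 (W : M → E m) : ∑ i ∈ J, der W (χ i) x = 0 := by
      have h2 : (fun z ↦ ∑ i ∈ J, χ i z) =ᶠ[𝓝 x] fun _ ↦ (1 : ℝ) := hsum x hx
      rw [← der_sum J (fun i _ ↦ hχ i), der_congr h2, der]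
      simp only [fderiv_fun_const]
      rfl
    simp only [cutoffBracket_apply, Finset.sum_sub_distrib, Finset.sum_add_distrib,
      ← Finset.sum_smul, h1, (hsum x hx).self_of_nhds, one_smul, zero_smul, add_zero, sub_zero]
  · rw [bracket_eq_zero_of_notMem Y hx]
    exact Finset.sum_eq_zero fun i _ ↦ cutoffBracket_eq_zero_of_notMem Y fun h ↦ hx h.1

omit [IsManifold 𝓘(ℝ, E m) ∞ M] in
theorem lieT_sum {ι : Type*} (J : Finset ι) {X : ι → M → E m} (hX : ∀ i, SmoothF (X i))
    (T : M → Bil m) (x : M) : lieT (∑ i ∈ J, X i) T x = ∑ i ∈ J, lieT (X i) T x := by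
  classical
  have hs (J : Finset ι) : SmoothF (∑ i ∈ J, X i) := by
    induction J using Finset.induction_on with
    | empty => exact smoothF_zero
    | insert i J hi ih => rw [Finset.sum_insert hi]; exact (hX i).add ih
  induction J using Finset.induction_on with
  | empty => exact lieT_zero T x
  | insert i J hi ih => rw [Finset.sum_insert hi, Finset.sum_insert hi, lieT_add (hX i) (hs J), ih]

end Decomposition

/-! ### Symmetry and bilinearity of the Hessian. -/

section Hessian

variable {m n : ℕ} {M N : Type*}
  [TopologicalSpace M] [ChartedSpace (E m) M] [IsManifold 𝓘(ℝ, E m) ∞ M]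
  [T2Space M] [SecondCountableTopology M] [MeasurableSpace M] [BorelSpace M]
  [TopologicalSpace N] [ChartedSpace (E n) N] [IsManifold 𝓘(ℝ, E n) ∞ N]

omit [T2Space M] [SecondCountableTopology M] in
theorem integrable_trT_lieT (g : Metric m M) {X : M → E m} (hX : SmoothF X) (hc : CompactF X)
    {T : M → Bil m} (hT : SmoothT T) : Integrable (trT g (lieT X T)) (vol g) := by
  have := isFiniteMeasureOnCompacts_vol g
  refine ((hT.lieT hX).trT g).continuous.integrable_of_hasCompactSupport ?_
  refine hc.of_isClosed_subset (isClosed_tsupport _) (closure_minimal (fun x hx ↦ ?_)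
    isClosed_closure)
  by_contra h
  refine hx ?_
  rw [trT, lieT_eq_zero_of_notMem h]
  exact trC_zero _

omit [IsManifold 𝓘(ℝ, E m) ∞ M] [T2Space M] [SecondCountableTopology M] [MeasurableSpace M]
  [BorelSpace M] in
theorem CompactF.cutoffBracket {X : M → E m} (hc : CompactF X) (χ : M → ℝ) (Y : M → E m) :
    CompactF (cutoffBracket χ Y X) :=
  hc.of_isClosed_subset isClosed_closure (closure_minimal (fun x hx ↦ by
    by_contra h
    exact hx (cutoffBracket_eq_zero_of_notMem Y fun h' ↦ h h'.1)) isClosed_closure)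

/-- The first variation of the energy of a restricted harmonic map along a bracket of divergence
free fields vanishes. -/
theorem IsRestrictedHarmonic.integral_trT_lieT_bracket {g : Metric m M} {h : Metric n N}
    {φ : M → N} (hφ : IsRestrictedHarmonic g h φ) {X Y : M → E m} (hX : SmoothF X)
    (hXc : CompactF X) (hXd : ∀ x, divergence g X x = 0) (hY : SmoothF Y)
    (hYc : CompactF Y) (hYd : ∀ x, divergence g Y x = 0) :
    ∫ x, trT g (lieT (bracket Y X) (pullT φ (metricT h))) x ∂(vol g) = 0 := by
  obtain ⟨J, χ, hχ, hsub, hsum⟩ := exists_finite_partition (m := m) hXc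
  set S : M → Bil m := pullT φ (metricT h)
  have hS : SmoothT S := (smoothT_metricT h).pullT hφ.smooth
  have hl (i : M) : IsLocalField (cutoffBracket (χ i) Y X) i
      (closure {x | X x ≠ 0} ∩ tsupport (χ i)) :=
    { smooth := SmoothF.cutoffBracket (hχ i) hY hX
      isCompact := hXc.inter_right (isClosed_tsupport _)
      subset := Set.inter_subset_right.trans (hsub i)
      zero := fun _ hx ↦ cutoffBracket_eq_zero_of_notMem Y hx }
  -- The divergence theorem for Y and for X, applied to χ·Xf and χ·Yf.
  have hdiv (i : M) (f : M → ℝ) (hf : SmoothS m f) :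
      ∫ x, der (cutoffBracket (χ i) Y X) f x ∂(vol g) = 0 := by
    have h1 : SmoothS m fun x ↦ χ i x * der X f x := (hχ i).mul (hf.der hX)
    have h2 : SmoothS m fun x ↦ χ i x * der Y f x := (hχ i).mul (hf.der hY)
    simp only [der_cutoffBracket (hχ i) hY hX hf]
    rw [integral_sub (integrable_der g hY hYc h1) (integrable_der g hX hXc h2),
      integral_der_eq_zero g hY hYc hYd h1, integral_der_eq_zero g hX hXc hXd h2, sub_zero]
  have hbr : bracket Y X = ∑ i ∈ J, cutoffBracket (χ i) Y X := by
    funext x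
    rw [Finset.sum_apply, sum_cutoffBracket hχ Y hsum]
  have key (x : M) : trT g (lieT (bracket Y X) S) x =
      ∑ i ∈ J, trT g (lieT (cutoffBracket (χ i) Y X) S) x := by
    rw [trT, hbr, lieT_sum J (fun i ↦ (hl i).smooth), trC_sum]
    rfl
  simp only [key]
  rw [integral_finsetSum _ fun i _ ↦ integrable_trT_lieT g (hl i).smooth (hXc.cutoffBracket _ Y) hS]
  exact Finset.sum_eq_zero fun i _ ↦ hφ.integral_trT_lieT_eq_zero (hl i) (hdiv i)

omit [T2Space M] [SecondCountableTopology M] in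
theorem integrable_innerC_lieT (g : Metric m M) {X Y : M → E m} (hX : SmoothF X) (hXc : CompactF X)
    (hY : SmoothF Y) {T T' : M → Bil m} (hT : SmoothT T) (hT' : SmoothT T') :
    Integrable (fun x ↦ innerC (metricT g x) (lieT X T x) (lieT Y T' x)) (vol g) := by
  have := isFiniteMeasureOnCompacts_vol g
  refine ((hT.lieT hX).innerC g (hT'.lieT hY)).continuous.integrable_of_hasCompactSupport ?_
  refine HasCompactSupport.intro' hXc isClosed_closure fun x hx ↦ ?_
  rw [lieT_eq_zero_of_notMem hx]
  simpa only [zero_smul, zero_mul] using innerC_smul_left 0 (metricT g x) 0 (lieT Y T' x)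

/-- The integrands differ by tr_g(L_[Y,X] S), which integrates to zero by criticality, and by
derivatives along X and Y, which integrate to zero by the divergence theorem. -/
theorem IsRestrictedHarmonic.integral_innerC_lieT_comm {g : Metric m M} {h : Metric n N}
    {φ : M → N} (hφ : IsRestrictedHarmonic g h φ) {X Y : M → E m} (hX : SmoothF X)
    (hXc : CompactF X) (hXd : ∀ x, divergence g X x = 0) (hY : SmoothF Y)
    (hYc : CompactF Y) (hYd : ∀ x, divergence g Y x = 0) :
    ∫ x, innerC (metricT g x) (lieT X (pullT φ (metricT h)) x) (lieT Y (metricT g) x) ∂(vol g) =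
      ∫ x, innerC (metricT g x) (lieT Y (pullT φ (metricT h)) x) (lieT X (metricT g) x)
        ∂(vol g) := by
  have hbr := hφ.integral_trT_lieT_bracket hX hXc hXd hY hYc hYd
  set S : M → Bil m := pullT φ (metricT h)
  have hS : SmoothT S := (smoothT_metricT h).pullT hφ.smooth
  have hSX : SmoothS m (trT g (lieT X S)) := (hS.lieT hX).trT g
  have hSY : SmoothS m (trT g (lieT Y S)) := (hS.lieT hY).trT g
  have i1 := integrable_innerC_lieT g hX hXc hY hS (smoothT_metricT g)
  have i2 := integrable_innerC_lieT g hY hYc hX hS (smoothT_metricT g)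
  have key (x : M) : innerC (metricT g x) (lieT X S x) (lieT Y (metricT g) x) -
      innerC (metricT g x) (lieT Y S x) (lieT X (metricT g) x) =
      trT g (lieT (bracket Y X) S) x - (der Y (trT g (lieT X S)) x - der X (trT g (lieT Y S)) x) := by
    rw [innerC_lieT_metricT g (hS.lieT hX), innerC_lieT_metricT g (hS.lieT hY)]
    have h3 : trT g (lieT (bracket Y X) S) x =
        trT g (lieT Y (lieT X S)) x - trT g (lieT X (lieT Y S)) x := by
      rw [trT, ← lieT_bracket hY hX hS, trC_sub]
      rfl
    rw [h3]
    ring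
  have hdX := integrable_der g hX hXc hSY
  have hdY := integrable_der g hY hYc hSX
  -- By `key` this trace is a combination of functions already known to be integrable.
  have hint : Integrable (trT g (lieT (bracket Y X) S)) (vol g) := by
    refine ((i1.sub i2).add (hdY.sub hdX)).congr (Filter.Eventually.of_forall fun x ↦ ?_)
    simp only [Pi.add_apply, Pi.sub_apply, key]
    ring
  rw [← sub_eq_zero, ← integral_sub i1 i2]
  simp only [key]
  have h5 : ∫ x, (der Y (trT g (lieT X S)) x - der X (trT g (lieT Y S)) x) ∂(vol g) = 0 := by
    rw [integral_sub hdY hdX, integral_der_eq_zero g hY hYc hYd hSX,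
      integral_der_eq_zero g hX hXc hXd hSY, sub_zero]
  refine (integral_sub hint (hdY.sub hdX)).trans ?_
  rw [hbr, zero_sub, neg_eq_zero]
  exact h5

/-- A vector field as a map to `ℝᵐ`. -/
noncomputable def toField (X : SmoothField m M) : M → E m := fun x ↦ X x

omit [T2Space M] [SecondCountableTopology M] [MeasurableSpace M] [BorelSpace M] in
theorem smoothF_toField (X : SmoothField m M) : SmoothF (toField X) := SmoothF.of_section X

omit [T2Space M] [SecondCountableTopology M] [MeasurableSpace M] [BorelSpace M] in
theorem hessDensity_eq (g : Metric m M) (h : Metric n N) {φ : M → N}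
    (hφ : ContMDiff 𝓘(ℝ, E m) 𝓘(ℝ, E n) ∞ φ) (X Y : divFreeFields g) :
    hessDensity g h φ X Y = fun x ↦ innerC (metricT g x)
      (lieT (toField X.1) (pullT φ (metricT h)) x) (lieT (toField Y.1) (metricT g) x) := by
  funext x
  have h1 := lieDeriv_eq (X := toField X.1) ((smoothT_metricT h).pullT hφ)
  have h2 := lieDeriv_eq (X := toField Y.1) (smoothT_metricT g)
  exact (congrArg₂ (fun S T ↦ tensorInner g S T x) h1 h2).trans (tensorInner_eq g _ _ x)

omit [T2Space M] [SecondCountableTopology M] in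
theorem integrable_hessDensity (g : Metric m M) (h : Metric n N) {φ : M → N}
    (hφ : ContMDiff 𝓘(ℝ, E m) 𝓘(ℝ, E n) ∞ φ) (X Y : divFreeFields g) :
    Integrable (hessDensity g h φ X Y) (vol g) := by
  rw [hessDensity_eq g h hφ]
  exact integrable_innerC_lieT g (smoothF_toField _) X.2.1 (smoothF_toField _)
    ((smoothT_metricT h).pullT hφ) (smoothT_metricT g)

theorem IsRestrictedHarmonic.hess_comm {g : Metric m M} {h : Metric n N} {φ : M → N}
    (hφ : IsRestrictedHarmonic g h φ) (X Y : divFreeFields g) :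
    hess g h φ X Y = hess g h φ Y X := by
  rw [hess, hess, hessDensity_eq g h hφ.smooth, hessDensity_eq g h hφ.smooth,
    hφ.integral_innerC_lieT_comm (smoothF_toField _) X.2.1 X.2.2 (smoothF_toField _) Y.2.1 Y.2.2]

omit [T2Space M] [SecondCountableTopology M] in
theorem hess_add_left (g : Metric m M) (h : Metric n N) {φ : M → N}
    (hφ : ContMDiff 𝓘(ℝ, E m) 𝓘(ℝ, E n) ∞ φ) (X X' Y : divFreeFields g) :
    hess g h φ (X + X') Y = hess g h φ X Y + hess g h φ X' Y := by
  have key (x : M) : hessDensity g h φ (X + X') Y x =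
      hessDensity g h φ X Y x + hessDensity g h φ X' Y x := by
    have h1 : toField (X + X').1 = toField X.1 + toField X'.1 := rfl
    simp only [hessDensity_eq g h hφ, h1]
    rw [lieT_add (smoothF_toField _) (smoothF_toField _), innerC_add_left]
  simp only [hess, key]
  rw [integral_add (integrable_hessDensity g h hφ X Y) (integrable_hessDensity g h hφ X' Y), mul_add]

omit [T2Space M] [SecondCountableTopology M] [BorelSpace M] in
theorem hess_smul_left (g : Metric m M) (h : Metric n N) {φ : M → N}
    (hφ : ContMDiff 𝓘(ℝ, E m) 𝓘(ℝ, E n) ∞ φ) (c : ℝ) (X Y : divFreeFields g) :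
    hess g h φ (c • X) Y = c • hess g h φ X Y := by
  have key (x : M) : hessDensity g h φ (c • X) Y x = c * hessDensity g h φ X Y x := by
    have h1 : toField (c • X).1 = c • toField X.1 := rfl
    simp only [hessDensity_eq g h hφ, h1, lieT_smul, innerC_smul_left]
  simp only [hess, key]
  rw [integral_const_mul, mul_left_comm, smul_eq_mul]

end Hessian

end RestrictedHarmonic

theorem proposition3p6 {m n : ℕ} {M N : Type*}
    [TopologicalSpace M] [ChartedSpace (RestrictedHarmonic.E m) M]
    [IsManifold 𝓘(ℝ, RestrictedHarmonic.E m) ∞ M] [T2Space M] [SecondCountableTopology M]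
    [MeasurableSpace M] [BorelSpace M]
    [TopologicalSpace N] [ChartedSpace (RestrictedHarmonic.E n) N]
    [IsManifold 𝓘(ℝ, RestrictedHarmonic.E n) ∞ N] [T2Space N] [SecondCountableTopology N]
    (g : RestrictedHarmonic.Metric m M) (h : RestrictedHarmonic.Metric n N) (φ : M → N)
    (hφ : RestrictedHarmonic.IsRestrictedHarmonic g h φ) :
    (∀ X Y : RestrictedHarmonic.divFreeFields g,
      Integrable (RestrictedHarmonic.hessDensity g h φ X Y) (RestrictedHarmonic.vol g)) ∧
    ∃ B : LinearMap.BilinForm ℝ (RestrictedHarmonic.divFreeFields g),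
      (∀ X Y, B X Y = RestrictedHarmonic.hess g h φ X Y) ∧ ∀ X Y, B X Y = B Y X := by
  refine ⟨RestrictedHarmonic.integrable_hessDensity g h hφ.smooth, ?_⟩
  refine ⟨LinearMap.mk₂ ℝ (RestrictedHarmonic.hess g h φ)
    (RestrictedHarmonic.hess_add_left g h hφ.smooth)
    (RestrictedHarmonic.hess_smul_left g h hφ.smooth) (fun X Y Y' ↦ ?_) (fun c X Y ↦ ?_),
    fun _ _ ↦ rfl, hφ.hess_comm⟩
  -- Linearity in the second argument follows from linearity in the first by symmetry.
  · rw [hφ.hess_comm, RestrictedHarmonic.hess_add_left g h hφ.smooth, hφ.hess_comm Y,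
      hφ.hess_comm Y']
  · rw [hφ.hess_comm, RestrictedHarmonic.hess_smul_left g h hφ.smooth, hφ.hess_comm Y]
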